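/- There is a universal constant $C>0$ such that the following holds. Let $d,r\ge 1$ and let $P_1,\dots,P_r\in\mathbb{C}\langle x_1,\dots,x_d\rangle$ be self-adjoint noncommutative polynomials (with $x_j^*=x_j$) of degrees $\tilde q_1,\dots,\tilde q_r$ (the zero polynomial having degree $0$). Let $s=(s_1,\dots,s_d)$ be a free semicircular family in a $C^*$-probability space $(\mathcal A,\tau)$, that is, a unital $C^*$-algebra with a faithful tracial state $\tau$, in which the $s_j$ are self-adjoint, freely independent and each distributed according to the semicircle law on $[-2,2]$ with density $\frac{1}{2\pi}\sqrt{4-x^2}$. For $N\ge 1$ let $G_1^N,\dots,G_d^N$ be independent GUE matrices of dimension $N$, i.e. Hermitian random matrices whose law has Lebesgue density proportional to $\exp(-\frac N2\operatorname{Tr}H^2)$. Put $X_i^N=P_i(G_1^N,\dots,G_d^N)$, $K_i=(Cd)^{\tilde q_i}\|P_i(s)\|$ and $\operatorname{tr}=\frac1N\operatorname{Tr}$, and write $\|h\|_{[-K,K]}=\sup_{|x|\le K}|h(x)|$. Let $\mathcal P$ be the space of real polynomials in one variable, and $\mathcal P_q$ the subspace of those of degree at most $q$. Then there are $r$-linear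 functionals $\nu_m:\mathcal P^r\to\mathbb R$ $(m=0,1,2,\dots)$ such that for all $m\ge 0$, all integers $q_1,\dots,q_r\ge 1$ and all $h_i\in\mathcal P_{q_i}$ $(i=1,\dots,r)$, \[ |\nu_m(h_1,\dots,h_r)|\le \frac{\bigl(C(\tilde q_1q_1+\cdots+\tilde q_rq_r)\bigr)^{2m}}{m!}\,\|h_1\|_{[-K_1,K_1]}\cdots\|h_r\|_{[-K_r,K_r]}, \] and, for every integer $N\ge 1$ with $N\ge C(\tilde q_1q_1+\cdots+\tilde q_rq_r)$, the random variable $\operatorname{tr}h_1(X_1^N)\cdots\operatorname{tr}h_r(X_r^N)$ is integrable and \[ \left|\mathbb E\bigl[\operatorname{tr}h_1(X_1^N)\cdots\operatorname{tr}h_r(X_r^N)\bigr]-\sum_{k=0}^{m-1}\frac{\nu_k(h_1,\dots,h_r)}{N^k}\right|\le \frac{\bigl(C(\tilde q_1q_1+\cdots+\tilde q_rq_r)\bigr)^{2m}}{m!\,N^m}\,\|h_1\|_{[-K_1,K_1]}\cdots\|h_r\|_{[-K_r,K_r]} \] (with the convention $0^0=1$). Moreover $\nu_m=0$ for every odd $m$.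 -/

import Mathlib

open MeasureTheory ProbabilityTheory Polynomial
open scoped Nat

noncomputable section

namespace MultiTraceGUE

/-! ### Noncommutative polynomials -/

/-- The algebra `ℂ⟨x₁, …, x_d⟩` of noncommutative polynomials: the monoid algebra of the free
monoid of words in `d` letters. -/
abbrev NCPoly (d : ℕ) : Type := MonoidAlgebra ℂ (FreeMonoid (Fin d))

namespace NCPoly

/-- The degree: the maximal length of a word with nonzero coefficient
(`0` for the zero polynomial). -/
def degree {d : ℕ} (P : NCPoly d) : ℕ := P.coeff.support.sup FreeMonoid.length

/-- `P = P*`, where `*` conjugates the coefficients and reverses the words (so `x_j* = x_j`). -/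
def IsSelfAdj {d : ℕ} (P : NCPoly d) : Prop :=
  ∀ w : FreeMonoid (Fin d), P.coeff w.reverse = star (P.coeff w)

/-- The evaluation `P(a₁, …, a_d)` in a unital complex algebra. -/
def eval {d : ℕ} {B : Type*} [Ring B] [Algebra ℂ B] (a : Fin d → B) (P : NCPoly d) : B :=
  MonoidAlgebra.lift ℂ B (FreeMonoid (Fin d)) (FreeMonoid.lift a) P

end NCPoly

/-! ### The Gaussian Unitary Ensemble -/

instance instMeasurableSpaceMatrix {m n α : Type*} [MeasurableSpace α] :
    MeasurableSpace (Matrix m n α) :=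
  inferInstanceAs (MeasurableSpace (m → n → α))

/-- The linear coordinates on the real vector space of Hermitian `N × N` matrices: the diagonal
entries `H i i`, and for `i < j` the real part `x i j` and the imaginary part `x j i` of `H i j`. -/
def hermitianOfReal (N : ℕ) (x : Fin N → Fin N → ℝ) : Matrix (Fin N) (Fin N) ℂ :=
  Matrix.of fun i j =>
    if i = j then (x i i : ℂ)
    else if i < j then (x i j : ℂ) + (x j i : ℂ) * Complex.I
    else (x j i : ℂ) - (x i j : ℂ) * Complex.I

/-- Lebesgue measure on the Hermitian matrices, as a measure on all complex matrices. -/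
def hermitianLebesgue (N : ℕ) : Measure (Matrix (Fin N) (Fin N) ℂ) :=
  Measure.map (hermitianOfReal N) (volume : Measure (Fin N → Fin N → ℝ))

/-- The unnormalized measure with density `exp (-(N/2) Tr H²)`. -/
def gueWeight (N : ℕ) : Measure (Matrix (Fin N) (Fin N) ℂ) :=
  (hermitianLebesgue N).withDensity fun H =>
    ENNReal.ofReal (Real.exp (-((N : ℝ) / 2) * (H * H).trace.re))

/-- The law of an `N × N` GUE matrix: the probability measure on Hermitian matrices whose Lebesgue
density is proportional to `exp (-(N/2) Tr H²)`. -/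
def gue (N : ℕ) : Measure (Matrix (Fin N) (Fin N) ℂ) :=
  (gueWeight N Set.univ)⁻¹ • gueWeight N

/-- `G₁, …, G_d` are independent `N × N` GUE matrices on the probability space `(Ω, μ)`. -/
structure IsIndepGUE {Ω : Type*} [MeasurableSpace Ω] (μ : Measure Ω) {d N : ℕ}
    (G : Fin d → Ω → Matrix (Fin N) (Fin N) ℂ) : Prop where
  hasLaw : ∀ j, HasLaw (G j) (gue N) μ
  indep : iIndepFun G μ

/-- The normalized trace `tr M = N⁻¹ Tr M`. -/
def ntr {N : ℕ} (M : Matrix (Fin N) (Fin N) ℂ) : ℂ := (N : ℂ)⁻¹ * M.trace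

/-! ### Free semicircular families -/

section Free

variable {A : Type*} [CStarAlgebra A]

/-- `τ` is a faithful tracial state, i.e. `(A, τ)` is a C*-probability space. -/
structure IsFaithfulTrace (τ : A →ₗ[ℂ] ℂ) : Prop where
  map_one : τ 1 = 1
  nonneg : ∀ a, 0 ≤ (τ (star a * a)).re ∧ (τ (star a * a)).im = 0
  tracial : ∀ a b, τ (a * b) = τ (b * a)
  faithful : ∀ a, τ (star a * a) = 0 → a = 0

/-- Free independence of a family of unital *-subalgebras: an alternating product of `τ`-centred
elements (neighbours from different subalgebras) is `τ`-centred. -/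
def FreeSubalgebras {ι : Type*} (τ : A →ₗ[ℂ] ℂ) (B : ι → StarSubalgebra ℂ A) : Prop :=
  ∀ l : List (ι × A), l ≠ [] → l.IsChain (fun p p' => p.1 ≠ p'.1) →
    (∀ p ∈ l, p.2 ∈ B p.1 ∧ τ p.2 = 0) → τ (l.map Prod.snd).prod = 0

/-- `a` is self-adjoint and its distribution is the semicircle law on `[-2, 2]`, with density
`(2π)⁻¹ √(4 - x²)`. -/
def IsSemicircular (τ : A →ₗ[ℂ] ℂ) (a : A) : Prop :=
  IsSelfAdjoint a ∧
    ∀ k : ℕ, τ (a ^ k) =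
      ((∫ x in (-2 : ℝ)..2, x ^ k * ((2 * Real.pi)⁻¹ * Real.sqrt (4 - x ^ 2)) : ℝ) : ℂ)

/-- A free semicircular family: freely independent elements (that is, the unital *-algebras they
generate are free), each with the standard semicircle law. -/
structure IsFreeSemicircular {d : ℕ} (τ : A →ₗ[ℂ] ℂ) (s : Fin d → A) : Prop where
  semicircular : ∀ j, IsSemicircular τ (s j)
  free : FreeSubalgebras τ fun j => StarAlgebra.adjoin ℂ {s j}

end Free

/-- The uniform norm `‖h‖_{[-K,K]}` of a real polynomial. -/
def supNorm (K : ℝ) (h : ℝ[X]) : ℝ := ⨆ x : Set.Icc (-K) K, |h.eval (x : ℝ)|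

/-- `q̃₁ q₁ + ⋯ + q̃_r q_r`, where `q̃_i` is the degree of `P_i`. -/
def totalDegree {d r : ℕ} (P : Fin r → NCPoly d) (q : Fin r → ℕ) : ℕ :=
  ∑ i, (P i).degree * q i

/-- The radius `K = (C d)^{q̃} ‖P(s)‖`, where `q̃` is the degree of `P`. -/
def radius {A : Type*} [CStarAlgebra A] {d : ℕ} (C : ℝ) (s : Fin d → A) (P : NCPoly d) : ℝ :=
  (C * d) ^ P.degree * ‖P.eval s‖

/-- The random variable `tr h₁(P₁(G)) ⋯ tr h_r(P_r(G))`. -/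
def multiTrace {d r N : ℕ} (P : Fin r → NCPoly d) (h : Fin r → ℝ[X])
    (G : Fin d → Matrix (Fin N) (Fin N) ℂ) : ℂ :=
  ∏ i, ntr (aeval ((P i).eval G) (h i))

end MultiTraceGUE

end

set_option linter.unusedSectionVars false

noncomputable section

namespace MultiTraceGUE

/-! ### Gaussian expectations of polynomials -/

section Gaussian

/-! Write `D = Σ q̃ᵢ qᵢ` and `M = ∏ ‖hᵢ‖`. The mean of `∏ tr hᵢ(Xᵢ)` is `f(1/N)` for an even
polynomial `f` of degree at most `D`: Gaussian integration by parts replaces products of traces of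
words by shorter ones, with a weight `N⁻²` whenever two traces merge (`schwinger_dyson`,
`exists_isExpansion_wordTrProd`). The functional `ν_m` is the `m`-th coefficient of `f`, so it
vanishes for odd `m`. What remains is to bound the coefficients and Taylor remainders of `f`, and
this only needs a bound on `f` at the points `1/N` with `N ≥ 2D`.

The a priori bound is `|f(1/N)| ≤ M`, with constant one as the case `m = 0` demands
(`abs_re_gaussE_multiTracePoly_le`). The same recursion bounds the moments of order up to `N`
exponentially (`norm_gaussE_wordTrProd_le`), so by Markov's inequality all `‖G_j‖` are at most a
constant times `√d` off an event whose probability is exponentially small in `N`, at a rate tuned by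
the constant. There `‖Pᵢ(G)‖ ≤ Kᵢ`, by `norm_eval_sq_le`: expand `Pᵢ` in noncommutative Chebyshev
words. They are orthonormal for `τ` at `s`, so the coefficients have `ℓ²` norm at most `‖Pᵢ(s)‖`,
and Cauchy–Schwarz finishes. Hence the bound holds pointwise off the bad event. It passes to the
mean without loss because `∏ tr hᵢ(Xᵢ)` is itself a Gaussian polynomial of degree at most `D`, and
by hypercontractivity such a polynomial has nonnegative mean once it is nonnegative off a set of
measure of order `9⁻ᴰ` (`gaussE_nonneg_of_nonneg_off`). This is applied to `M` plus and minus the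
real part.

The last step is a statement about one-variable polynomials (`exists_coeff_remainder_bound`).
Evenness makes `0` interior to the sampled set `{±1/N}`, so Bernstein's inequality, which costs `D`
where Markov's would cost `D²`, fills the gaps between sample points: `|f| ≤ 2M` on an interval
about `0` of length of order `1/D` (`abs_eval_le_of_discrete`). Cauchy's estimate on a disc of
radius proportional to `k` bounds the `k`-th coefficient by `(CD)^(2k)/k! · M`, one factor `Dᵏ`
coming from the length of the interval and one from the degree. Remainders are then compared with
the terms of an exponential series. -/

/-- The standard Gaussian measure on `ℝ^ι`. -/
def stdGauss (ι : Type*) [Fintype ι] : Measure (ι → ℝ) := Measure.pi fun _ => gaussianReal 0 1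

instance {ι : Type*} [Fintype ι] : IsProbabilityMeasure (stdGauss ι) := by
  unfold stdGauss; infer_instance

lemma integrable_pow_gaussianReal (k : ℕ) : Integrable (fun x : ℝ => x ^ k) (gaussianReal 0 1) := by
  have h := (memLp_id_gaussianReal (μ := 0) (v := 1) (k : NNReal)).integrable_norm_pow'
  refine h.mono' (by fun_prop) (Filter.Eventually.of_forall fun x => ?_)
  simp

/-- Integration by parts against the density, whose derivative is `-x` times itself. -/
lemma integral_pow_gaussianReal_add_two (k : ℕ) :
    ∫ x : ℝ, x ^ (k + 2) ∂gaussianReal 0 1 = (k + 1) * ∫ x : ℝ, x ^ k ∂gaussianReal 0 1 := by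
  have hi : ∀ n : ℕ, Integrable (fun x : ℝ => x ^ n * gaussianPDFReal 0 1 x) := by
    intro n
    have h := integrable_pow_gaussianReal n
    rw [gaussianReal_of_var_ne_zero _ one_ne_zero] at h
    unfold gaussianPDF at h
    rw [integrable_withDensity_iff_integrable_smul₀' (by fun_prop) (by simp)] at h
    refine h.congr (Filter.Eventually.of_forall fun x => ?_)
    simp [gaussianPDFReal_nonneg, mul_comm]
  have hd : ∀ x : ℝ, HasDerivAt (gaussianPDFReal 0 1) (-x * gaussianPDFReal 0 1 x) x := by
    intro x
    unfold gaussianPDFReal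
    have h1 : HasDerivAt (fun x : ℝ => -(x - 0) ^ 2 / (2 * ((1 : NNReal) : ℝ))) (-x) x := by
      have := ((hasDerivAt_pow 2 x).neg).div_const 2
      simp only [sub_zero, NNReal.coe_one, mul_one]
      refine this.congr_deriv ?_
      push_cast; ring
    refine (h1.exp.const_mul (√(2 * Real.pi * ((1 : NNReal) : ℝ)))⁻¹).congr_deriv ?_
    ring
  have key := integral_mul_deriv_eq_deriv_mul_of_integrable
    (u := fun x : ℝ => x ^ (k + 1)) (v := gaussianPDFReal 0 1)
    (u' := fun x => (k + 1 : ℝ) * x ^ k) (v' := fun x => -x * gaussianPDFReal 0 1 x)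
    (fun x _ => by simpa using hasDerivAt_pow (k + 1) x) (fun x _ => hd x)
    (by
      refine ((hi (k + 2)).neg).congr (Filter.Eventually.of_forall fun x => ?_)
      simp only [Pi.neg_apply, Pi.mul_apply]; ring)
    (by
      refine ((hi k).const_mul (k + 1 : ℝ)).congr (Filter.Eventually.of_forall fun x => ?_)
      simp only [Pi.mul_apply]; ring)
    (hi (k + 1))
  rw [integral_gaussianReal_eq_integral_smul one_ne_zero,
    integral_gaussianReal_eq_integral_smul one_ne_zero]
  simp only [smul_eq_mul]
  calc ∫ x : ℝ, gaussianPDFReal 0 1 x * x ^ (k + 2)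
      = - ∫ x : ℝ, x ^ (k + 1) * (-x * gaussianPDFReal 0 1 x) := by
        rw [← integral_neg]; congr 1; ext x; ring
    _ = ∫ x : ℝ, (k + 1) * x ^ k * gaussianPDFReal 0 1 x := by rw [key]; simp
    _ = _ := by rw [← integral_const_mul]; congr 1; ext x; ring

variable {𝕜 : Type*} [RCLike 𝕜]

/-- The value of a polynomial at a real point. -/
def evalReal {ι : Type*} (x : ι → ℝ) : MvPolynomial ι 𝕜 →ₐ[𝕜] 𝕜 := MvPolynomial.aeval fun i => (x i : 𝕜)

lemma evalReal_monomial {ι : Type*} [Fintype ι] (x : ι → ℝ) (α : ι →₀ ℕ) (c : 𝕜) :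
    evalReal x (MvPolynomial.monomial α c) = c * ((∏ i, x i ^ α i : ℝ) : 𝕜) := by
  simp [evalReal, MvPolynomial.aeval_monomial, Finsupp.prod_fintype]

lemma continuous_evalReal {ι : Type*} (p : MvPolynomial ι 𝕜) :
    Continuous fun x : ι → ℝ => evalReal x p := by
  unfold evalReal
  simp only [MvPolynomial.aeval_def]
  have := MvPolynomial.continuous_eval p (X := 𝕜) (σ := ι)
  simp only [Algebra.algebraMap_self]
  exact this.comp (by fun_prop : Continuous fun x : ι → ℝ => fun i => (x i : 𝕜))

variable {ι : Type*} [Fintype ι]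

lemma integrable_prod_pow_stdGauss (α : ι →₀ ℕ) :
    Integrable (fun x : ι → ℝ => ∏ i, x i ^ α i) (stdGauss ι) :=
  Integrable.fintype_prod (f := fun i (t : ℝ) => t ^ α i) fun _ => integrable_pow_gaussianReal _

lemma integral_prod_pow_stdGauss (α : ι →₀ ℕ) :
    ∫ x : ι → ℝ, ∏ i, x i ^ α i ∂stdGauss ι = ∏ i, ∫ t : ℝ, t ^ α i ∂gaussianReal 0 1 :=
  integral_fintype_prod_eq_prod (𝕜 := ℝ) (fun i (t : ℝ) => t ^ α i)

lemma integrable_evalReal (p : MvPolynomial ι 𝕜) :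
    Integrable (fun x => evalReal x p) (stdGauss ι) := by
  induction p using MvPolynomial.induction_on' with
  | monomial α c =>
    simp only [evalReal_monomial]
    exact ((integrable_prod_pow_stdGauss α).ofReal).const_mul c
  | add p q hp hq => simp only [map_add]; exact hp.add hq

/-- The expectation of a polynomial in independent standard Gaussian variables. -/
def gaussE (ι 𝕜 : Type*) [Fintype ι] [RCLike 𝕜] : MvPolynomial ι 𝕜 →ₗ[𝕜] 𝕜 where
  toFun p := ∫ x, evalReal x p ∂stdGauss ι
  map_add' p q := by
    simp only [map_add]; exact integral_add (integrable_evalReal p) (integrable_evalReal q)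
  map_smul' c p := by simp only [map_smul]; exact integral_smul c _

lemma gaussE_apply (p : MvPolynomial ι 𝕜) : gaussE ι 𝕜 p = ∫ x, evalReal x p ∂stdGauss ι := rfl

lemma gaussE_one : gaussE ι 𝕜 1 = 1 := by simp [gaussE_apply]

lemma gaussE_monomial (α : ι →₀ ℕ) (c : 𝕜) :
    gaussE ι 𝕜 (MvPolynomial.monomial α c) =
      c * ((∏ i, ∫ t : ℝ, t ^ α i ∂gaussianReal 0 1 : ℝ) : 𝕜) := by
  simp only [gaussE_apply, evalReal_monomial]
  rw [integral_const_mul, integral_ofReal, integral_prod_pow_stdGauss]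

variable [DecidableEq ι]

/-- Gaussian integration by parts. -/
lemma gaussE_X_mul (j : ι) (p : MvPolynomial ι 𝕜) :
    gaussE ι 𝕜 (MvPolynomial.X j * p) = gaussE ι 𝕜 (MvPolynomial.pderiv j p) := by
  induction p using MvPolynomial.induction_on' with
  | add p q hp hq => simp only [mul_add, map_add, hp, hq]
  | monomial α c =>
    rw [MvPolynomial.X, MvPolynomial.monomial_mul, one_mul, MvPolynomial.pderiv_monomial, gaussE_monomial,
      gaussE_monomial, mul_assoc]
    congr 1
    rw [← RCLike.ofReal_natCast (K := 𝕜) (α j), ← RCLike.ofReal_mul]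
    congr 1
    rw [← Finset.mul_prod_erase _ _ (Finset.mem_univ j),
      ← Finset.mul_prod_erase _ _ (Finset.mem_univ j), ← mul_assoc]
    congr 1
    -- Only the factor in the variable `j` changes, and there the claim is the moment recursion;
    -- exponent `0` is the vanishing of the mean.
    · rcases hk : α j with _ | _ | k
      · simp [hk, integral_id_gaussianReal]
      · have := integral_pow_gaussianReal_add_two 0
        simp [hk] at this ⊢
        exact this
      · have := integral_pow_gaussianReal_add_two (k + 1)
        simp [hk] at this ⊢
        rw [← this, add_comm 1]
    · refine Finset.prod_congr rfl fun i hi => ?_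
      have : j ≠ i := (Finset.ne_of_mem_erase hi).symm
      simp [this]

end Gaussian

/-! ### Hypercontractivity for Gaussian polynomials -/

section Hypercontractivity

open MvPolynomial (pderiv)

variable {ι : Type*} [Fintype ι] [DecidableEq ι]

/-- The pairing `⟨E ∇ᵏ f, E ∇ᵏ g⟩`. -/
def gradForm : ℕ → MvPolynomial ι ℝ → MvPolynomial ι ℝ → ℝ
  | 0, f, g => gaussE ι ℝ f * gaussE ι ℝ g
  | k + 1, f, g => ∑ i, gradForm k (pderiv i f) (pderiv i g)

/-- The energy `E ‖∇ˢ f‖²`. -/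
def gradEnergy : ℕ → MvPolynomial ι ℝ → ℝ
  | 0, f => gaussE ι ℝ (f * f)
  | s + 1, f => ∑ i, gradEnergy s (pderiv i f)

lemma gradForm_add_left (k : ℕ) (f f' g : MvPolynomial ι ℝ) :
    gradForm k (f + f') g = gradForm k f g + gradForm k f' g := by
  induction k generalizing f f' g with
  | zero => simp [gradForm, add_mul]
  | succ k ih => simp [gradForm, ih, Finset.sum_add_distrib]

lemma gradForm_zero_left (k : ℕ) (g : MvPolynomial ι ℝ) : gradForm k 0 g = 0 := by
  have := gradForm_add_left k 0 0 g
  simpa using this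

lemma gradForm_self_nonneg (k : ℕ) (f : MvPolynomial ι ℝ) : 0 ≤ gradForm k f f := by
  induction k generalizing f with
  | zero => exact mul_self_nonneg _
  | succ k ih => exact Finset.sum_nonneg fun i _ => ih _

lemma gradForm_add_self_le (k : ℕ) (f g : MvPolynomial ι ℝ) :
    gradForm k (f + g) (f + g) ≤ 2 * (gradForm k f f + gradForm k g g) := by
  induction k generalizing f g with
  | zero =>
    simp only [gradForm, map_add]
    nlinarith [sq_nonneg (gaussE ι ℝ f - gaussE ι ℝ g)]
  | succ k ih =>
    simp only [gradForm, map_add, ← Finset.sum_add_distrib, Finset.mul_sum]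
    exact Finset.sum_le_sum fun i _ => ih _ _

lemma pderiv_pderiv_comm (i j : ι) (f : MvPolynomial ι ℝ) :
    pderiv i (pderiv j f) = pderiv j (pderiv i f) := by
  induction f using MvPolynomial.induction_on with
  | C a => simp
  | add p q hp hq => simp [hp, hq]
  | mul_X p k hp =>
    simp only [Derivation.leibniz, map_add, smul_eq_mul, hp]
    have h : ∀ a b : ι, pderiv a (pderiv b (MvPolynomial.X k : MvPolynomial ι ℝ)) = 0 := by
      intro a b
      rcases eq_or_ne k b with rfl | hb
      · simp
      · simp [MvPolynomial.pderiv_X_of_ne hb]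
    rw [h, h]; ring

/-- Any one of the `k` derivatives may hit the factor `x_j`; if none does, Gaussian integration by
parts removes it. The truncated `k - 1` is harmless because its coefficient vanishes at `k = 0`. -/
lemma gradForm_X_mul (k : ℕ) (j : ι) (f g : MvPolynomial ι ℝ) :
    gradForm k (MvPolynomial.X j * f) g =
      gradForm k (pderiv j f) g + k * gradForm (k - 1) f (pderiv j g) := by
  induction k generalizing f g with
  | zero => simp [gradForm, gaussE_X_mul]
  | succ k ih =>
    have h1 : ∀ i, pderiv i (MvPolynomial.X j * f) =
        MvPolynomial.X j * pderiv i f + (if i = j then f else 0) := by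
      intro i
      rw [Derivation.leibniz]
      split_ifs with h
      · subst h; simp
      · simp [MvPolynomial.pderiv_X_of_ne (Ne.symm h)]
    simp only [gradForm, h1, gradForm_add_left, ih, Finset.sum_add_distrib]
    have h2 : ∑ i, gradForm k (if i = j then f else 0) (pderiv i g) = gradForm k f (pderiv j g) := by
      rw [Finset.sum_eq_single j]
      · simp
      · intro i _ hi; simp [hi, gradForm_zero_left]
      · simp
    rw [h2, ← Finset.mul_sum]
    have h3 : (k : ℝ) * ∑ i, gradForm (k - 1) (pderiv i f) (pderiv j (pderiv i g)) =
        k * gradForm k f (pderiv j g) := by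
      rcases k with _ | k
      · simp
      · simp only [Nat.add_sub_cancel, gradForm]
        simp only [pderiv_pderiv_comm j]
    rw [h3]
    simp only [pderiv_pderiv_comm j]
    push_cast [Nat.add_sub_cancel]
    ring

lemma totalDegree_pderiv_le (i : ι) (f : MvPolynomial ι ℝ) :
    (pderiv i f).totalDegree ≤ f.totalDegree - 1 := by
  have hs : pderiv i f = ∑ α ∈ f.support, pderiv i (MvPolynomial.monomial α (f.coeff α)) := by
    rw [← map_sum, ← f.as_sum]
  rw [hs]
  refine (MvPolynomial.totalDegree_finsetSum_le fun α hα => ?_)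
  rw [MvPolynomial.pderiv_monomial]
  have h1 := MvPolynomial.le_totalDegree hα
  rcases Nat.eq_zero_or_pos (α i) with h0 | h0
  · simp [h0]
  refine (MvPolynomial.totalDegree_monomial_le _ _).trans ?_
  have h2 : (α - Finsupp.single i 1) + Finsupp.single i 1 = α :=
    tsub_add_cancel_of_le (by simpa using Nat.succ_le_of_lt h0)
  have h3 : (α.sum fun _ e => e) =
      ((α - Finsupp.single i 1).sum fun _ e => e) + 1 := by
    conv_lhs => rw [← h2]
    rw [Finsupp.sum_add_index' (by simp) (by simp), Finsupp.sum_single_index rfl]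
  simp only [Function.id_def] at *
  omega

lemma gradForm_eq_zero (k : ℕ) (f g : MvPolynomial ι ℝ) (h : f.totalDegree < k) :
    gradForm k f g = 0 := by
  induction k generalizing f g with
  | zero => simp at h
  | succ k ih =>
    rw [gradForm]
    refine Finset.sum_eq_zero fun i _ => ?_
    rcases Nat.eq_zero_or_pos f.totalDegree with h0 | h0
    · rw [MvPolynomial.totalDegree_eq_zero_iff_eq_C] at h0
      rw [h0]; simp [gradForm_zero_left]
    · refine ih _ _ (lt_of_le_of_lt (totalDegree_pderiv_le i f) (by omega))

/-- Parseval for the Hermite expansion, without Hermite polynomials. For a monomial `f = x_j p`,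
integration by parts gives `E[p ∂_j g] + E[(∂_j p) g]`, and by `gradForm_X_mul` the right side
satisfies the same recursion in the degree. -/
lemma gaussE_mul_eq_sum (n : ℕ) (f g : MvPolynomial ι ℝ) (hf : f.totalDegree ≤ n) :
    gaussE ι ℝ (f * g) = ∑ k ∈ Finset.range (n + 1), gradForm k f g / k ! := by
  induction n using Nat.strong_induction_on generalizing f g with
  | _ n ih =>
  have hlin : ∀ (s : Finset (ι →₀ ℕ)) (F : (ι →₀ ℕ) → MvPolynomial ι ℝ),
      (∀ α ∈ s, gaussE ι ℝ (F α * g) =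
        ∑ k ∈ Finset.range (n + 1), gradForm k (F α) g / k !) →
      gaussE ι ℝ ((∑ α ∈ s, F α) * g) =
        ∑ k ∈ Finset.range (n + 1), gradForm k (∑ α ∈ s, F α) g / k ! := by
    intro s F
    induction s using Finset.induction_on with
    | empty => intro _; simp [gradForm_zero_left]
    | insert a s ha ihs =>
      intro h
      rw [Finset.sum_insert ha, add_mul, map_add, h a (by simp),
        ihs fun α hα => h α (Finset.mem_insert_of_mem hα), ← Finset.sum_add_distrib]
      exact Finset.sum_congr rfl fun k _ => by rw [gradForm_add_left, add_div]
  rw [f.as_sum]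
  refine hlin _ _ fun α hα => ?_
  have hα' := (MvPolynomial.le_totalDegree hα).trans hf
  generalize f.coeff α = c
  by_cases h0 : α = 0
  · subst h0
    rw [Finset.sum_range_succ']
    have : ∀ k, gradForm (k + 1) (MvPolynomial.monomial (0 : ι →₀ ℕ) c) g = 0 := by
      intro k
      refine gradForm_eq_zero _ _ _ ?_
      change (MvPolynomial.C c : MvPolynomial ι ℝ).totalDegree < _
      simp
    simp only [this]
    change gaussE ι ℝ (MvPolynomial.C c * g) = _
    rw [← MvPolynomial.smul_eq_C_mul, map_smul]
    have h1 : gaussE ι ℝ (MvPolynomial.monomial (0 : ι →₀ ℕ) c) = c := by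
      rw [gaussE_monomial]; simp
    simp only [gradForm, h1]
    simp
  · obtain ⟨j, hj⟩ : ∃ j, α j ≠ 0 := by
      by_contra! h; exact h0 (Finsupp.ext h)
    have h2 : Finsupp.single j 1 + (α - Finsupp.single j 1) = α :=
      add_tsub_cancel_of_le (by simpa using Nat.one_le_iff_ne_zero.2 hj)
    set β := α - Finsupp.single j 1 with hβ
    have h3 : (α.sum fun _ e => e) = 1 + (β.sum fun _ e => e) := by
      conv_lhs => rw [← h2]
      rw [Finsupp.sum_add_index' (by simp) (by simp), Finsupp.sum_single_index rfl]
    have hm : MvPolynomial.monomial α c = MvPolynomial.X j * MvPolynomial.monomial β c := by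
      rw [MvPolynomial.X, MvPolynomial.monomial_mul, one_mul, h2]
    obtain ⟨m, rfl⟩ : ∃ m, n = m + 1 := ⟨n - 1, by omega⟩
    set p : MvPolynomial ι ℝ := MvPolynomial.monomial β c with hp
    have hpd : p.totalDegree ≤ m := by
      have := MvPolynomial.totalDegree_monomial_le β c
      simp only [Function.id_def] at this
      exact this.trans (by omega)
    have hpd' : (pderiv j p).totalDegree ≤ m := (totalDegree_pderiv_le j p).trans (by omega)
    rw [hm, mul_assoc, gaussE_X_mul, Derivation.leibniz, map_add, smul_eq_mul, smul_eq_mul,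
      ih m (by omega) p _ hpd, mul_comm g, ih m (by omega) _ g hpd']
    simp only [gradForm_X_mul, add_div, Finset.sum_add_distrib]
    rw [Finset.sum_range_succ _ (m + 1),
      gradForm_eq_zero (m + 1) _ _ (lt_of_le_of_lt hpd' (Nat.lt_succ_self m)),
      Finset.sum_range_succ' (fun k => (k : ℝ) * gradForm (k - 1) p (pderiv j g) / (k ! : ℝ))]
    simp only [Nat.cast_zero, zero_mul, zero_div, add_zero, Nat.add_sub_cancel]
    rw [add_comm]
    congr 1
    refine Finset.sum_congr rfl fun k _ => ?_
    rw [Nat.factorial_succ]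
    push_cast
    field_simp

lemma gradEnergy_eq_sum (s n : ℕ) (f : MvPolynomial ι ℝ) (hf : f.totalDegree ≤ n) :
    gradEnergy s f = ∑ k ∈ Finset.range (n + 1), gradForm (k + s) f f / k ! := by
  induction s generalizing f with
  | zero => exact gaussE_mul_eq_sum n f f hf
  | succ s ih =>
    simp only [gradEnergy]
    rw [Finset.sum_congr rfl fun i _ =>
      ih (pderiv i f) ((totalDegree_pderiv_le i f).trans (by omega)), Finset.sum_comm]
    refine Finset.sum_congr rfl fun k _ => ?_
    rw [← Finset.sum_div]
    rfl

lemma gradEnergy_nonneg (s : ℕ) (f : MvPolynomial ι ℝ) : 0 ≤ gradEnergy s f := by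
  rw [gradEnergy_eq_sum s _ f le_rfl]
  exact Finset.sum_nonneg fun k _ => div_nonneg (gradForm_self_nonneg _ _) (by positivity)

/-- On the `k`-th chaos, `∇ˢ` multiplies the squared norm by `k(k-1)⋯(k-s+1)`, which is largest at
the top degree `n`. -/
lemma gradEnergy_le (s n : ℕ) (f : MvPolynomial ι ℝ) (hf : f.totalDegree ≤ n) :
    gradEnergy s f ≤ n.descFactorial s * gaussE ι ℝ (f * f) := by
  rw [gradEnergy_eq_sum s n f hf, gaussE_mul_eq_sum n f f hf]
  have hz : ∀ k, n < k → gradForm k f f = 0 := fun k hk =>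
    gradForm_eq_zero k f f (lt_of_le_of_lt hf hk)
  have h1 : ∀ k ∈ Finset.range (n + 1), gradForm (k + s) f f / (k ! : ℝ) ≤
      n.descFactorial s * (gradForm (k + s) f f / ((k + s)! : ℝ)) := by
    intro k _
    rcases lt_or_ge n (k + s) with h | h
    · simp [hz _ h]
    · have h2 : ((k + s)! : ℝ) = k ! * (k + s).descFactorial s := by
        have := Nat.factorial_mul_descFactorial (Nat.le_add_left s k)
        rw [Nat.add_sub_cancel] at this
        exact_mod_cast this.symm
      have h3 : ((k + s).descFactorial s : ℝ) ≤ n.descFactorial s := by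
        exact_mod_cast Nat.descFactorial_le s h
      have h4 : (0 : ℝ) < (k + s).descFactorial s := by
        exact_mod_cast Nat.descFactorial_pos.2 (Nat.le_add_left s k)
      rw [h2, div_le_iff₀ (by positivity)]
      have h5 := gradForm_self_nonneg (k + s) f
      have h6 : (n.descFactorial s : ℝ) *
          (gradForm (k + s) f f / (k ! * (k + s).descFactorial s)) * k ! =
          gradForm (k + s) f f * (n.descFactorial s / (k + s).descFactorial s) := by
        field_simp
      rw [h6]
      exact le_mul_of_one_le_right h5 ((one_le_div h4).2 h3)
  refine (Finset.sum_le_sum h1).trans ?_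
  rw [← Finset.mul_sum]
  refine mul_le_mul_of_nonneg_left ?_ (by positivity)
  have h7 : ∑ k ∈ Finset.range (n + 1), gradForm k f f / (k ! : ℝ) =
      ∑ k ∈ Finset.range (s + (n + 1)), gradForm k f f / (k ! : ℝ) := by
    refine Finset.sum_subset (Finset.range_subset_range.2 (by omega)) fun k _ hk => ?_
    rw [hz k (by simpa using hk), zero_div]
  rw [h7, Finset.sum_range_add _ s (n + 1)]
  have h9 : ∑ k ∈ Finset.range (n + 1), gradForm (k + s) f f / ((k + s)! : ℝ) =
      ∑ k ∈ Finset.range (n + 1), gradForm (s + k) f f / ((s + k)! : ℝ) := by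
    simp only [add_comm s]
  have h8 : 0 ≤ ∑ k ∈ Finset.range s, gradForm k f f / (k ! : ℝ) :=
    Finset.sum_nonneg fun k _ => div_nonneg (gradForm_self_nonneg _ _) (by positivity)
  linarith

lemma gaussE_mul_self_nonneg (f : MvPolynomial ι ℝ) : 0 ≤ gaussE ι ℝ (f * f) :=
  gradEnergy_nonneg 0 f

lemma gaussE_mul_sq_le (f g : MvPolynomial ι ℝ) :
    gaussE ι ℝ (f * g) * gaussE ι ℝ (f * g) ≤ gaussE ι ℝ (f * f) * gaussE ι ℝ (g * g) := by
  have h := discrim_le_zero (a := gaussE ι ℝ (g * g)) (b := 2 * gaussE ι ℝ (f * g))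
    (c := gaussE ι ℝ (f * f)) fun t => by
      have := gaussE_mul_self_nonneg (f + t • g)
      have e : (f + t • g) * (f + t • g) = f * f + (2 * t) • (f * g) + (t * t) • (g * g) := by
        simp only [MvPolynomial.smul_eq_C_mul, map_mul]
        have : (MvPolynomial.C (2 : ℝ) : MvPolynomial ι ℝ) = 2 := rfl
        rw [this]; ring
      rw [e] at this
      simp only [map_add, map_smul, smul_eq_mul] at this
      linarith
  unfold discrim at h
  nlinarith

/-- Leibniz's rule with `|a + b|² ≤ 2(|a|² + |b|²)` at each of the `k` derivatives, then
Cauchy–Schwarz once they are all distributed. -/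
lemma gradForm_mul_self_le (k : ℕ) (f g : MvPolynomial ι ℝ) :
    gradForm k (f * g) (f * g) ≤ 2 ^ k * ∑ ij ∈ Finset.HasAntidiagonal.antidiagonal k,
      (k.choose ij.1 : ℝ) * (gradEnergy ij.1 f * gradEnergy ij.2 g) := by
  induction k generalizing f g with
  | zero => simpa [gradForm, gradEnergy] using gaussE_mul_sq_le f g
  | succ k ih =>
    rw [Finset.sum_antidiagonal_choose_succ_mul (fun i j => gradEnergy i f * gradEnergy j g)]
    have h1 : gradForm (k + 1) (f * g) (f * g) ≤
        ∑ i, 2 * (gradForm k (f * pderiv i g) (f * pderiv i g) +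
          gradForm k (pderiv i f * g) (pderiv i f * g)) := by
      rw [gradForm]
      refine Finset.sum_le_sum fun i _ => ?_
      rw [Derivation.leibniz, smul_eq_mul, smul_eq_mul, mul_comm g]
      exact gradForm_add_self_le _ _ _
    refine h1.trans ((Finset.sum_le_sum fun i _ => mul_le_mul_of_nonneg_left
      (add_le_add (ih f (pderiv i g)) (ih (pderiv i f) g)) zero_le_two).trans (le_of_eq ?_))
    rw [← Finset.mul_sum, Finset.sum_add_distrib, ← Finset.mul_sum, ← Finset.mul_sum, pow_succ,
      Finset.sum_comm, Finset.sum_comm (s := Finset.univ)]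
    have e1 : ∀ ij : ℕ × ℕ, ∑ i, (k.choose ij.1 : ℝ) *
        (gradEnergy ij.1 f * gradEnergy ij.2 (pderiv i g)) =
        k.choose ij.1 * (gradEnergy ij.1 f * gradEnergy (ij.2 + 1) g) := by
      intro ij; rw [← Finset.mul_sum, ← Finset.mul_sum]; rfl
    have e2 : ∀ ij ∈ Finset.HasAntidiagonal.antidiagonal k, ∑ i, (k.choose ij.1 : ℝ) *
        (gradEnergy ij.1 (pderiv i f) * gradEnergy ij.2 g) =
        k.choose ij.2 * (gradEnergy (ij.1 + 1) f * gradEnergy ij.2 g) := by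
      intro ij hij
      rw [← Finset.mul_sum, ← Finset.sum_mul,
        Nat.choose_symm_of_eq_add (Finset.HasAntidiagonal.mem_antidiagonal.1 hij).symm]
      rfl
    rw [Finset.sum_congr rfl fun ij _ => e1 ij, Finset.sum_congr rfl e2]
    ring

/-- The fourth moment of a Gaussian polynomial is controlled by its second moment. -/
lemma gaussE_four_le (n : ℕ) (f : MvPolynomial ι ℝ) (hf : f.totalDegree ≤ n) :
    gaussE ι ℝ (f * f * (f * f)) ≤ 9 ^ n * gaussE ι ℝ (f * f) ^ 2 := by
  set V := gaussE ι ℝ (f * f) with hV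
  have hff : (f * f).totalDegree ≤ 2 * n := (MvPolynomial.totalDegree_mul _ _).trans (by omega)
  rw [gaussE_mul_eq_sum (2 * n) _ _ hff]
  -- The binomial coefficient times the two falling factorials is `k! C(n,i) C(n,j)`, so Vandermonde
  -- sums it to `k! C(2n,k)`. Summing `2ᵏ C(2n,k)` over `k` gives `3^(2n) = 9ⁿ`.
  have h1 : ∀ k, gradForm k (f * f) (f * f) / (k ! : ℝ) ≤ 2 ^ k * ((2 * n).choose k) * V ^ 2 := by
    intro k
    rw [div_le_iff₀ (by positivity)]
    refine (gradForm_mul_self_le k f f).trans ?_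
    rw [two_mul n, Nat.add_choose_eq]
    push_cast
    rw [mul_assoc, mul_assoc, Finset.sum_mul]
    refine mul_le_mul_of_nonneg_left (Finset.sum_le_sum fun ij hij => ?_) (by positivity)
    have hk : ij.1 + ij.2 = k := Finset.HasAntidiagonal.mem_antidiagonal.1 hij
    have h2 : gradEnergy ij.1 f * gradEnergy ij.2 f ≤
        (n.descFactorial ij.1 * V) * (n.descFactorial ij.2 * V) :=
      mul_le_mul (gradEnergy_le _ n f hf) (gradEnergy_le _ n f hf) (gradEnergy_nonneg _ _)
        (mul_nonneg (by positivity) (gaussE_mul_self_nonneg f))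
    refine (mul_le_mul_of_nonneg_left h2 (by positivity)).trans (le_of_eq ?_)
    rw [Nat.descFactorial_eq_factorial_mul_choose, Nat.descFactorial_eq_factorial_mul_choose,
      ← hk, ← Nat.add_choose_mul_factorial_mul_factorial, Nat.choose_symm_add]
    push_cast
    ring
  refine (Finset.sum_le_sum fun k _ => h1 k).trans (le_of_eq ?_)
  rw [← Finset.sum_mul]
  congr 1
  have := add_pow (2 : ℝ) 1 (2 * n)
  simp only [one_pow, mul_one] at this
  rw [← this, pow_mul]
  norm_num

/-- A Gaussian polynomial of degree `n` that is nonnegative off a set of measure `≲ 9⁻ⁿ` has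
nonnegative expectation. -/
lemma gaussE_nonneg_of_nonneg_off (n : ℕ) (f : MvPolynomial ι ℝ) (hf : f.totalDegree ≤ n)
    {B : Set (ι → ℝ)} (hB : MeasurableSet B) (hpos : ∀ x ∉ B, 0 ≤ evalReal x f)
    (hsmall : 16 * 9 ^ n * (stdGauss ι).real B ≤ 1) : 0 ≤ gaussE ι ℝ f := by
  set V := gaussE ι ℝ (f * f) with hV
  have hV0 : 0 ≤ V := gaussE_mul_self_nonneg f
  rcases hV0.eq_or_lt with h0 | h0
  · have := gaussE_mul_sq_le f 1
    simp only [mul_one, gaussE_one] at this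
    rw [← hV, ← h0] at this
    nlinarith
  set α : ℝ := 3 ^ n * √V with hα
  have hα0 : 0 < α := by positivity
  have hα2 : α ^ 2 = 9 ^ n * V := by
    rw [hα, mul_pow, Real.sq_sqrt hV0, ← pow_mul, mul_comm n, pow_mul]; norm_num
  set β : ℝ := (2 * α ^ 2)⁻¹ with hβ
  -- A lower bound for `t` by moments: `α` and `β` are chosen so that the fourth-moment estimate
  -- gives `β E f⁴ ≤ V/2`.
  have hpt : ∀ t : ℝ, 0 ≤ t → (t ^ 2 - β * t ^ 4) / α ≤ t := by
    intro t ht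
    rw [div_le_iff₀ hα0]
    have h1 : t - β * t ^ 3 ≤ α := by
      have : t - β * t ^ 3 = α * (t / α - (t / α) ^ 3 / 2) := by
        rw [hβ]; field_simp
      rw [this]
      have hu : 0 ≤ t / α := by positivity
      set u := t / α
      have : u - u ^ 3 / 2 ≤ 1 := by nlinarith [mul_nonneg hu (sq_nonneg (u - 1)), sq_nonneg (u - 1)]
      nlinarith
    nlinarith
  -- On `B` one writes `f ≥ |f| - 2|f|` and splits the loss `2|f|` by the arithmetic–geometric mean
  -- inequality. In the mean, the three losses, multiplied by `α`, are at most `V/2`, `V/4` and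
  -- `V/4`, so nothing negative remains.
  have hmain : ∀ x, (evalReal x (f * f) - β * evalReal x (f * f * (f * f))) / α -
      evalReal x (f * f) / (4 * α) - (4 * α) * B.indicator 1 x ≤ evalReal x f := by
    intro x
    simp only [map_mul]
    set t : ℝ := evalReal x f
    by_cases hx : x ∈ B
    · have h1 := hpt |t| (abs_nonneg t)
      rw [sq_abs, (by rw [← abs_pow, abs_of_nonneg (by positivity)] : |t| ^ 4 = t ^ 4)] at h1
      have h2 : 2 * |t| ≤ t * t / (4 * α) + 4 * α := by
        have h3 : t * t / (4 * α) + 4 * α - 2 * |t| = (|t| - 4 * α) ^ 2 / (4 * α) := by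
          have : t * t = |t| ^ 2 := by rw [sq_abs]; ring
          rw [this]; field_simp; ring
        have : 0 ≤ (|t| - 4 * α) ^ 2 / (4 * α) := by positivity
        linarith
      have h4 := neg_abs_le t
      simp only [Set.indicator_of_mem hx, Pi.one_apply]
      have e : (t * t - β * (t * t * (t * t))) / α = (t ^ 2 - β * t ^ 4) / α := by ring
      rw [e]; linarith
    · have h1 := hpt t (hpos x hx)
      simp only [Set.indicator_of_notMem hx]
      have e : (t * t - β * (t * t * (t * t))) / α = (t ^ 2 - β * t ^ 4) / α := by ring
      have h2 : 0 ≤ t * t / (4 * α) := div_nonneg (mul_self_nonneg t) (by positivity)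
      rw [e]; linarith
  have hi2 := integrable_evalReal (f * f)
  have hi4 := integrable_evalReal (f * f * (f * f))
  have hiB : Integrable (B.indicator (1 : (ι → ℝ) → ℝ)) (stdGauss ι) :=
    (integrable_const 1).indicator hB
  have hInt := integral_mono (((hi2.sub (hi4.const_mul β)).div_const α).sub
    (hi2.div_const (4 * α)) |>.sub (hiB.const_mul (4 * α))) (integrable_evalReal f) hmain
  refine le_trans ?_ hInt
  simp only [Pi.sub_apply]
  rw [integral_sub, integral_sub, integral_div, integral_sub, integral_div, integral_const_mul,
    integral_const_mul, integral_indicator_one hB, ← gaussE_apply, ← gaussE_apply, ← hV]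
  · have h4 := gaussE_four_le n f hf
    rw [← hV] at h4
    set W := gaussE ι ℝ (f * f * (f * f))
    set b := (stdGauss ι).real B
    have hW : β * W ≤ V / 2 := by
      rw [hβ, hα2]
      rw [inv_mul_le_iff₀ (by positivity)]
      nlinarith
    have h5 : (V - β * W) / α - V / (4 * α) - 4 * α * b =
        (V - β * W - V / 4 - 4 * α ^ 2 * b) / α := by field_simp
    rw [h5, hα2]
    refine div_nonneg ?_ hα0.le
    nlinarith
  · exact hi2
  · exact hi4.const_mul β
  · exact (hi2.sub (hi4.const_mul β)).div_const α
  · exact hi2.div_const (4 * α)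
  · exact ((hi2.sub (hi4.const_mul β)).div_const α).sub (hi2.div_const (4 * α))
  · exact hiB.const_mul (4 * α)

end Hypercontractivity

/-! ### The Schwinger–Dyson equations -/

section SchwingerDyson

open MvPolynomial (pderiv)

/-- Real coordinates of `d` Hermitian matrices of size `N`. -/
abbrev Coord (d N : ℕ) : Type := Fin d × Fin N × Fin N

/-- The entry `(a, b)` of an `N × N` GUE matrix as a linear form in standard Gaussian variables. -/
def gueCoef {N : ℕ} (a b : Fin N) : Fin N × Fin N → ℂ :=
  if a = b then ((√(N : ℝ) : ℝ) : ℂ)⁻¹ • Pi.single (a, a) 1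
  else if a < b then
    ((√(2 * N : ℝ) : ℝ) : ℂ)⁻¹ • (Pi.single (a, b) 1 + Complex.I • Pi.single (b, a) 1)
  else ((√(2 * N : ℝ) : ℝ) : ℂ)⁻¹ • (Pi.single (b, a) 1 - Complex.I • Pi.single (a, b) 1)

/-- The covariance of two entries, without conjugation: the real and imaginary parts cancel in
`H_ab²` and add up in `H_ab H_ba`. -/
lemma gueCoef_dotProduct {N : ℕ} (a b c e : Fin N) :
    gueCoef a b ⬝ᵥ gueCoef c e = if a = e ∧ b = c then (N : ℂ)⁻¹ else 0 := by
  have hN : (0 : ℝ) ≤ N := by positivity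
  have e1 : ((√(N : ℝ) : ℝ) : ℂ)⁻¹ * ((√(N : ℝ) : ℝ) : ℂ)⁻¹ = (N : ℂ)⁻¹ := by
    rw [← mul_inv, ← Complex.ofReal_mul, Real.mul_self_sqrt hN]; simp
  have e2 : ((√(2 * N : ℝ) : ℝ) : ℂ)⁻¹ * (((√(2 * N : ℝ) : ℝ) : ℂ)⁻¹ * 2) = (N : ℂ)⁻¹ := by
    rw [← mul_assoc, ← mul_inv, ← Complex.ofReal_mul, Real.mul_self_sqrt (by positivity)]
    push_cast
    rw [mul_inv]
    ring_nf
  have e3 := Complex.I_sq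
  unfold gueCoef
  generalize ((√(2 * N : ℝ) : ℝ) : ℂ)⁻¹ = s at *
  generalize ((√(N : ℝ) : ℝ) : ℂ)⁻¹ = t at *
  rcases lt_trichotomy a b with hab | hab | hab <;>
  rcases lt_trichotomy c e with hce | hce | hce
  · simp only [hab.ne, hce.ne, hab, hce, if_true, if_false, smul_dotProduct, dotProduct_smul,
      add_dotProduct, single_one_dotProduct, Pi.add_apply, Pi.smul_apply, Pi.single_apply,
      Prod.mk.injEq, smul_eq_mul]
    split_ifs <;> grind
  · subst hce
    simp only [hab.ne, hab, if_true, if_false, smul_dotProduct, dotProduct_smul,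
      add_dotProduct, single_one_dotProduct, Pi.single_apply, Prod.mk.injEq, smul_eq_mul]
    split_ifs <;> grind
  · simp only [hab.ne, hce.ne', hce.not_gt, hab, if_true, if_false, smul_dotProduct,
      dotProduct_smul, add_dotProduct, single_one_dotProduct, Pi.sub_apply, Pi.smul_apply,
      Pi.single_apply, Prod.mk.injEq, smul_eq_mul]
    split_ifs <;> grind
  · subst hab
    simp only [hce.ne, hce, if_true, if_false, smul_dotProduct, dotProduct_smul,
      single_one_dotProduct, Pi.add_apply, Pi.smul_apply, Pi.single_apply,
      Prod.mk.injEq, smul_eq_mul]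
    split_ifs <;> grind
  · subst hab hce
    simp only [if_true, smul_dotProduct, dotProduct_smul,
      single_one_dotProduct, Pi.single_apply, Prod.mk.injEq, smul_eq_mul]
    split_ifs <;> grind
  · subst hab
    simp only [hce.ne', hce.not_gt, if_true, if_false, smul_dotProduct, dotProduct_smul,
      single_one_dotProduct, Pi.sub_apply, Pi.smul_apply, Pi.single_apply,
      Prod.mk.injEq, smul_eq_mul]
    split_ifs <;> grind
  · simp only [hab.ne', hab.not_gt, hce.ne, hce, if_true, if_false, smul_dotProduct,
      dotProduct_smul, sub_dotProduct, single_one_dotProduct, Pi.add_apply, Pi.smul_apply,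
      Pi.single_apply, Prod.mk.injEq, smul_eq_mul]
    split_ifs <;> grind
  · subst hce
    simp only [hab.ne', hab.not_gt, if_true, if_false, smul_dotProduct, dotProduct_smul,
      sub_dotProduct, single_one_dotProduct, Pi.single_apply, Prod.mk.injEq, smul_eq_mul]
    split_ifs <;> grind
  · simp only [hab.ne', hab.not_gt, hce.ne', hce.not_gt, if_false, smul_dotProduct,
      dotProduct_smul, sub_dotProduct, single_one_dotProduct, Pi.sub_apply, Pi.smul_apply,
      Pi.single_apply, Prod.mk.injEq, smul_eq_mul]
    split_ifs <;> grind

/-- The `j`-th GUE matrix, with entries polynomials in standard Gaussian variables. -/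
def gueMat (d N : ℕ) (j : Fin d) : Matrix (Fin N) (Fin N) (MvPolynomial (Coord d N) ℂ) :=
  Matrix.of fun a b => ∑ p, gueCoef a b p • MvPolynomial.X (j, p)

/-- The derivation dual to the entry `(a, b)` of the `j`-th GUE matrix. -/
def gueDeriv (d N : ℕ) (j : Fin d) (a b : Fin N) :
    Derivation ℂ (MvPolynomial (Coord d N) ℂ) (MvPolynomial (Coord d N) ℂ) :=
  ∑ p, gueCoef a b p • pderiv (j, p)

variable {d N : ℕ}

lemma gueDeriv_apply (j : Fin d) (a b : Fin N) (p : MvPolynomial (Coord d N) ℂ) :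
    gueDeriv d N j a b p = ∑ x, gueCoef a b x • pderiv (j, x) p := by
  unfold gueDeriv
  rw [← Derivation.coeFnAddMonoidHom_apply, map_sum]
  simp

lemma gaussE_gueMat_mul (j : Fin d) (a b : Fin N) (p : MvPolynomial (Coord d N) ℂ) :
    gaussE (Coord d N) ℂ (gueMat d N j a b * p) = gaussE (Coord d N) ℂ (gueDeriv d N j a b p) := by
  simp only [gueDeriv_apply, gueMat, Matrix.of_apply, Finset.sum_mul, smul_mul_assoc, map_sum,
    map_smul, gaussE_X_mul]

lemma gueDeriv_gueMat (j k : Fin d) (a b c e : Fin N) :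
    gueDeriv d N j a b (gueMat d N k c e) =
      if j = k ∧ a = e ∧ b = c then MvPolynomial.C (N : ℂ)⁻¹ else 0 := by
  have hX : ∀ x y : Fin N × Fin N,
      pderiv (j, x) (MvPolynomial.X (k, y) : MvPolynomial (Coord d N) ℂ) =
      if j = k ∧ x = y then 1 else 0 := by
    intro x y
    split_ifs with h
    · rw [h.1, h.2]; simp
    · refine MvPolynomial.pderiv_X_of_ne ?_
      rintro h'; rw [Prod.mk.injEq] at h'; exact h ⟨h'.1.symm, h'.2.symm⟩
  simp only [gueDeriv_apply, gueMat, Matrix.of_apply, map_sum, Derivation.map_smul, hX]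
  by_cases hjk : j = k
  · have h1 : ∀ x : Fin N × Fin N, gueCoef c e x • ∑ y, gueCoef a b y •
        (if j = k ∧ y = x then 1 else 0 : MvPolynomial (Coord d N) ℂ) =
        MvPolynomial.C (gueCoef a b x * gueCoef c e x) := by
      intro x
      simp only [hjk, true_and, smul_ite, smul_zero, Finset.sum_ite_eq', Finset.mem_univ, if_true]
      rw [smul_smul, MvPolynomial.smul_eq_C_mul, mul_one, mul_comm]
    rw [Finset.sum_congr rfl fun x _ => h1 x, ← map_sum]
    have := gueCoef_dotProduct a b c e
    rw [dotProduct] at this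
    rw [this]
    split_ifs <;> simp_all
  · simp [hjk]

/-- All ways to write `w = u j v`. -/
def splits (j : Fin d) : List (Fin d) → List (List (Fin d) × List (Fin d))
  | [] => []
  | k :: w => (if k = j then [([], w)] else []) ++ (splits j w).map fun p => (k :: p.1, p.2)

/-- All ways to write one of the words as `u j v` and to replace it by `w v u`. -/
def merges (j : Fin d) (w : List (Fin d)) : List (List (Fin d)) → List (List (List (Fin d)))
  | [] => []
  | x :: xs => ((splits j x).map fun p => (w ++ p.2 ++ p.1) :: xs) ++ (merges j w xs).map (x :: ·)

/-- The product of GUE matrices along a word. -/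
def wordMat (N : ℕ) (w : List (Fin d)) : Matrix (Fin N) (Fin N) (MvPolynomial (Coord d N) ℂ) :=
  (w.map (gueMat d N)).prod

lemma wordMat_append (u v : List (Fin d)) : wordMat N (u ++ v) = wordMat N u * wordMat N v := by
  simp [wordMat]

/-- The normalized trace of a word. -/
def wordTr (N : ℕ) (w : List (Fin d)) : MvPolynomial (Coord d N) ℂ :=
  (N : ℂ)⁻¹ • (wordMat N w).trace

/-- The product of the normalized traces of several words. -/
def wordTrProd (N : ℕ) (ws : List (List (Fin d))) : MvPolynomial (Coord d N) ℂ :=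
  (ws.map (wordTr N)).prod

/-- Differentiation replaces one occurrence of the letter `j` by `N⁻¹` times the matrix unit at `(b,
a)`, which cuts the word there. -/
lemma gueDeriv_wordMat (j : Fin d) (a b c e : Fin N) (w : List (Fin d)) :
    gueDeriv d N j a b (wordMat N w c e) =
      (N : ℂ)⁻¹ • ((splits j w).map fun p => wordMat N p.1 c b * wordMat N p.2 a e).sum := by
  induction w generalizing c with
  | nil =>
    simp only [wordMat, List.map_nil, List.prod_nil, splits, List.sum_nil, smul_zero,
      Matrix.one_apply]
    split_ifs <;> simp
  | cons k w ih =>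
    have h1 : ∀ c e, wordMat N (k :: w) c e = ∑ f, gueMat d N k c f * wordMat N w f e := by
      intro c e; simp [wordMat, Matrix.mul_apply]
    rw [h1, map_sum]
    simp only [Derivation.leibniz, smul_eq_mul, ih, gueDeriv_gueMat, Finset.sum_add_distrib]
    rw [splits, List.map_append, List.sum_append, smul_add, add_comm]
    congr 1
    · have h2 : ∀ f, wordMat N w f e * (if j = k ∧ a = f ∧ b = c then
          MvPolynomial.C (N : ℂ)⁻¹ else 0 : MvPolynomial (Coord d N) ℂ) =
          if a = f then (if k = j ∧ c = b then (N : ℂ)⁻¹ • wordMat N w a e else 0) else 0 := by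
        intro f
        rw [MvPolynomial.smul_eq_C_mul]
        by_cases ha : a = f <;> by_cases hb : b = c <;> by_cases hk : j = k <;>
          simp [ha, hb, hk, eq_comm, mul_comm]
      simp only [h2, Finset.sum_ite_eq, Finset.mem_univ, if_true]
      by_cases hk : k = j
      · simp only [hk, true_and, if_true, List.map_cons, List.map_nil, List.sum_singleton]
        simp only [wordMat, List.map_nil, List.prod_nil, Matrix.one_apply]
        split_ifs <;> simp
      · simp [hk]
    · simp only [List.map_map, Function.comp_def, mul_smul_comm, ← Finset.smul_sum]
      congr 1
      simp only [← List.sum_map_mul_left]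
      have h3 : ∀ (u : List (Fin d)), wordMat N (k :: u) c b = ∑ f, gueMat d N k c f * wordMat N u f b := by
        intro u; simp [wordMat, Matrix.mul_apply]
      simp only [h3]
      generalize splits j w = l
      induction l with
      | nil => simp
      | cons x l ih => simp [Finset.sum_add_distrib, ih, Finset.sum_mul, mul_assoc]

/-- Inside a trace the two pieces left by the cut are glued again, in the cyclic order starting
after the removed letter. -/
lemma gueDeriv_wordTr (j : Fin d) (a b : Fin N) (w : List (Fin d)) :
    gueDeriv d N j a b (wordTr N w) =
      ((N : ℂ)⁻¹ * (N : ℂ)⁻¹) • ((splits j w).map fun p => wordMat N (p.2 ++ p.1) a b).sum := by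
  rw [wordTr, Derivation.map_smul, Matrix.trace, map_sum]
  simp only [Matrix.diag_apply, gueDeriv_wordMat, ← Finset.smul_sum, smul_smul]
  congr 1
  generalize splits j w = l
  induction l with
  | nil => simp
  | cons x l ih =>
    simp only [List.map_cons, List.sum_cons, Finset.sum_add_distrib, ih, wordMat_append,
      Matrix.mul_apply]
    congr 1
    exact Finset.sum_congr rfl fun i _ => mul_comm _ _

lemma sum_wordMat_mul_gueDeriv (j : Fin d) (w : List (Fin d)) (ws : List (List (Fin d))) :
    ∑ a, ∑ b, wordMat N w b a * gueDeriv d N j a b (wordTrProd N ws) =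
      (N : ℂ)⁻¹ • ((merges j w ws).map (wordTrProd N)).sum := by
  induction ws with
  | nil => simp [wordTrProd, merges]
  | cons x xs ih =>
    have h1 : wordTrProd N (x :: xs) = wordTr N x * wordTrProd N xs := by simp [wordTrProd]
    have h2 : ∀ l : List (List (List (Fin d))),
        ((l.map (x :: ·)).map (wordTrProd N)).sum = wordTr N x * (l.map (wordTrProd N)).sum := by
      intro l
      rw [List.map_map, ← List.sum_map_mul_left]
      rfl
    have h3 : ∀ p : List (Fin d) × List (Fin d), wordTrProd N ((w ++ p.2 ++ p.1) :: xs) =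
        (N : ℂ)⁻¹ • ((∑ a, ∑ b, wordMat N w b a * wordMat N (p.2 ++ p.1) a b) *
          wordTrProd N xs) := by
      intro p
      have h4 : wordTr N (w ++ (p.2 ++ p.1)) =
          (N : ℂ)⁻¹ • ∑ a, ∑ b, wordMat N w b a * wordMat N (p.2 ++ p.1) a b := by
        rw [wordTr, wordMat_append w, Matrix.trace, Finset.sum_comm]
        simp only [Matrix.diag_apply, Matrix.mul_apply]
      rw [List.append_assoc, ← smul_mul_assoc, ← h4]
      simp only [wordTrProd, List.map_cons, List.prod_cons]
    have h5 : ∀ l : List (List (Fin d) × List (Fin d)),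
        ∑ a, ∑ b, wordMat N w b a * (wordTrProd N xs *
          (((N : ℂ)⁻¹ * (N : ℂ)⁻¹) • (l.map fun p => wordMat N (p.2 ++ p.1) a b).sum)) =
        (N : ℂ)⁻¹ • (l.map fun p => wordTrProd N ((w ++ p.2 ++ p.1) :: xs)).sum := by
      intro l
      induction l with
      | nil => simp
      | cons y l ih' =>
        rw [List.map_cons, List.sum_cons, smul_add, ← ih', h3, smul_smul]
        simp only [List.map_cons, List.sum_cons, smul_add, mul_add, Finset.sum_add_distrib]
        refine congrArg (· + _) ?_
        simp only [Finset.sum_mul, Finset.smul_sum]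
        refine Finset.sum_congr rfl fun a _ => Finset.sum_congr rfl fun b _ => ?_
        simp only [MvPolynomial.smul_eq_C_mul]
        ring
    have h6 : ∑ a, ∑ b, wordMat N w b a *
        (wordTr N x * gueDeriv d N j a b (wordTrProd N xs)) = wordTr N x *
        ∑ a, ∑ b, wordMat N w b a * gueDeriv d N j a b (wordTrProd N xs) := by
      simp only [Finset.mul_sum]
      exact Finset.sum_congr rfl fun a _ => Finset.sum_congr rfl fun b _ => by ring
    rw [merges, List.map_append, List.sum_append, h2, smul_add, ← mul_smul_comm, ← ih, h1,
      List.map_map, ← h6]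
    refine Eq.trans ?_ (congrArg (· + _) (h5 (splits j x)))
    simp only [Derivation.leibniz, smul_eq_mul, mul_add, Finset.sum_add_distrib, gueDeriv_wordTr]
    exact add_comm _ _

/-- The Schwinger–Dyson equation for traces of words in independent GUE matrices. -/
lemma schwinger_dyson (hN : N ≠ 0) (j : Fin d) (w : List (Fin d)) (ws : List (List (Fin d))) :
    gaussE (Coord d N) ℂ (wordTrProd N ((j :: w) :: ws)) =
      ((splits j w).map fun p => gaussE (Coord d N) ℂ (wordTrProd N (p.1 :: p.2 :: ws))).sum +
      (N : ℂ)⁻¹ ^ 2 * ((merges j w ws).map fun x => gaussE (Coord d N) ℂ (wordTrProd N x)).sum := by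
  have hN' : (N : ℂ) ≠ 0 := by exact_mod_cast hN
  have h1 : wordTrProd N ((j :: w) :: ws) = (N : ℂ)⁻¹ • ∑ a, ∑ b,
      gueMat d N j a b * (wordMat N w b a * wordTrProd N ws) := by
    simp only [wordTrProd, List.map_cons, List.prod_cons, wordTr, smul_mul_assoc]
    refine congrArg _ ?_
    simp only [Matrix.trace, Matrix.diag_apply, wordMat, List.map_cons, List.prod_cons,
      Matrix.mul_apply, Finset.sum_mul, mul_assoc]
  have h2 : ∀ l : List (List (Fin d) × List (Fin d)), ∑ a, ∑ b, wordTrProd N ws *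
      ((N : ℂ)⁻¹ • (l.map fun p => wordMat N p.1 b b * wordMat N p.2 a a).sum) =
      (N : ℂ) • (l.map fun p => wordTrProd N (p.1 :: p.2 :: ws)).sum := by
    intro l
    induction l with
    | nil => simp
    | cons x l ih =>
      have h4 : ∑ a, ∑ b, wordTrProd N ws *
          ((N : ℂ)⁻¹ • (wordMat N x.1 b b * wordMat N x.2 a a)) =
          (N : ℂ) • wordTrProd N (x.1 :: x.2 :: ws) := by
        have h5 : wordTrProd N (x.1 :: x.2 :: ws) =
            ((N : ℂ)⁻¹ * (N : ℂ)⁻¹) • ((wordMat N x.1).trace * (wordMat N x.2).trace *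
              wordTrProd N ws) := by
          simp only [wordTrProd, List.map_cons, List.prod_cons, wordTr, smul_mul_assoc,
            mul_smul_comm, smul_smul, mul_assoc]
        rw [h5, smul_smul, mul_inv_cancel_left₀ hN']
        simp only [Matrix.trace, Matrix.diag_apply, Finset.sum_mul, Finset.mul_sum,
          Finset.smul_sum]
        refine Finset.sum_congr rfl fun a _ => Finset.sum_congr rfl fun b _ => ?_
        simp only [MvPolynomial.smul_eq_C_mul]
        ring
      rw [List.map_cons, List.sum_cons, smul_add, ← ih, ← h4]
      simp only [List.map_cons, List.sum_cons, smul_add, mul_add, Finset.sum_add_distrib]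
  have h3 : ∀ (l : List (List (List (Fin d)))), gaussE (Coord d N) ℂ (l.map (wordTrProd N)).sum =
      (l.map fun x => gaussE (Coord d N) ℂ (wordTrProd N x)).sum := by
    intro l; rw [map_list_sum, List.map_map]; rfl
  -- Integration by parts in the leading letter. The derivative falls on the rest of its own word,
  -- producing two traces whose normalizations cancel all powers of `N`, or on another trace, which
  -- merges with the word and leaves `N⁻²`.
  have h6 : gaussE (Coord d N) ℂ (∑ a, ∑ b,
      gueMat d N j a b * (wordMat N w b a * wordTrProd N ws)) =
      gaussE (Coord d N) ℂ ((∑ a, ∑ b, wordMat N w b a * gueDeriv d N j a b (wordTrProd N ws)) +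
        ∑ a, ∑ b, wordTrProd N ws * gueDeriv d N j a b (wordMat N w b a)) := by
    simp only [map_sum, gaussE_gueMat_mul, Derivation.leibniz, smul_eq_mul, map_add,
      Finset.sum_add_distrib]
  rw [h1, map_smul, h6, sum_wordMat_mul_gueDeriv]
  simp only [gueDeriv_wordMat]
  rw [h2, map_add, map_smul, map_smul, h3, map_list_sum, List.map_map]
  simp only [smul_eq_mul, Function.comp_def]
  rw [mul_add, inv_mul_cancel_left₀ hN', ← mul_assoc, ← sq, add_comm]

end SchwingerDyson

/-! ### The genus expansion and moment bounds -/

section Moments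

variable {d N : ℕ}

/-- The total length of a list of words. -/
def totalLen (ws : List (List (Fin d))) : ℕ := (ws.map List.length).sum

lemma length_of_mem_splits {j : Fin d} {w : List (Fin d)} {p : List (Fin d) × List (Fin d)}
    (hp : p ∈ splits j w) : p.1.length + p.2.length + 1 = w.length := by
  induction w generalizing p with
  | nil => simp [splits] at hp
  | cons k w ih =>
    simp only [splits, List.mem_append, List.mem_map] at hp
    rcases hp with hp | ⟨q, hq, rfl⟩
    · split_ifs at hp
      · simp only [List.mem_singleton] at hp
        subst hp; simp
      · simp at hp
    · have := ih hq
      simp only [List.length_cons]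
      omega

/-- There is at most one split at each position `i`, with pieces of lengths `i` and `|w| - 1 - i`;
positions carrying other letters only enlarge the right side. -/
lemma sum_splits_le (j : Fin d) (w : List (Fin d)) (F : ℕ → ℕ → ℝ) (hF : ∀ a b, 0 ≤ F a b) :
    ((splits j w).map fun p => F p.1.length p.2.length).sum ≤
      ∑ i ∈ Finset.range w.length, F i (w.length - 1 - i) := by
  induction w generalizing F with
  | nil => simp [splits]
  | cons k w ih =>
    rw [splits, List.map_append, List.sum_append, List.length_cons, Finset.sum_range_succ',
      add_comm]
    refine add_le_add ?_ ?_
    · rw [List.map_map]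
      refine (ih (fun a b => F (a + 1) b) fun a b => hF _ _).trans (le_of_eq ?_)
      refine Finset.sum_congr rfl fun i _ => ?_
      congr 1; omega
    · split_ifs
      · simp
      · simpa using hF _ _

lemma length_splits_le (j : Fin d) (w : List (Fin d)) : (splits j w).length ≤ w.length := by
  have := sum_splits_le j w (fun _ _ => 1) (fun _ _ => zero_le_one)
  simp at this
  exact_mod_cast this

lemma of_mem_merges {j : Fin d} {w : List (Fin d)} {ws x : List (List (Fin d))}
    (hx : x ∈ merges j w ws) : totalLen x + 1 = w.length + totalLen ws ∧ x.length = ws.length := by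
  induction ws generalizing x with
  | nil => simp [merges] at hx
  | cons y ys ih =>
    simp only [merges, List.mem_append, List.mem_map] at hx
    rcases hx with ⟨p, hp, rfl⟩ | ⟨z, hz, rfl⟩
    · have := length_of_mem_splits hp
      simp only [totalLen, List.map_cons, List.sum_cons, List.length_append, List.length_cons]
      refine ⟨?_, trivial⟩
      omega
    · have := ih hz
      simp only [totalLen, List.map_cons, List.sum_cons, List.length_cons] at *
      omega

lemma wordTr_nil (hN : N ≠ 0) : wordTr N ([] : List (Fin d)) = 1 := by
  have hN' : (N : ℂ) ≠ 0 := by exact_mod_cast hN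
  simp only [wordTr, wordMat, List.map_nil, List.prod_nil, Matrix.trace_one, Fintype.card_fin]
  rw [← map_natCast (MvPolynomial.C : ℂ →+* MvPolynomial (Coord d N) ℂ), MvPolynomial.smul_eq_C_mul,
    ← map_mul, inv_mul_cancel₀ hN', map_one]

lemma wordTrProd_nil_cons (hN : N ≠ 0) (ws : List (List (Fin d))) :
    wordTrProd N ([] :: ws) = wordTrProd N ws := by
  simp [wordTrProd, wordTr_nil hN]

/-- Induction on lists of words along the Schwinger–Dyson equation. -/
lemma words_induction {motive : List (List (Fin d)) → Prop} (nil : motive [])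
    (nil_cons : ∀ ws, motive ws → motive ([] :: ws))
    (cons_cons : ∀ j w ws, (∀ p ∈ splits j w, motive (p.1 :: p.2 :: ws)) →
      (∀ x ∈ merges j w ws, motive x) → motive ((j :: w) :: ws)) (ws : List (List (Fin d))) :
    motive ws := by
  -- Letters plus words: a split loses two letters and gains one word, a merging loses two letters
  -- and one word, and dropping an empty word lowers the number of words.
  induction hm : totalLen ws + ws.length using Nat.strong_induction_on generalizing ws with
  | _ m ih =>
    match ws, hm with
    | [], _ => exact nil
    | [] :: ws, hm =>
      refine nil_cons ws (ih _ ?_ ws rfl)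
      simp only [totalLen, List.map_cons, List.sum_cons, List.length_cons, List.length_nil] at hm ⊢
      omega
    | (j :: w) :: ws, hm =>
      simp only [totalLen, List.map_cons, List.sum_cons, List.length_cons] at hm
      refine cons_cons j w ws (fun p hp => ih _ ?_ _ rfl) fun x hx => ih _ ?_ x rfl
      · have := length_of_mem_splits hp
        simp only [totalLen, List.map_cons, List.sum_cons, List.length_cons]
        omega
      · have := of_mem_merges hx
        simp only [totalLen] at this ⊢
        omega

/-- `p` expresses `N ↦ F N` in terms of `N⁻²`. -/
def IsExpansion (F : ℕ → ℂ) (p : ℝ[X]) : Prop :=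
  ∀ N : ℕ, N ≠ 0 → F N = ((p.eval ((N : ℝ)⁻¹ ^ 2) : ℝ) : ℂ)

/-- The clause on the empty list serves the merge term of `exists_isExpansion_wordTrProd`: with
nothing to merge, a nonzero constant multiplied by `X` could exceed the allowed degree. -/
lemma exists_isExpansion_sum {α : Type*} (l : List α) (F : α → ℕ → ℂ) (n : ℕ)
    (h : ∀ x ∈ l, ∃ p : ℝ[X], 2 * p.natDegree ≤ n ∧ IsExpansion (F x) p) :
    ∃ p : ℝ[X], 2 * p.natDegree ≤ n ∧ (l = [] → p = 0) ∧
      IsExpansion (fun N => (l.map fun x => F x N).sum) p := by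
  induction l with
  | nil => exact ⟨0, by simp, fun _ => rfl, fun N _ => by simp⟩
  | cons x l ih =>
    obtain ⟨p, hp, hp'⟩ := h x (by simp)
    obtain ⟨r, hr, -, hr'⟩ := ih fun y hy => h y (by simp [hy])
    refine ⟨p + r, ?_, by simp, fun N hN => ?_⟩
    · have := Polynomial.natDegree_add_le p r
      omega
    · simp [hp' N hN, hr' N hN]

/-- The expectation of a product of normalized traces of words is a polynomial in `N⁻²`. -/
lemma exists_isExpansion_wordTrProd (ws : List (List (Fin d))) :
    ∃ p : ℝ[X], 2 * p.natDegree ≤ totalLen ws ∧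
      IsExpansion (fun N => gaussE (Coord d N) ℂ (wordTrProd N ws)) p := by
  induction ws using words_induction with
  | nil => exact ⟨1, by simp, fun N _ => by simp [wordTrProd, gaussE_one]⟩
  | nil_cons ws ih =>
    obtain ⟨p, hp, hp'⟩ := ih
    refine ⟨p, by simpa [totalLen] using hp, fun N hN => ?_⟩
    simp only [wordTrProd_nil_cons hN]
    exact hp' N hN
  | cons_cons j w ws ih1 ih2 =>
    obtain ⟨p, hp, -, hp'⟩ := exists_isExpansion_sum (splits j w)
      (fun x N => gaussE (Coord d N) ℂ (wordTrProd N (x.1 :: x.2 :: ws)))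
      (w.length - 1 + totalLen ws) fun x hx => by
        obtain ⟨p, hp, hp'⟩ := ih1 x hx
        refine ⟨p, hp.trans ?_, hp'⟩
        have := length_of_mem_splits hx
        simp only [totalLen, List.map_cons, List.sum_cons]
        omega
    obtain ⟨r, hr, hr0, hr'⟩ := exists_isExpansion_sum (merges j w ws)
      (fun x N => gaussE (Coord d N) ℂ (wordTrProd N x)) (w.length + totalLen ws - 1)
      fun x hx => by
        obtain ⟨p, hp, hp'⟩ := ih2 x hx
        refine ⟨p, hp.trans ?_, hp'⟩
        have := of_mem_merges hx
        omega
    -- A merging loses two letters, which is exactly the cost of the factor `X = N⁻²`.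
    refine ⟨p + X * r, ?_, fun N hN => ?_⟩
    · have h1 := Polynomial.natDegree_add_le p (X * r)
      have h2 : 2 * (X * r : ℝ[X]).natDegree ≤ w.length + 1 + totalLen ws := by
        by_cases hl : merges j w ws = []
        · simp [hr0 hl]
        · obtain ⟨x, hx⟩ := List.exists_mem_of_ne_nil _ hl
          have h3 := of_mem_merges hx
          have h4 := Polynomial.natDegree_mul_le (p := X) (q := r)
          have h5 := Polynomial.natDegree_X_le (R := ℝ)
          omega
      have h6 : totalLen ((j :: w) :: ws) = w.length + 1 + totalLen ws := by
        simp [totalLen]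
      omega
    · have e1 := hp' N hN
      have e2 := hr' N hN
      simp only at e1 e2
      simp only [schwinger_dyson hN, e1, e2]
      simp

/-- The weights bounding the moments of words of length `l`. -/
def momBound (N l : ℕ) : ℝ := 6 ^ l * (1 / ((l : ℝ) + 1) ^ 2 + 1 / N)

lemma momBound_nonneg (N l : ℕ) : 0 ≤ momBound N l := by unfold momBound; positivity

lemma sum_inv_sq_le (n : ℕ) :
    ∑ i ∈ Finset.range (n + 1), 1 / ((i : ℝ) + 1) ^ 2 ≤ 2 - 1 / ((n : ℝ) + 1) := by
  induction n with
  | zero => norm_num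
  | succ n ih =>
    rw [Finset.sum_range_succ]
    push_cast
    have : 1 / ((n : ℝ) + 1 + 1) ^ 2 ≤ 1 / ((n : ℝ) + 1) - 1 / ((n : ℝ) + 1 + 1) := by
      rw [div_sub_div _ _ (by positivity) (by positivity),
        div_le_div_iff₀ (by positivity) (by positivity)]
      nlinarith
    linarith

/-- The sequence `1/(l+1)²` is summable and, since `(x+y)² ≤ 2(x²+y²)`, reproduces itself under
convolution up to a constant. The terms with `1/N²` number at most `N`. The base `6` leaves a factor
`36/2 = 18` for all constants. -/
lemma momBound_convolution (n : ℕ) (hn : n + 2 ≤ N) :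
    ∑ i ∈ Finset.range (n + 1), momBound N i * momBound N (n - i) ≤ momBound N (n + 2) / 2 := by
  have hN : (0 : ℝ) < N := by exact_mod_cast (by omega : 0 < N)
  have hs : ∑ i ∈ Finset.range (n + 1), 1 / ((i : ℝ) + 1) ^ 2 ≤ 2 :=
    (sum_inv_sq_le n).trans (by have : (0 : ℝ) ≤ 1 / ((n : ℝ) + 1) := by positivity
                                linarith)
  have hs' : ∑ i ∈ Finset.range (n + 1), 1 / (((n - i : ℕ) : ℝ) + 1) ^ 2 ≤ 2 := by
    rw [← Finset.sum_range_reflect]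
    refine le_trans (le_of_eq ?_) hs
    refine Finset.sum_congr rfl fun i hi => ?_
    have : n - (n + 1 - 1 - i) = i := by have := Finset.mem_range.1 hi; omega
    rw [this]
  have h1 : ∀ i ∈ Finset.range (n + 1), momBound N i * momBound N (n - i) ≤
      6 ^ n * ((2 / ((n : ℝ) + 2) ^ 2 + 1 / N) *
        (1 / ((i : ℝ) + 1) ^ 2 + 1 / (((n - i : ℕ) : ℝ) + 1) ^ 2) + 1 / N ^ 2) := by
    intro i hi
    have hin : i ≤ n := by have := Finset.mem_range.1 hi; omega
    have e : (6 : ℝ) ^ i * 6 ^ (n - i) = 6 ^ n := by rw [← pow_add]; congr 1; omega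
    unfold momBound
    have e2 : (n : ℝ) = i + ((n - i : ℕ) : ℝ) := by rw [Nat.cast_sub hin]; ring
    set x : ℝ := (i : ℝ) + 1
    set y : ℝ := ((n - i : ℕ) : ℝ) + 1
    have hx : 0 < x := by positivity
    have hy : 0 < y := by positivity
    have hxy : (n : ℝ) + 2 = x + y := by rw [e2]; simp only [x, y]; ring
    rw [hxy]
    have h2 : 1 / x ^ 2 * (1 / y ^ 2) ≤ 2 / (x + y) ^ 2 * (1 / x ^ 2 + 1 / y ^ 2) := by
      rw [div_add_div _ _ (by positivity) (by positivity), div_mul_div_comm, div_mul_div_comm,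
        div_le_div_iff₀ (by positivity) (by positivity)]
      have : (x + y) ^ 2 ≤ 2 * (y ^ 2 + x ^ 2) := by nlinarith [sq_nonneg (x - y)]
      have h3 : 0 < x ^ 2 * y ^ 2 := by positivity
      nlinarith
    calc 6 ^ i * (1 / x ^ 2 + 1 / (N : ℝ)) * (6 ^ (n - i) * (1 / y ^ 2 + 1 / N))
        = 6 ^ n * (1 / x ^ 2 * (1 / y ^ 2) + 1 / N * (1 / x ^ 2 + 1 / y ^ 2) + 1 / N ^ 2) := by
          rw [← e]; ring
      _ ≤ _ := by
          refine mul_le_mul_of_nonneg_left ?_ (by positivity)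
          rw [add_mul]; linarith
  refine (Finset.sum_le_sum h1).trans ?_
  rw [← Finset.mul_sum, Finset.sum_add_distrib, ← Finset.mul_sum, Finset.sum_add_distrib]
  simp only [Finset.sum_const, Finset.card_range, nsmul_eq_mul]
  have h4 : (2 / ((n : ℝ) + 2) ^ 2 + 1 / N) * (∑ i ∈ Finset.range (n + 1), 1 / ((i : ℝ) + 1) ^ 2 +
      ∑ i ∈ Finset.range (n + 1), 1 / (((n - i : ℕ) : ℝ) + 1) ^ 2) ≤
      (2 / ((n : ℝ) + 2) ^ 2 + 1 / N) * 4 :=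
    mul_le_mul_of_nonneg_left (by linarith) (by positivity)
  have h5 : ((n + 1 : ℕ) : ℝ) * (1 / (N : ℝ) ^ 2) ≤ 1 / N := by
    rw [mul_one_div, div_le_div_iff₀ (by positivity) hN]
    have : ((n + 1 : ℕ) : ℝ) ≤ N := by exact_mod_cast (by omega : n + 1 ≤ N)
    nlinarith
  have h6 : 2 / ((n : ℝ) + 2) ^ 2 * 4 ≤ 18 * (1 / ((n : ℝ) + 3) ^ 2) := by
    rw [div_mul_eq_mul_div, mul_one_div, div_le_div_iff₀ (by positivity) (by positivity)]
    nlinarith [sq_nonneg (n : ℝ), (Nat.cast_nonneg n : (0 : ℝ) ≤ n)]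
  have e3 : momBound N (n + 2) / 2 = 6 ^ n * (18 * (1 / ((n : ℝ) + 3) ^ 2) + 18 * (1 / N)) := by
    unfold momBound
    push_cast
    rw [pow_add]
    ring
  rw [e3]
  refine mul_le_mul_of_nonneg_left ?_ (by positivity)
  have h7 : (0 : ℝ) ≤ 1 / N := by positivity
  nlinarith

/-- The summand `1/N` in `momBound` exists for this: no weight lies below `6ᵐ/N`, so gluing two
words costs at most a factor `N/9`. The `N⁻²` of the Schwinger–Dyson equation pays for that and for
the at most `N` mergings. -/
lemma momBound_merge_le (hN : N ≠ 0) (l m : ℕ) (hm : 1 ≤ m) :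
    momBound N (l + m - 1) ≤ N / 9 * (momBound N (l + 1) * momBound N m) := by
  have hN' : (0 : ℝ) < N := by exact_mod_cast Nat.pos_of_ne_zero hN
  obtain ⟨m, rfl⟩ : ∃ k, m = k + 1 := ⟨m - 1, by omega⟩
  have e : l + (m + 1) - 1 = l + m := by omega
  rw [e]
  have h1 : (6 : ℝ) ^ (m + 1) / N ≤ momBound N (m + 1) := by
    unfold momBound
    rw [mul_add, mul_one_div _ (N : ℝ)]
    have : (0 : ℝ) ≤ 6 ^ (m + 1) * (1 / (((m + 1 : ℕ) : ℝ) + 1) ^ 2) := by positivity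
    linarith
  have h2 : momBound N (l + m) ≤ 6 ^ (l + m) * (4 * (1 / ((l : ℝ) + 2) ^ 2 + 1 / N)) := by
    unfold momBound
    refine mul_le_mul_of_nonneg_left ?_ (by positivity)
    have h3 : 1 / (((l + m : ℕ) : ℝ) + 1) ^ 2 ≤ 4 * (1 / ((l : ℝ) + 2) ^ 2) := by
      rw [mul_one_div, div_le_div_iff₀ (by positivity) (by positivity)]
      push_cast
      nlinarith [(Nat.cast_nonneg l : (0 : ℝ) ≤ l), (Nat.cast_nonneg m : (0 : ℝ) ≤ m),
        mul_nonneg (Nat.cast_nonneg l : (0 : ℝ) ≤ l) (Nat.cast_nonneg m : (0 : ℝ) ≤ m)]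
    have : (0 : ℝ) ≤ 1 / N := by positivity
    linarith
  have h4 : (6 : ℝ) ^ (l + m) * (4 * (1 / ((l : ℝ) + 2) ^ 2 + 1 / N)) =
      N / 9 * (momBound N (l + 1) * (6 ^ (m + 1) / N)) := by
    unfold momBound
    push_cast
    have : (l : ℝ) + 1 + 1 = l + 2 := by ring
    rw [this, pow_add, pow_succ, pow_succ]
    field_simp
    ring
  refine h2.trans (h4.le.trans ?_)
  refine mul_le_mul_of_nonneg_left ?_ (by positivity)
  exact mul_le_mul_of_nonneg_left h1 (momBound_nonneg _ _)

/-- The product of the moment weights. -/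
def momBoundProd (N : ℕ) (ws : List (List (Fin d))) : ℝ := (ws.map fun w => momBound N w.length).prod

lemma momBoundProd_nonneg (N : ℕ) (ws : List (List (Fin d))) : 0 ≤ momBoundProd N ws := by
  unfold momBoundProd
  refine List.prod_nonneg fun x hx => ?_
  obtain ⟨w, -, rfl⟩ := List.mem_map.1 hx
  exact momBound_nonneg _ _

lemma momBoundProd_cons (N : ℕ) (w : List (Fin d)) (ws : List (List (Fin d))) :
    momBoundProd N (w :: ws) = momBound N w.length * momBoundProd N ws := by
  simp [momBoundProd]

lemma sum_merges_le (hN : N ≠ 0) (j : Fin d) (w : List (Fin d)) (ws : List (List (Fin d))) :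
    ((merges j w ws).map (momBoundProd N)).sum ≤
      N / 9 * totalLen ws * (momBound N (w.length + 1) * momBoundProd N ws) := by
  induction ws with
  | nil => simp [merges, totalLen]
  | cons x xs ih =>
    rw [merges, List.map_append, List.sum_append, List.map_map, List.map_map]
    have h1 : ((splits j x).map (momBoundProd N ∘ fun p => (w ++ p.2 ++ p.1) :: xs)).sum ≤
        x.length * (N / 9 * (momBound N (w.length + 1) * momBound N x.length) *
          momBoundProd N xs) := by
      have h2 : ∀ y ∈ (splits j x).map (momBoundProd N ∘ fun p => (w ++ p.2 ++ p.1) :: xs),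
          y ≤ N / 9 * (momBound N (w.length + 1) * momBound N x.length) * momBoundProd N xs := by
        intro y hy
        obtain ⟨p, hp, rfl⟩ := List.mem_map.1 hy
        have := length_of_mem_splits hp
        simp only [Function.comp_apply, momBoundProd_cons]
        refine mul_le_mul_of_nonneg_right ?_ (momBoundProd_nonneg _ _)
        have h3 : (w ++ p.2 ++ p.1).length = w.length + x.length - 1 := by
          simp only [List.length_append]; omega
        rw [h3]
        exact momBound_merge_le hN w.length x.length (by omega)
      refine (List.sum_le_card_nsmul _ _ h2).trans ?_
      rw [nsmul_eq_mul, List.length_map]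
      refine mul_le_mul_of_nonneg_right (by exact_mod_cast length_splits_le j x) ?_
      have := momBound_nonneg N (w.length + 1)
      have := momBound_nonneg N x.length
      have := momBoundProd_nonneg N xs
      positivity
    have h3 : ((merges j w xs).map (momBoundProd N ∘ fun y => x :: y)).sum ≤
        momBound N x.length * (N / 9 * totalLen xs *
          (momBound N (w.length + 1) * momBoundProd N xs)) := by
      have : (momBoundProd N ∘ fun y => x :: y) = fun y => momBound N x.length * momBoundProd N y := by
        ext y; simp [momBoundProd_cons]
      rw [this, List.sum_map_mul_left]
      exact mul_le_mul_of_nonneg_left ih (momBound_nonneg _ _)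
    refine (add_le_add h1 h3).trans (le_of_eq ?_)
    rw [momBoundProd_cons]
    simp only [totalLen, List.map_cons, List.sum_cons]
    push_cast
    ring

lemma norm_list_sum_le {α : Type*} (l : List α) (F : α → ℂ) (G : α → ℝ)
    (h : ∀ x ∈ l, ‖F x‖ ≤ G x) : ‖(l.map F).sum‖ ≤ (l.map G).sum := by
  induction l with
  | nil => simp
  | cons x l ih =>
    simp only [List.map_cons, List.sum_cons]
    exact (norm_add_le _ _).trans (add_le_add (h x (by simp)) (ih fun y hy => h y (by simp [hy])))

/-- The moments of GUE matrices of order at most `N` grow at most exponentially. -/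
lemma norm_gaussE_wordTrProd_le (hN : N ≠ 0) (ws : List (List (Fin d))) (hws : totalLen ws ≤ N) :
    ‖gaussE (Coord d N) ℂ (wordTrProd N ws)‖ ≤ momBoundProd N ws := by
  have hN' : (0 : ℝ) < N := by exact_mod_cast Nat.pos_of_ne_zero hN
  induction ws using words_induction with
  | nil => simp [wordTrProd, gaussE_one, momBoundProd]
  | nil_cons ws ih =>
    rw [wordTrProd_nil_cons hN, momBoundProd_cons]
    refine (ih (by simpa [totalLen] using hws)).trans
      (le_mul_of_one_le_left (momBoundProd_nonneg _ _) ?_)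
    simp [momBound]
  | cons_cons j w ws ih1 ih2 =>
    have hl : w.length + 1 + totalLen ws ≤ N := by simpa [totalLen] using hws
    rw [schwinger_dyson hN]
    refine (norm_add_le _ _).trans ?_
    have h1 := norm_list_sum_le (splits j w)
      (fun p => gaussE (Coord d N) ℂ (wordTrProd N (p.1 :: p.2 :: ws)))
      (fun p => momBound N p.1.length * momBound N p.2.length * momBoundProd N ws) fun p hp => by
        have := length_of_mem_splits hp
        refine (ih1 p hp ?_).trans (le_of_eq ?_)
        · simp only [totalLen, List.map_cons, List.sum_cons] at hl ⊢; omega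
        · simp only [momBoundProd_cons, mul_assoc]
    have h2 := norm_list_sum_le (merges j w ws)
      (fun x => gaussE (Coord d N) ℂ (wordTrProd N x)) (momBoundProd N) fun x hx => by
        have := of_mem_merges hx
        exact ih2 x hx (by omega)
    -- The splits are allotted half of the weight here, the mergings the other half below.
    have h3 : ((splits j w).map fun p => momBound N p.1.length * momBound N p.2.length *
        momBoundProd N ws).sum ≤ momBound N (w.length + 1) / 2 * momBoundProd N ws := by
      rw [List.sum_map_mul_right]
      refine mul_le_mul_of_nonneg_right ?_ (momBoundProd_nonneg _ _)
      refine (sum_splits_le j w (fun a b => momBound N a * momBound N b) fun a b =>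
        mul_nonneg (momBound_nonneg _ _) (momBound_nonneg _ _)).trans ?_
      rcases hw : w.length with _ | n
      · simpa using div_nonneg (momBound_nonneg N 1) zero_le_two
      · exact momBound_convolution n (by omega)
    have h4 := sum_merges_le hN j w ws
    have h5 : ‖(N : ℂ)⁻¹ ^ 2 *
        ((merges j w ws).map fun x => gaussE (Coord d N) ℂ (wordTrProd N x)).sum‖ ≤
        momBound N (w.length + 1) / 2 * momBoundProd N ws := by
      rw [norm_mul, norm_pow, norm_inv, Complex.norm_natCast]
      refine (mul_le_mul_of_nonneg_left (h2.trans h4) (by positivity)).trans ?_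
      have h6 : (totalLen ws : ℝ) ≤ N := by exact_mod_cast (by omega : totalLen ws ≤ N)
      have h7 : 0 ≤ momBound N (w.length + 1) * momBoundProd N ws :=
        mul_nonneg (momBound_nonneg _ _) (momBoundProd_nonneg _ _)
      have h8 : ((N : ℝ)⁻¹) ^ 2 * (N / 9 * totalLen ws) ≤ 1 / 2 := by
        rw [inv_pow, inv_mul_le_iff₀ (by positivity)]
        nlinarith
      calc _ = ((N : ℝ)⁻¹) ^ 2 * (N / 9 * totalLen ws) *
            (momBound N (w.length + 1) * momBoundProd N ws) := by ring
        _ ≤ 1 / 2 * (momBound N (w.length + 1) * momBoundProd N ws) :=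
            mul_le_mul_of_nonneg_right h8 h7
        _ = _ := by ring
    rw [momBoundProd_cons, List.length_cons]
    linarith

end Moments

/-! ### The law of the GUE in terms of standard Gaussian variables -/

section Law

lemma pi_withDensity_ofReal {ι : Type*} [Fintype ι] {E : ι → Type*} [∀ i, MeasureSpace (E i)]
    [∀ i, SigmaFinite (volume : Measure (E i))] (g : ∀ i, E i → ℝ) (hg0 : ∀ i x, 0 ≤ g i x)
    (hg : ∀ i, Integrable (g i)) :
    (Measure.pi fun i => (volume : Measure (E i))).withDensity
      (fun x => ENNReal.ofReal (∏ i, g i (x i))) =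
      Measure.pi fun i => (volume : Measure (E i)).withDensity fun y => ENNReal.ofReal (g i y) := by
  have : ∀ i, IsFiniteMeasure
      ((volume : Measure (E i)).withDensity fun y => ENNReal.ofReal (g i y)) := fun i =>
    isFiniteMeasure_withDensity_ofReal (hg i).2
  refine (Measure.pi_eq fun s hs => ?_).symm
  rw [withDensity_apply _ (MeasurableSet.univ_pi hs), ← lintegral_indicator (MeasurableSet.univ_pi hs)]
  have h1 : ∀ x : ∀ i, E i, (Set.univ.pi s).indicator
      (fun x => ENNReal.ofReal (∏ i, g i (x i))) x =
      ENNReal.ofReal (∏ i, (s i).indicator (g i) (x i)) := by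
    intro x
    by_cases hx : x ∈ Set.univ.pi s
    · rw [Set.indicator_of_mem hx]
      congr 1
      exact Finset.prod_congr rfl fun i _ =>
        (Set.indicator_of_mem (hx i (Set.mem_univ i)) _).symm
    · rw [Set.indicator_of_notMem hx]
      simp only [Set.mem_univ_pi, not_forall] at hx
      obtain ⟨i, hi⟩ := hx
      rw [Finset.prod_eq_zero (Finset.mem_univ i) (Set.indicator_of_notMem hi _)]
      simp
  have hi : ∀ i, Integrable ((s i).indicator (g i)) := fun i => (hg i).indicator (hs i)
  have h0 : ∀ i x, 0 ≤ (s i).indicator (g i) x := fun i x =>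
    Set.indicator_nonneg (fun x _ => hg0 i x) x
  simp only [h1]
  rw [← ofReal_integral_eq_lintegral_ofReal (Integrable.fintype_prod_dep hi)
    (Filter.Eventually.of_forall fun x => Finset.prod_nonneg fun i _ => h0 i _),
    integral_fintype_prod_eq_prod,
    ENNReal.ofReal_prod_of_nonneg fun i _ => integral_nonneg (h0 i)]
  refine Finset.prod_congr rfl fun i _ => ?_
  rw [withDensity_apply _ (hs i), ofReal_integral_eq_lintegral_ofReal (hi i)
    (Filter.Eventually.of_forall (h0 i)), ← lintegral_indicator (hs i)]
  congr 1
  ext x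
  by_cases hx : x ∈ s i <;> simp [hx]

lemma withDensity_map_eq {α β : Type*} [MeasurableSpace α] [MeasurableSpace β] (μ : Measure α)
    {f : α → β} (hf : Measurable f) {g : β → ENNReal} (hg : Measurable g) :
    (μ.map f).withDensity g = (μ.withDensity (g ∘ f)).map f := by
  ext s hs
  rw [withDensity_apply _ hs, Measure.map_apply hf hs, withDensity_apply _ (hf hs),
    setLIntegral_map hs hg hf]
  rfl

/-- The variances of the real coordinates of a GUE matrix. -/
def gueVar (N : ℕ) (a b : Fin N) : NNReal := if a = b then (N : NNReal)⁻¹ else (2 * N : NNReal)⁻¹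

variable {N : ℕ}

lemma gueVar_ne_zero (hN : N ≠ 0) (a b : Fin N) : gueVar N a b ≠ 0 := by
  unfold gueVar; split_ifs <;> simp [hN]

lemma measurable_hermitianOfReal (N : ℕ) : Measurable (hermitianOfReal N) := by
  refine measurable_pi_lambda _ fun i => measurable_pi_lambda _ fun j => ?_
  unfold hermitianOfReal
  simp only [Matrix.of_apply]
  split_ifs <;> fun_prop

/-- The weight `2` off the diagonal is why `gueVar` is halved there. -/
lemma trace_hermitianOfReal_sq (N : ℕ) (x : Fin N → Fin N → ℝ) :
    (hermitianOfReal N x * hermitianOfReal N x).trace.re =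
      ∑ a, ∑ b, (if a = b then 1 else 2) * x a b ^ 2 := by
  have h1 : (hermitianOfReal N x * hermitianOfReal N x).trace.re =
      ∑ a, ∑ b, (if a = b then x a b ^ 2 else x a b ^ 2 + x b a ^ 2) := by
    simp only [Matrix.trace, Matrix.diag_apply, Matrix.mul_apply, Complex.re_sum]
    refine Finset.sum_congr rfl fun a _ => Finset.sum_congr rfl fun b _ => ?_
    simp only [hermitianOfReal, Matrix.of_apply]
    rcases lt_trichotomy a b with h | h | h
    · simp [h.ne, h.ne', h, h.not_gt]; ring
    · subst h; simp; ring
    · simp [h.ne, h.ne', h, h.not_gt]; ring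
  have h2 : ∑ a, ∑ b, (if a = b then 0 else x b a ^ 2) = ∑ a, ∑ b, (if a = b then 0 else x a b ^ 2) := by
    rw [Finset.sum_comm]
    simp only [eq_comm]
  rw [h1]
  have h3 : ∀ a b, (if a = b then x a b ^ 2 else x a b ^ 2 + x b a ^ 2) =
      x a b ^ 2 + if a = b then 0 else x b a ^ 2 := by intro a b; split_ifs <;> simp
  have h4 : ∀ a b, (if a = b then 1 else 2) * x a b ^ 2 =
      x a b ^ 2 + if a = b then 0 else x a b ^ 2 := by
    intro a b; split_ifs <;> ring
  simp only [h3, h4, Finset.sum_add_distrib, h2]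

/-- The law of the real coordinates of a GUE matrix. -/
lemma gue_eq_map (hN : N ≠ 0) :
    gue N = (Measure.pi fun a => Measure.pi fun b => gaussianReal 0 (gueVar N a b)).map
      (hermitianOfReal N) := by
  set g : Fin N → Fin N → ℝ → ℝ := fun a b => gaussianPDFReal 0 (gueVar N a b) with hg
  set c : ℝ := ∏ a, ∏ b, √(2 * Real.pi * gueVar N a b) with hc
  have hpos : ∀ a b, 0 < √(2 * Real.pi * gueVar N a b) := fun a b => by
    have : (0 : ℝ) < gueVar N a b := by
      exact_mod_cast pos_of_ne_zero (gueVar_ne_zero hN a b)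
    positivity
  have hc0 : 0 < c := Finset.prod_pos fun a _ => Finset.prod_pos fun b _ => hpos a b
  have hdens : ∀ x : Fin N → Fin N → ℝ,
      Real.exp (-((N : ℝ) / 2) * (hermitianOfReal N x * hermitianOfReal N x).trace.re) =
        c * ∏ a, ∏ b, g a b (x a b) := by
    intro x
    rw [trace_hermitianOfReal_sq, hc, Finset.mul_sum, Real.exp_sum, ← Finset.prod_mul_distrib]
    refine Finset.prod_congr rfl fun a _ => ?_
    rw [Finset.mul_sum, Real.exp_sum, ← Finset.prod_mul_distrib]
    refine Finset.prod_congr rfl fun b _ => ?_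
    rw [hg]
    simp only [gaussianPDFReal]
    rw [mul_inv_cancel_left₀ (hpos a b).ne']
    congr 1
    have hN' : (N : ℝ) ≠ 0 := by exact_mod_cast hN
    unfold gueVar
    split_ifs
    · push_cast; field_simp; ring
    · push_cast; field_simp; ring
  have hmeas : Measurable fun H : Matrix (Fin N) (Fin N) ℂ =>
      ENNReal.ofReal (Real.exp (-((N : ℝ) / 2) * (H * H).trace.re)) := by
    have h1 : ∀ a b, Measurable fun H : Matrix (Fin N) (Fin N) ℂ => H a b := fun a b =>
      (measurable_pi_apply b).comp (measurable_pi_apply (X := fun _ => Fin N → ℂ) a)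
    simp only [Matrix.trace, Matrix.diag_apply, Matrix.mul_apply]
    fun_prop
  -- The value of `c` is immaterial: only its being positive and finite matters for the
  -- normalization at the end.
  have hw : gueWeight N = ENNReal.ofReal c •
      (Measure.pi fun a => Measure.pi fun b => gaussianReal 0 (gueVar N a b)).map
        (hermitianOfReal N) := by
    rw [gueWeight, hermitianLebesgue, withDensity_map_eq _ (measurable_hermitianOfReal N) hmeas,
      ← Measure.map_smul]
    congr 1
    have h1 : (fun H : Matrix (Fin N) (Fin N) ℂ =>
        ENNReal.ofReal (Real.exp (-((N : ℝ) / 2) * (H * H).trace.re))) ∘ hermitianOfReal N =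
        ENNReal.ofReal c • fun x => ENNReal.ofReal (∏ a, ∏ b, g a b (x a b)) := by
      ext x
      simp only [Function.comp_apply, hdens, Pi.smul_apply, smul_eq_mul]
      rw [ENNReal.ofReal_mul hc0.le]
    rw [h1, withDensity_smul' _ _ ENNReal.ofReal_ne_top]
    congr 1
    have hgi : ∀ a b, Integrable (g a b) := fun a b => integrable_gaussianPDFReal _ _
    have hg0 : ∀ a b x, 0 ≤ g a b x := fun a b x => gaussianPDFReal_nonneg _ _ _
    rw [volume_pi]
    rw [pi_withDensity_ofReal (fun a (y : Fin N → ℝ) => ∏ b, g a b (y b))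
      (fun a y => Finset.prod_nonneg fun b _ => hg0 a b _)
      (fun a => Integrable.fintype_prod (hgi a))]
    congr 1
    ext1 a
    rw [volume_pi, pi_withDensity_ofReal (fun b => g a b) (hg0 a) (hgi a)]
    congr 1
    ext1 b
    rw [gaussianReal_of_var_ne_zero _ (gueVar_ne_zero hN a b)]
    rfl
  have : IsProbabilityMeasure ((Measure.pi fun a => Measure.pi fun b =>
      gaussianReal 0 (gueVar N a b)).map (hermitianOfReal N)) :=
    Measure.isProbabilityMeasure_map (measurable_hermitianOfReal N).aemeasurable
  rw [gue, hw, Measure.smul_apply, measure_univ, smul_eq_mul, mul_one, smul_smul,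
    ENNReal.inv_mul_cancel (by simpa using hc0) ENNReal.ofReal_ne_top, one_smul]

variable {d : ℕ}

/-- The GUE matrices with given standard Gaussian coordinates. -/
def gueSample (x : Coord d N → ℝ) (j : Fin d) : Matrix (Fin N) (Fin N) ℂ :=
  (gueMat d N j).map (evalReal x)

lemma gueSample_eq (x : Coord d N → ℝ) (j : Fin d) :
    gueSample x j = hermitianOfReal N fun a b => √(gueVar N a b) * x (j, a, b) := by
  ext a b
  have h1 : gueSample x j a b = ∑ p, gueCoef a b p * x (j, p) := by
    simp [gueSample, gueMat, evalReal, Matrix.map_apply]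
  have h2 : gueSample x j a b = gueCoef a b ⬝ᵥ fun p => (x (j, p) : ℂ) := h1
  rw [h2]
  unfold gueCoef hermitianOfReal gueVar
  simp only [Matrix.of_apply]
  rcases lt_trichotomy a b with h | h | h
  · simp only [h.ne, h.ne', h, if_true, if_false, smul_dotProduct, add_dotProduct,
      single_one_dotProduct, smul_eq_mul]
    push_cast
    rw [Real.sqrt_inv]
    push_cast
    ring
  · subst h
    simp only [if_true, smul_dotProduct, single_one_dotProduct, smul_eq_mul]
    push_cast
    rw [Real.sqrt_inv]
    push_cast
    ring
  · simp only [h.ne, h.ne', h.not_gt, if_false, smul_dotProduct, sub_dotProduct,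
      single_one_dotProduct, smul_eq_mul]
    push_cast
    rw [Real.sqrt_inv]
    push_cast
    ring

lemma isHermitian_gueSample (x : Coord d N → ℝ) (j : Fin d) : (gueSample x j).IsHermitian := by
  rw [gueSample_eq]
  ext a b
  simp only [Matrix.conjTranspose_apply, hermitianOfReal, Matrix.of_apply]
  rcases lt_trichotomy a b with h | h | h
  · simp [h.ne, h.ne', h, h.not_gt]
  · subst h; simp
  · simp [h.ne, h.ne', h, h.not_gt, sub_eq_add_neg]

lemma stdGauss_map_curry (d N : ℕ) : (stdGauss (Coord d N)).map (fun x j a b => x (j, a, b)) =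
    Measure.pi fun _ : Fin d => Measure.pi fun _ : Fin N => Measure.pi fun _ : Fin N =>
      gaussianReal 0 1 := by
  have h1 : ∀ (α β : Type) [Fintype α] [Fintype β],
      (stdGauss (α × β)).map (fun x a b => x (a, b)) =
        Measure.pi fun _ : α => stdGauss β := by
    intro α β _ _
    have := Measure.infinitePi_map_curry (fun (_ : α) (_ : β) => gaussianReal 0 1)
    simp only [Measure.infinitePi_eq_pi] at this
    exact this
  have h2 : (fun (x : Coord d N → ℝ) j a b => x (j, a, b)) =
      (fun (y : Fin d → Fin N × Fin N → ℝ) j a b => y j (a, b)) ∘ fun x j p => x (j, p) := rfl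
  rw [h2, ← Measure.map_map (by fun_prop) (by fun_prop), h1,
    Measure.pi_map_pi (f := fun _ (y : Fin N × Fin N → ℝ) a b => y (a, b))
      (fun _ => Measurable.aemeasurable (by fun_prop))]
  congr 1
  ext1 j
  exact h1 (Fin N) (Fin N)

/-- The joint law of independent GUE matrices is the law of `gueSample` under the standard
Gaussian measure. -/
lemma map_eq_of_isIndepGUE (hN : N ≠ 0) {Ω : Type*} [MeasurableSpace Ω] {μ : Measure Ω}
    [IsProbabilityMeasure μ] {G : Fin d → Ω → Matrix (Fin N) (Fin N) ℂ} (hG : IsIndepGUE μ G) :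
    μ.map (fun ω j => G j ω) = (stdGauss (Coord d N)).map gueSample := by
  have h1 : ∀ j, AEMeasurable (G j) μ := fun j => (hG.hasLaw j).aemeasurable
  rw [(iIndepFun_iff_map_fun_eq_pi_map h1).1 hG.indep]
  have hm : Measurable fun (z : Fin N → Fin N → ℝ) =>
      hermitianOfReal N fun a b => √(gueVar N a b) * z a b :=
    (measurable_hermitianOfReal N).comp (by fun_prop)
  have h2 : gue N = (Measure.pi fun _ : Fin N => Measure.pi fun _ : Fin N =>
      gaussianReal 0 1).map fun z => hermitianOfReal N fun a b => √(gueVar N a b) * z a b := by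
    have h3 : (fun z : Fin N → Fin N → ℝ =>
        hermitianOfReal N fun a b => √(gueVar N a b) * z a b) =
        hermitianOfReal N ∘ fun z a b => √(gueVar N a b) * z a b := rfl
    have h4 : ∀ a b, gaussianReal 0 (gueVar N a b) =
        (gaussianReal 0 1).map fun t => √(gueVar N a b) * t := by
      intro a b
      rw [gaussianReal_map_const_mul]
      congr 1
      · simp
      · ext
        simp [Real.sq_sqrt]
    rw [gue_eq_map hN, h3, ← Measure.map_map (measurable_hermitianOfReal N) (by fun_prop)]
    congr 1
    have h5 : ∀ a, SigmaFinite ((Measure.pi fun _ : Fin N => gaussianReal 0 1).map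
        fun y b => √(gueVar N a b) * y b) := fun a =>
      haveI := Measure.isProbabilityMeasure_map (μ := Measure.pi fun _ : Fin N => gaussianReal 0 1)
        (f := fun (y : Fin N → ℝ) b => √(gueVar N a b) * y b)
        (Measurable.aemeasurable (by fun_prop))
      inferInstance
    have h6 : ∀ a b, SigmaFinite ((gaussianReal 0 1).map fun t => √(gueVar N a b) * t) := by
      intro a b; rw [← h4]; infer_instance
    rw [Measure.pi_map_pi (f := fun a (y : Fin N → ℝ) b => √(gueVar N a b) * y b)
      (fun _ => Measurable.aemeasurable (by fun_prop))]
    congr 1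
    ext1 a
    rw [Measure.pi_map_pi (f := fun b (t : ℝ) => √(gueVar N a b) * t) (fun _ => by fun_prop)]
    simp only [← h4]
  have h7 : (fun j => μ.map (G j)) = fun _ : Fin d => (Measure.pi fun _ : Fin N =>
      Measure.pi fun _ : Fin N => gaussianReal 0 1).map fun z =>
        hermitianOfReal N fun a b => √(gueVar N a b) * z a b := by
    ext1 j; rw [(hG.hasLaw j).map_eq, h2]
  have h8 : ∀ _ : Fin d, SigmaFinite ((Measure.pi fun _ : Fin N =>
      Measure.pi fun _ : Fin N => gaussianReal 0 1).map fun z =>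
        hermitianOfReal N fun a b => √(gueVar N a b) * z a b) := fun _ =>
    haveI := Measure.isProbabilityMeasure_map (μ := Measure.pi fun _ : Fin N =>
      Measure.pi fun _ : Fin N => gaussianReal 0 1) hm.aemeasurable
    inferInstance
  have h9 : Measurable fun (z : Fin d → Fin N → Fin N → ℝ) (j : Fin d) =>
      hermitianOfReal N fun a b => √(gueVar N a b) * z j a b :=
    measurable_pi_lambda _ fun j => hm.comp (measurable_pi_apply j)
  rw [h7, ← Measure.pi_map_pi (fun _ => hm.aemeasurable), ← stdGauss_map_curry,
    Measure.map_map h9 (by fun_prop)]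
  congr 1
  ext1 x
  ext1 j
  exact (gueSample_eq x j).symm

end Law

/-! ### Polynomials bounded at the points `1/N` -/

section PolynomialBounds

/-- The Bernstein–Walsh inequality in Joukowski coordinates. -/
lemma norm_eval_joukowski_le {p : ℂ[X]} {n : ℕ} (hp : p.natDegree ≤ n) {S : ℝ}
    (hS : ∀ x : ℝ, |x| ≤ 1 → ‖p.eval (x : ℂ)‖ ≤ S) {w : ℂ} (hw0 : w ≠ 0) (hw : ‖w‖ ≤ 1) :
    ‖p.eval ((w + w⁻¹) / 2)‖ * ‖w‖ ^ n ≤ S := by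
  -- This is `wⁿ p((w + w⁻¹)/2)` with the pole at `0` removed. The Joukowski map sends the unit
  -- circle to `[-1, 1]`, so the maximum principle on the unit disc applies.
  set q : ℂ → ℂ := fun w =>
    ∑ k ∈ Finset.range (n + 1), p.coeff k * ((w ^ 2 + 1) / 2) ^ k * w ^ (n - k) with hq
  have hqe : ∀ w : ℂ, w ≠ 0 → q w = p.eval ((w + w⁻¹) / 2) * w ^ n := by
    intro w hw
    rw [Polynomial.eval_eq_sum_range' (Nat.lt_succ_of_le hp), Finset.sum_mul]
    refine Finset.sum_congr rfl fun k hk => ?_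
    have hk' : k ≤ n := by have := Finset.mem_range.1 hk; omega
    have e : (w ^ 2 + 1) / 2 = (w + w⁻¹) / 2 * w := by field_simp
    have e2 : w ^ n = w ^ k * w ^ (n - k) := by rw [← pow_add]; congr 1; omega
    rw [e, e2, mul_pow]; ring
  have hqd : Differentiable ℂ q := by rw [hq]; fun_prop
  have hbd : ∀ z ∈ frontier (Metric.ball (0 : ℂ) 1), ‖q z‖ ≤ S := by
    intro z hz
    rw [frontier_ball _ one_ne_zero, mem_sphere_zero_iff_norm] at hz
    have hz0 : z ≠ 0 := by rintro rfl; simp at hz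
    have e : (z + z⁻¹) / 2 = ((z.re : ℝ) : ℂ) := by
      rw [Complex.inv_eq_conj hz, Complex.add_conj]; push_cast; ring
    rw [hqe z hz0, norm_mul, norm_pow, hz, one_pow, mul_one, e]
    exact hS _ (hz ▸ Complex.abs_re_le_norm z)
  have := Complex.norm_le_of_forall_mem_frontier_norm_le Metric.isBounded_ball hqd.diffContOnCl hbd
    (z := w) (by rw [closure_ball _ one_ne_zero]; simpa using hw)
  rwa [hqe w hw0, norm_mul, norm_pow] at this

/-- The roots of `w² - 2zw + 1` are mutually inverse, so one of them lies in the closed unit disc.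
The last identity says that circles about `0` go to ellipses with foci `±1`. -/
lemma exists_joukowski (z : ℂ) : ∃ w : ℂ, w ≠ 0 ∧ ‖w‖ ≤ 1 ∧ z = (w + w⁻¹) / 2 ∧
    ‖w‖ + ‖w‖⁻¹ = ‖z - 1‖ + ‖z + 1‖ := by
  obtain ⟨s, hs⟩ := IsAlgClosed.exists_pow_nat_eq (z ^ 2 - 1) (n := 2) (by norm_num)
  have hprod : (z + s) * (z - s) = 1 := by linear_combination -hs
  have key : ∀ w w' : ℂ, w * w' = 1 → w + w' = 2 * z → ‖w‖ ≤ 1 → ∃ w : ℂ, w ≠ 0 ∧ ‖w‖ ≤ 1 ∧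
      z = (w + w⁻¹) / 2 ∧ ‖w‖ + ‖w‖⁻¹ = ‖z - 1‖ + ‖z + 1‖ := by
    intro w w' h1 h2 h3
    have hw : w ≠ 0 := left_ne_zero_of_mul_eq_one h1
    have hw' : w' = w⁻¹ := eq_inv_of_mul_eq_one_right h1
    have hz : z = (w + w⁻¹) / 2 := by rw [← hw', h2]; ring
    refine ⟨w, hw, h3, hz, ?_⟩
    have hn : ‖w‖ ≠ 0 := norm_ne_zero_iff.2 hw
    have e1 : z - 1 = (w - 1) ^ 2 / (2 * w) := by rw [hz]; field_simp; ring
    have e2 : z + 1 = (w + 1) ^ 2 / (2 * w) := by rw [hz]; field_simp; ring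
    rw [e1, e2, norm_div, norm_div, norm_pow, norm_pow, norm_mul, ← add_div]
    have e3 : ‖w - 1‖ ^ 2 + ‖w + 1‖ ^ 2 = 2 * (‖w‖ ^ 2 + 1) := by
      rw [← Complex.normSq_eq_norm_sq, ← Complex.normSq_eq_norm_sq, ← Complex.normSq_eq_norm_sq]
      simp only [Complex.normSq_apply, Complex.sub_re, Complex.sub_im, Complex.add_re,
        Complex.add_im, Complex.one_re, Complex.one_im]
      ring
    rw [e3]
    simp only [Complex.norm_ofNat]
    field_simp
  rcases le_total ‖z + s‖ 1 with h | h
  · exact key _ _ hprod (by ring) h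
  · refine key (z - s) (z + s) (by rw [mul_comm]; exact hprod) (by ring) ?_
    have : ‖z + s‖ * ‖z - s‖ = 1 := by rw [← norm_mul, hprod, norm_one]
    nlinarith [norm_nonneg (z - s)]

lemma norm_eval_le_of_real_bound {p : ℂ[X]} {n : ℕ} (hp : p.natDegree ≤ n) {S : ℝ}
    (hS : ∀ x : ℝ, |x| ≤ 1 → ‖p.eval (x : ℂ)‖ ≤ S) (z : ℂ) :
    ∃ ρ : ℝ, 1 ≤ ρ ∧ ρ + ρ⁻¹ = ‖z - 1‖ + ‖z + 1‖ ∧ ‖p.eval z‖ ≤ S * ρ ^ n := by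
  obtain ⟨w, hw0, hw1, hz, hs⟩ := exists_joukowski z
  have hn : 0 < ‖w‖ := norm_pos_iff.2 hw0
  refine ⟨‖w‖⁻¹, (one_le_inv₀ hn).2 hw1, by rw [inv_inv, add_comm, hs], ?_⟩
  have := norm_eval_joukowski_le hp hS hw0 hw1
  rw [← hz] at this
  rwa [inv_pow, ← div_eq_mul_inv, le_div_iff₀ (by positivity)]

/-- Growth on the real line. -/
lemma norm_eval_real_le {p : ℂ[X]} {n : ℕ} (hp : p.natDegree ≤ n) {S : ℝ} (hS0 : 0 ≤ S)
    (hS : ∀ x : ℝ, |x| ≤ 1 → ‖p.eval (x : ℂ)‖ ≤ S) {R : ℝ} (hR : 1 ≤ R) {x : ℝ} (hx : |x| ≤ R) :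
    ‖p.eval (x : ℂ)‖ ≤ S * (2 * R) ^ n := by
  obtain ⟨ρ, h1, h2, h3⟩ := norm_eval_le_of_real_bound hp hS (x : ℂ)
  refine h3.trans (mul_le_mul_of_nonneg_left (pow_le_pow_left₀ (by linarith) ?_ n) hS0)
  have e1 : ‖(x : ℂ) - 1‖ = |x - 1| := by
    rw [← Complex.ofReal_one, ← Complex.ofReal_sub, Complex.norm_real, Real.norm_eq_abs]
  have e2 : ‖(x : ℂ) + 1‖ = |x + 1| := by
    rw [← Complex.ofReal_one, ← Complex.ofReal_add, Complex.norm_real, Real.norm_eq_abs]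
  rw [e1, e2] at h2
  have h4 : 0 < ρ⁻¹ := by positivity
  have h5 : |x - 1| + |x + 1| ≤ 2 * R := by
    obtain ⟨ha, hb⟩ := abs_le.1 hx
    rcases abs_cases (x - 1) with ⟨h, -⟩ | ⟨h, -⟩ <;> rcases abs_cases (x + 1) with ⟨h', -⟩ | ⟨h', -⟩ <;>
      rw [h, h'] <;> linarith
  linarith

/-- Growth near interior points of the interval. -/
lemma norm_eval_near_le {p : ℂ[X]} {n : ℕ} (hp : p.natDegree ≤ n) {S : ℝ} (hS0 : 0 ≤ S)
    (hS : ∀ x : ℝ, |x| ≤ 1 → ‖p.eval (x : ℂ)‖ ≤ S) {z : ℂ} {c t : ℝ} (hc : 0 < c) (ht : 0 ≤ t)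
    (hre : |z.re| ≤ 1 - c) (him : z.im ^ 2 ≤ c * t ^ 2) :
    ‖p.eval z‖ ≤ S * Real.exp (2 * n * t) := by
  obtain ⟨ρ, h1, h2, h3⟩ := norm_eval_le_of_real_bound hp hS z
  obtain ⟨ha, hb⟩ := abs_le.1 hre
  -- Each focal distance exceeds its horizontal part `A` by at most `t²/2`, because `A` is at least
  -- the distance `c` to the end points.
  have hnorm : ∀ u : ℂ, ∀ A : ℝ, c ≤ A → u.re ^ 2 = A ^ 2 → u.im = z.im →
      ‖u‖ ≤ A + t ^ 2 / 2 := by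
    intro u A hA hu hv
    have hA0 : 0 < A := lt_of_lt_of_le hc hA
    refine abs_le_of_sq_le_sq' (a := ‖u‖) ?_ (by positivity) |>.2
    rw [← Complex.normSq_eq_norm_sq, Complex.normSq_apply, ← sq, ← sq, hu, hv]
    have : c * t ^ 2 ≤ A * t ^ 2 := mul_le_mul_of_nonneg_right hA (by positivity)
    nlinarith [sq_nonneg (t ^ 2)]
  have h4 := hnorm (z - 1) (1 - z.re) (by linarith) (by simp; ring) (by simp)
  have h5 := hnorm (z + 1) (1 + z.re) (by linarith) (by simp; ring) (by simp)
  have hρ : 0 < ρ := by linarith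
  have h6 : ρ + ρ⁻¹ ≤ 2 + t ^ 2 := by rw [h2]; linarith
  set r := √ρ with hr
  have hr1 : 1 ≤ r := Real.one_le_sqrt.2 h1
  have hr2 : r ^ 2 = ρ := Real.sq_sqrt hρ.le
  -- From `ρ + ρ⁻¹ - 2 = (r - r⁻¹)²` one gets `r - r⁻¹ ≤ t`, and `r⁻¹ ≤ 1`.
  have h7 : r ≤ 1 + t := by
    by_contra! h
    have h8 : (ρ - 1) ^ 2 ≤ ρ * t ^ 2 := by
      have : ρ * (ρ + ρ⁻¹) ≤ ρ * (2 + t ^ 2) := mul_le_mul_of_nonneg_left h6 hρ.le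
      rw [mul_add, mul_inv_cancel₀ hρ.ne'] at this
      nlinarith
    have h9 : ρ - 1 ≤ r * t := by
      refine abs_le_of_sq_le_sq' (a := ρ - 1) ?_ (by positivity) |>.2
      rw [mul_pow, hr2]; exact h8
    nlinarith
  have h8 : ρ ≤ Real.exp (2 * t) := by
    have : r ≤ Real.exp t := h7.trans (by linarith [Real.add_one_le_exp t])
    calc ρ = r ^ 2 := hr2.symm
      _ ≤ Real.exp t ^ 2 := pow_le_pow_left₀ (by linarith) this 2
      _ = _ := by rw [← Real.exp_nat_mul]; norm_num
  refine h3.trans (mul_le_mul_of_nonneg_left ?_ hS0)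
  calc ρ ^ n ≤ Real.exp (2 * t) ^ n := pow_le_pow_left₀ hρ.le h8 n
    _ = _ := by rw [← Real.exp_nat_mul]; ring_nf

lemma iteratedDeriv_eval_zero (p : ℂ[X]) (k : ℕ) :
    iteratedDeriv k (fun z => p.eval z) 0 = k ! * p.coeff k := by
  have h : ∀ k, iteratedDeriv k (fun z => p.eval z) = fun z => (derivative^[k] p).eval z := by
    intro k
    induction k with
    | zero => simp
    | succ k ih =>
      rw [iteratedDeriv_succ, ih, Function.iterate_succ_apply']
      ext z
      exact Polynomial.deriv _
  rw [h k]
  change (derivative^[k] p).eval 0 = _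
  rw [← Polynomial.coeff_zero_eq_eval_zero, Polynomial.coeff_iterate_derivative]
  simp [Nat.descFactorial_self]

/-- Coefficients of a polynomial bounded on `[-1, 1]`. -/
lemma norm_coeff_le {p : ℂ[X]} {n : ℕ} (hp : p.natDegree ≤ n) {S : ℝ} (hS0 : 0 ≤ S)
    (hS : ∀ x : ℝ, |x| ≤ 1 → ‖p.eval (x : ℂ)‖ ≤ S) (k : ℕ) :
    ‖p.coeff k‖ ≤ (16 * n) ^ k / k ! * S := by
  rcases Nat.eq_zero_or_pos k with rfl | hk
  · have := hS 0 (by simp)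
    rw [Polynomial.coeff_zero_eq_eval_zero]
    simpa using this
  rcases lt_or_ge n k with hkn | hkn
  · rw [Polynomial.coeff_eq_zero_of_natDegree_lt (by omega), norm_zero]
    positivity
  have hn : (0 : ℝ) < n := by exact_mod_cast lt_of_lt_of_le hk hkn
  have hk' : (0 : ℝ) < k := by exact_mod_cast hk
  have hkn' : (k : ℝ) ≤ n := by exact_mod_cast hkn
  -- With a radius proportional to `k`, the polynomial is at most `S e^(2k)` on the circle, while
  -- `r⁻ᵏ = (2n/k)ᵏ` supplies the factorial through `k! ≤ kᵏ`.
  set r : ℝ := k / (2 * n) with hr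
  have hr0 : 0 < r := by positivity
  have hr1 : r ≤ 1 / 2 := by
    rw [hr, div_le_div_iff₀ (by positivity) (by norm_num)]; linarith
  have hb : ∀ z ∈ Metric.sphere (0 : ℂ) r, ‖p.eval z‖ ≤ S * Real.exp (2 * k) := by
    intro z hz
    rw [mem_sphere_zero_iff_norm] at hz
    have h1 := Complex.abs_re_le_norm z
    have h2 := Complex.abs_im_le_norm z
    have := norm_eval_near_le hp hS0 hS (z := z) (c := 1 / 2) (t := 2 * r) (by norm_num)
      (by positivity) (by linarith) (by
        have h3 : z.im ^ 2 ≤ r ^ 2 := by rw [← sq_abs]; exact pow_le_pow_left₀ (abs_nonneg _) (hz ▸ h2) 2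
        nlinarith)
    refine this.trans (le_of_eq ?_)
    congr 2
    rw [hr]; field_simp
  have hd : DiffContOnCl ℂ (fun z => p.eval z) (Metric.ball 0 r) := by
    have : Differentiable ℂ fun z => p.eval z := p.differentiable
    exact this.diffContOnCl
  have := Complex.norm_iteratedDeriv_le_of_forall_mem_sphere_norm_le k hr0 hd hb
  rw [iteratedDeriv_eval_zero, norm_mul, Complex.norm_natCast, mul_div_assoc] at this
  have h3 := le_of_mul_le_mul_left this (by positivity)
  refine h3.trans ?_
  have h4 : Real.exp (2 * k) ≤ 8 ^ k := by
    rw [mul_comm, Real.exp_nat_mul]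
    refine pow_le_pow_left₀ (Real.exp_pos _).le ?_ k
    have := Real.exp_one_lt_d9
    calc Real.exp 2 = Real.exp 1 ^ 2 := by rw [← Real.exp_nat_mul]; norm_num
      _ ≤ 2.7182818286 ^ 2 := pow_le_pow_left₀ (Real.exp_pos _).le this.le 2
      _ ≤ 8 := by norm_num
  have h5 : (k ! : ℝ) ≤ k ^ k := by exact_mod_cast Nat.factorial_le_pow k
  have h6 : r ^ k = k ^ k / (2 * n) ^ k := by rw [hr, div_pow]
  rw [h6, div_div_eq_mul_div, div_mul_eq_mul_div, div_le_div_iff₀ (by positivity) (by positivity)]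
  have e : (16 * (n : ℝ)) ^ k = 8 ^ k * (2 * n) ^ k := by rw [← mul_pow]; ring
  rw [e]
  have h7 : 0 ≤ S * (2 * n : ℝ) ^ k := by positivity
  calc S * Real.exp (2 * k) * (2 * n) ^ k * k ! = (S * (2 * n) ^ k) * (Real.exp (2 * k) * k !) := by ring
    _ ≤ (S * (2 * n) ^ k) * (8 ^ k * k ^ k) :=
        mul_le_mul_of_nonneg_left (mul_le_mul h4 h5 (by positivity) (by positivity)) h7
    _ = _ := by ring

/-- The derivative of a polynomial bounded on `[-1, 1]`, away from the end points. -/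
lemma norm_derivative_eval_le {p : ℂ[X]} {n : ℕ} (hn : 1 ≤ n) (hp : p.natDegree ≤ n) {S : ℝ}
    (hS0 : 0 ≤ S) (hS : ∀ x : ℝ, |x| ≤ 1 → ‖p.eval (x : ℂ)‖ ≤ S) {x : ℝ} (hx : |x| ≤ 15 / 16) :
    ‖p.derivative.eval (x : ℂ)‖ ≤ 96 * n * S := by
  have hn' : (1 : ℝ) ≤ n := by exact_mod_cast hn
  -- At distance of order `1/n` the polynomial grows by a constant factor only, so Cauchy's estimate
  -- yields Bernstein's inequality.
  set r : ℝ := 1 / (32 * n) with hr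
  have hr0 : 0 < r := by positivity
  have hr1 : r ≤ 1 / 32 := by
    rw [hr, div_le_div_iff₀ (by positivity) (by norm_num)]; linarith
  have hb : ∀ z ∈ Metric.sphere (x : ℂ) r, ‖p.eval z‖ ≤ S * Real.exp 1 := by
    intro z hz
    rw [mem_sphere_iff_norm] at hz
    have h1 := Complex.abs_re_le_norm (z - x)
    have h2 := Complex.abs_im_le_norm (z - x)
    simp only [Complex.sub_re, Complex.ofReal_re, Complex.sub_im, Complex.ofReal_im, sub_zero] at h1 h2
    rw [hz] at h1 h2
    have h4 : |z.re| ≤ 1 - 1 / 32 := by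
      have : |z.re| ≤ |z.re - x| + |x| := by
        have := abs_add_le (z.re - x) x; rwa [sub_add_cancel] at this
      linarith
    have := norm_eval_near_le hp hS0 hS (z := z) (c := 1 / 32) (t := 16 * r) (by norm_num)
      (by positivity) h4 (by
        have h3 : z.im ^ 2 ≤ r ^ 2 := by rw [← sq_abs]; exact pow_le_pow_left₀ (abs_nonneg _) h2 2
        nlinarith)
    refine this.trans (le_of_eq ?_)
    congr 2
    rw [hr]; field_simp; norm_num
  have hd : DiffContOnCl ℂ (fun z => p.eval z) (Metric.ball (x : ℂ) r) := by
    have : Differentiable ℂ fun z => p.eval z := p.differentiable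
    exact this.diffContOnCl
  have := Complex.norm_deriv_le_of_forall_mem_sphere_norm_le hr0 hd hb
  rw [Polynomial.deriv] at this
  refine this.trans ?_
  rw [hr, div_div_eq_mul_div, div_one]
  have h3 : Real.exp 1 ≤ 3 := by linarith [Real.exp_one_lt_d9]
  have : 0 ≤ S * (32 * n) := by positivity
  nlinarith

end PolynomialBounds

/-! ### From values at reciprocals of integers to Taylor coefficients and remainders -/

section Discretization

lemma eval_map_ofReal (p : ℝ[X]) (x : ℝ) :
    (p.map Complex.ofRealHom).eval (x : ℂ) = ((p.eval x : ℝ) : ℂ) := by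
  rw [Polynomial.eval_map]
  exact Polynomial.eval₂_at_apply Complex.ofRealHom x

lemma norm_eval_map_ofReal (p : ℝ[X]) (x : ℝ) :
    ‖(p.map Complex.ofRealHom).eval (x : ℂ)‖ = |p.eval x| := by
  rw [eval_map_ofReal, Complex.norm_real, Real.norm_eq_abs]

lemma abs_eval_le_of_abs_le {p : ℝ[X]} {n : ℕ} (hp : p.natDegree ≤ n) {S : ℝ} (hS0 : 0 ≤ S)
    (hS : ∀ x : ℝ, |x| ≤ 1 → |p.eval x| ≤ S) {R : ℝ} (hR : 1 ≤ R) {x : ℝ} (hx : |x| ≤ R) :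
    |p.eval x| ≤ S * (2 * R) ^ n := by
  rw [← norm_eval_map_ofReal]
  exact norm_eval_real_le (natDegree_map_le.trans hp) hS0
    (fun x hx => by rw [norm_eval_map_ofReal]; exact hS x hx) hR hx

lemma abs_coeff_le {p : ℝ[X]} {n : ℕ} (hp : p.natDegree ≤ n) {S : ℝ} (hS0 : 0 ≤ S)
    (hS : ∀ x : ℝ, |x| ≤ 1 → |p.eval x| ≤ S) (k : ℕ) :
    |p.coeff k| ≤ (16 * n) ^ k / k ! * S := by
  have := norm_coeff_le (p := p.map Complex.ofRealHom) (natDegree_map_le.trans hp) hS0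
    (fun x hx => by rw [norm_eval_map_ofReal]; exact hS x hx) k
  simpa [Polynomial.coeff_map] using this

lemma abs_eval_sub_eval_le {p : ℝ[X]} {n : ℕ} (hn : 1 ≤ n) (hp : p.natDegree ≤ n) {S : ℝ}
    (hS0 : 0 ≤ S) (hS : ∀ x : ℝ, |x| ≤ 1 → |p.eval x| ≤ S) {x y : ℝ} (hx : |x| ≤ 15 / 16)
    (hy : |y| ≤ 15 / 16) : |p.eval x - p.eval y| ≤ 96 * n * S * |x - y| := by
  have hb : ∀ z ∈ Set.Icc (-(15 / 16) : ℝ) (15 / 16), ‖p.derivative.eval z‖ ≤ 96 * n * S := by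
    intro z hz
    have := norm_derivative_eval_le (p := p.map Complex.ofRealHom) hn (natDegree_map_le.trans hp) hS0
      (fun x hx => by rw [norm_eval_map_ofReal]; exact hS x hx) (abs_le.2 hz)
    rwa [Polynomial.derivative_map, norm_eval_map_ofReal] at this
  have := (convex_Icc (-(15 / 16) : ℝ) (15 / 16)).norm_image_sub_le_of_norm_hasDerivWithin_le
    (fun z _ => (p.hasDerivAt z).hasDerivWithinAt) hb (abs_le.1 hy) (abs_le.1 hx)
  simpa [Real.norm_eq_abs] using this

/-- Rounding `N₀/a` up to an integer `N` gives a point below `a` with error at most `a/N`; for `a =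
0` one takes `N = N₀²`. -/
lemma exists_div_near {N₀ : ℕ} (hN₀ : 2 ≤ N₀) {a : ℝ} (ha : 0 ≤ a) (ha' : a ≤ 15 / 16) :
    ∃ N : ℕ, N₀ ≤ N ∧ |a - (N₀ : ℝ) / N| ≤ 1 / N₀ ∧ |(N₀ : ℝ) / N| ≤ 15 / 16 := by
  have h0 : (2 : ℝ) ≤ N₀ := by exact_mod_cast hN₀
  rcases ha.eq_or_lt with rfl | ha
  · refine ⟨N₀ * N₀, by nlinarith, ?_, ?_⟩
    · push_cast
      rw [zero_sub, abs_neg, abs_of_nonneg (by positivity)]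
      apply le_of_eq; field_simp
    · push_cast
      rw [abs_of_nonneg (by positivity), div_le_div_iff₀ (by positivity) (by norm_num)]
      nlinarith
  · have h1 : (N₀ : ℝ) / a ≤ ⌈(N₀ : ℝ) / a⌉₊ := Nat.le_ceil _
    have h2 : (⌈(N₀ : ℝ) / a⌉₊ : ℝ) < N₀ / a + 1 := Nat.ceil_lt_add_one (by positivity)
    set N := ⌈(N₀ : ℝ) / a⌉₊
    have h3 : (N₀ : ℝ) ≤ N₀ / a := by rw [le_div_iff₀ ha]; nlinarith
    have h4 : (N₀ : ℝ) ≤ N := h3.trans h1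
    have hN : (0 : ℝ) < N := by linarith
    have h5 : (N₀ : ℝ) ≤ N * a := by rwa [div_le_iff₀ ha] at h1
    have h6 : (N : ℝ) * a ≤ N₀ + a := by
      have := mul_le_mul_of_nonneg_right h2.le ha.le
      rwa [add_mul, div_mul_cancel₀ _ ha.ne', one_mul] at this
    have h7 : (N₀ : ℝ) / N ≤ a := by rw [div_le_iff₀ hN]; linarith
    refine ⟨N, by exact_mod_cast h4, ?_, ?_⟩
    · rw [abs_of_nonneg (by linarith), sub_le_iff_le_add, ← sub_le_iff_le_add', le_div_iff₀ hN,
        sub_mul]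
      have h8 : 1 ≤ 1 / (N₀ : ℝ) * N := by rw [one_div_mul_eq_div, le_div_iff₀ (by linarith)]; linarith
      linarith
    · rw [abs_of_nonneg (by positivity)]; linarith

/-- An even polynomial bounded at the points `N₀ / N`, `N ≥ N₀`, is bounded near the origin. -/
lemma abs_eval_le_of_discrete {g : ℝ[X]} {n N₀ : ℕ} (hn : 1 ≤ n) (hg : g.natDegree ≤ n)
    (heven : ∀ y, g.eval (-y) = g.eval y) (hN₀ : 12480 * n ≤ N₀) {M : ℝ}
    (hM : ∀ N : ℕ, N₀ ≤ N → |g.eval ((N₀ : ℝ) / N)| ≤ M) {y₀ : ℝ} (hy₀ : |y₀| ≤ 1 / 4) :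
    |g.eval y₀| ≤ 2 * M := by
  have hn' : (1 : ℝ) ≤ n := by exact_mod_cast hn
  have hN₀' : (12480 : ℝ) * n ≤ N₀ := by exact_mod_cast hN₀
  obtain ⟨hy1, hy2⟩ := abs_le.1 hy₀
  -- The weight equals one at `y₀` and decays exponentially in `n` away from it. It keeps the
  -- maximum of `F` off the end points, where Bernstein's inequality degenerates, at the price of a
  -- degree `65 n`.
  set F : ℝ[X] := g * (1 - C (1 / 4) * (X - C y₀) ^ 2) ^ (32 * n) with hF
  have hFe : ∀ y, F.eval y = g.eval y * (1 - 1 / 4 * (y - y₀) ^ 2) ^ (32 * n) := by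
    intro y; simp [hF]
  have hFd : F.natDegree ≤ 65 * n := by
    have h1 : (1 - C (1 / 4) * (X - C y₀) ^ 2 : ℝ[X]).natDegree ≤ 2 := by compute_degree
    have h2 := natDegree_pow_le_of_le (32 * n) h1
    have := natDegree_mul_le_of_le hg h2
    rw [← hF] at this
    omega
  have hω : ∀ y : ℝ, |y| ≤ 1 → 0 ≤ 1 - 1 / 4 * (y - y₀) ^ 2 ∧ 1 - 1 / 4 * (y - y₀) ^ 2 ≤ 1 := by
    intro y hy
    obtain ⟨h1, h2⟩ := abs_le.1 hy
    constructor <;> nlinarith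
  obtain ⟨ys, hys, hmax⟩ := (isCompact_Icc (a := (-1 : ℝ)) (b := 1)).exists_isMaxOn
    ⟨0, by simp⟩ (f := fun y => |F.eval y|) (F.continuous.abs.continuousOn)
  set S := |F.eval ys| with hS
  have hS0 : 0 ≤ S := abs_nonneg _
  have hb : ∀ y : ℝ, |y| ≤ 1 → |F.eval y| ≤ S := fun y hy => hmax (abs_le.1 hy)
  have hgS : |g.eval y₀| ≤ S := by
    have := hb y₀ (by linarith)
    rw [hFe] at this
    simpa using this
  refine hgS.trans ?_
  have hys' : |ys| ≤ 1 := abs_le.2 hys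
  rcases le_total |ys| (15 / 16) with hc | hc
  -- Interior maximum: a sample point, reflected by evenness if needed, lies within `1/N₀`. Since
  -- `12480 = 2 · 96 · 65`, `F` varies by at most `S/2` on the way.
  · obtain ⟨N, hN1, hN2, hN3⟩ := exists_div_near (N₀ := N₀) (by omega) (abs_nonneg ys) hc
    obtain ⟨y₁, h1, h2, h3⟩ : ∃ y₁ : ℝ, |y₁| ≤ 15 / 16 ∧ |ys - y₁| ≤ 1 / N₀ ∧ |g.eval y₁| ≤ M := by
      rcases le_total 0 ys with h | h
      · rw [abs_of_nonneg h] at hN2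
        exact ⟨_, hN3, hN2, hM N hN1⟩
      · rw [abs_of_nonpos h] at hN2
        refine ⟨-((N₀ : ℝ) / N), by rwa [abs_neg], ?_, by rw [heven]; exact hM N hN1⟩
        rw [← abs_neg]
        convert hN2 using 2
        ring
    have h4 := abs_eval_sub_eval_le (by omega) hFd hS0 hb hc h1
    have h5 : |F.eval y₁| ≤ M := by
      rw [hFe, abs_mul]
      obtain ⟨h6, h7⟩ := hω y₁ (by linarith)
      rw [abs_of_nonneg (pow_nonneg h6 _)]
      have := pow_le_one₀ (n := 32 * n) h6 h7
      have := mul_le_mul h3 this (pow_nonneg h6 _) ((abs_nonneg _).trans h3)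
      linarith
    have h6 : 96 * ((65 * n : ℕ) : ℝ) * S * |ys - y₁| ≤ S / 2 := by
      have h7 : 96 * ((65 * n : ℕ) : ℝ) * S * |ys - y₁| ≤ 96 * ((65 * n : ℕ) : ℝ) * S * (1 / N₀) :=
        mul_le_mul_of_nonneg_left h2 (by positivity)
      refine h7.trans ?_
      rw [mul_one_div, div_le_div_iff₀ (by linarith) (by norm_num)]
      push_cast
      nlinarith
    have h7 := abs_sub_abs_le_abs_sub (F.eval ys) (F.eval y₁)
    rw [← hS] at h7
    linarith
  -- Maximum near an end point: within `1/2` of `y₀` the weight is at least `(15/16)^(32n)`, which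
  -- bounds `g` there, and reaching `ys` costs a further `5ⁿ`. The weight at `ys` is at most
  -- `(903/1024)^(32n)` and beats both, so `S = 0`.
  · have hgrow : ∀ u : ℝ, |u| ≤ 1 →
        |(g.comp (C y₀ + C (1 / 2) * X)).eval u| ≤ S * (16 / 15) ^ (32 * n) := by
      intro u hu
      obtain ⟨hu1, hu2⟩ := abs_le.1 hu
      have h1 := hb (y₀ + 1 / 2 * u) (abs_le.2 ⟨by linarith, by linarith⟩)
      rw [hFe, abs_mul] at h1
      have h2 : (15 / 16 : ℝ) ≤ 1 - 1 / 4 * (y₀ + 1 / 2 * u - y₀) ^ 2 := by nlinarith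
      have h3 := pow_le_pow_left₀ (by norm_num) h2 (32 * n)
      rw [abs_of_nonneg (le_trans (by positivity) h3)] at h1
      have h4 := (mul_le_mul_of_nonneg_left h3 (abs_nonneg _)).trans h1
      have e : ((16 : ℝ) / 15) ^ (32 * n) = ((15 / 16) ^ (32 * n))⁻¹ := by rw [← inv_pow]; norm_num
      rw [e, ← div_eq_mul_inv, le_div_iff₀ (by positivity)]
      simpa using h4
    have hd : (g.comp (C y₀ + C (1 / 2) * X)).natDegree ≤ n := by
      refine natDegree_comp_le.trans ?_
      have : (C y₀ + C (1 / 2) * X : ℝ[X]).natDegree ≤ 1 := by compute_degree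
      calc _ ≤ n * 1 := Nat.mul_le_mul hg this
        _ = n := by ring
    have h1 := abs_eval_le_of_abs_le hd (by positivity) hgrow (R := 5 / 2) (by norm_num)
      (x := 2 * (ys - y₀)) (by
        obtain ⟨h1, h2⟩ := abs_le.1 hys'
        rw [abs_le]; constructor <;> linarith)
    have e1 : (g.comp (C y₀ + C (1 / 2) * X)).eval (2 * (ys - y₀)) = g.eval ys := by
      simp only [eval_comp, eval_add, eval_C, eval_mul, eval_X]
      congr 1; ring
    rw [e1] at h1
    obtain ⟨h6, h7⟩ := hω ys hys'
    have h8 : 1 - 1 / 4 * (ys - y₀) ^ 2 ≤ 903 / 1024 := by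
      have : (11 / 16 : ℝ) ≤ |ys - y₀| := by
        have := abs_sub_abs_le_abs_sub ys y₀
        linarith
      have := pow_le_pow_left₀ (by norm_num) this 2
      rw [sq_abs] at this
      linarith
    have h9 : S ≤ S * (16 / 15) ^ (32 * n) * (2 * (5 / 2)) ^ n * (903 / 1024) ^ (32 * n) := by
      calc S = |g.eval ys| * (1 - 1 / 4 * (ys - y₀) ^ 2) ^ (32 * n) := by
            rw [hS, hFe, abs_mul, abs_of_nonneg (pow_nonneg h6 _)]
        _ ≤ _ := mul_le_mul h1 (pow_le_pow_left₀ h6 h8 _) (pow_nonneg h6 _) (by positivity)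
    have e2 : S * (16 / 15 : ℝ) ^ (32 * n) * (2 * (5 / 2)) ^ n * (903 / 1024) ^ (32 * n)
        = S * ((16 / 15) ^ 32 * 5 * (903 / 1024) ^ 32) ^ n := by
      have : ∀ a b c : ℝ, S * a ^ (32 * n) * b ^ n * c ^ (32 * n) = S * (a ^ 32 * b * c ^ 32) ^ n := by
        intros; rw [pow_mul, pow_mul, mul_pow, mul_pow]; ring
      rw [this, show (2 * (5 / 2) : ℝ) = 5 by norm_num]
    rw [e2] at h9
    have h10 : ((16 / 15 : ℝ) ^ 32 * 5 * (903 / 1024) ^ 32) ^ n ≤ 3 / 4 := by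
      have h : ((16 / 15 : ℝ) ^ 32 * 5 * (903 / 1024) ^ 32) ≤ 3 / 4 := by norm_num
      calc _ ≤ ((16 / 15 : ℝ) ^ 32 * 5 * (903 / 1024) ^ 32) ^ 1 :=
            pow_le_pow_of_le_one (by positivity) (h.trans (by norm_num)) hn
        _ ≤ _ := by rwa [pow_one]
    have h11 : S ≤ 0 := by nlinarith
    have : 0 ≤ M := (abs_nonneg _).trans (hM N₀ le_rfl)
    linarith

/-- Up to index `2t` each term is at most twice the next, so the last one dominates geometrically,
including the initial term `1`. -/
lemma sum_pow_div_factorial_le {t : ℝ} (ht : 0 ≤ t) (m : ℕ) (hm : (m : ℝ) ≤ 2 * t) :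
    1 ≤ 2 ^ m * (t ^ m / m !) ∧
      ∑ k ∈ Finset.range m, t ^ k / (k ! : ℝ) ≤ 2 * (2 ^ m - 1) * (t ^ m / m !) := by
  induction m with
  | zero => simp
  | succ m ih =>
    push_cast at hm
    obtain ⟨h1, h2⟩ := ih (by linarith)
    have hs : t ^ m / (m ! : ℝ) ≤ 2 * (t ^ (m + 1) / ((m + 1)! : ℝ)) := by
      rw [Nat.factorial_succ, pow_succ]
      push_cast
      rw [mul_div_assoc', div_le_div_iff₀ (by positivity) (by positivity)]
      have : 0 ≤ t ^ m * (m ! : ℝ) := by positivity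
      nlinarith
    have hp : (1 : ℝ) ≤ 2 ^ m := one_le_pow₀ (by norm_num)
    refine ⟨?_, ?_⟩
    · refine h1.trans ((mul_le_mul_of_nonneg_left hs (by positivity)).trans (le_of_eq ?_))
      ring
    · rw [Finset.sum_range_succ]
      calc _ ≤ 2 * (2 ^ m - 1) * (t ^ m / (m ! : ℝ)) + t ^ m / (m ! : ℝ) := by linarith
        _ = (2 * 2 ^ m - 1) * (t ^ m / (m ! : ℝ)) := by ring
        _ ≤ (2 * 2 ^ m - 1) * (2 * (t ^ (m + 1) / ((m + 1)! : ℝ))) :=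
            mul_le_mul_of_nonneg_left hs (by linarith)
        _ = _ := by ring

/-- Past index `2t` each term is at most half the previous one; the extra term on the left lets the
induction telescope. -/
lemma sum_pow_div_factorial_tail_le {t : ℝ} (ht : 0 ≤ t) (m : ℕ) (hm : 2 * t ≤ m) (L : ℕ) :
    ∑ j ∈ Finset.range L, t ^ (m + j) / ((m + j)! : ℝ) + 2 * (t ^ (m + L) / ((m + L)! : ℝ))
      ≤ 2 * (t ^ m / m !) := by
  induction L with
  | zero => simp
  | succ L ih =>
    rw [Finset.sum_range_succ]
    have hs : 2 * (t ^ (m + L + 1) / ((m + L + 1)! : ℝ)) ≤ t ^ (m + L) / ((m + L)! : ℝ) := by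
      rw [Nat.factorial_succ, pow_succ]
      push_cast
      rw [mul_div_assoc', div_le_div_iff₀ (by positivity) (by positivity)]
      have : 0 ≤ t ^ (m + L) * ((m + L)! : ℝ) := by positivity
      have hL : (0 : ℝ) ≤ L := by positivity
      nlinarith
    rw [← add_assoc m L 1]
    linarith

/-- Taylor coefficients and remainders of an even polynomial bounded at the reciprocals of large
integers. -/
theorem exists_coeff_remainder_bound (C₀ : ℝ) : ∃ C : ℝ, C₀ ≤ C ∧
    ∀ (n : ℕ), 1 ≤ n → ∀ f : ℝ[X], f.natDegree ≤ n → (∀ y, f.eval (-y) = f.eval y) → ∀ M : ℝ,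
      (∀ N : ℕ, 1 ≤ N → C₀ * n ≤ N → |f.eval ((N : ℝ)⁻¹)| ≤ M) → ∀ m : ℕ,
      |f.coeff m| ≤ (C * n) ^ (2 * m) / m ! * M ∧ ∀ N : ℕ, 1 ≤ N → C₀ * n ≤ N →
        |f.eval ((N : ℝ)⁻¹) - ∑ k ∈ Finset.range m, f.coeff k / (N : ℝ) ^ k|
          ≤ (C * n) ^ (2 * m) / (m ! * (N : ℝ) ^ m) * M := by
  set B : ℕ := max 12480 ⌈C₀⌉₊ with hB
  have hB1 : 12480 ≤ B := le_max_left _ _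
  have hB1' : (12480 : ℝ) ≤ B := by exact_mod_cast hB1
  have hB2 : C₀ ≤ B := (Nat.le_ceil C₀).trans (by exact_mod_cast le_max_right _ _)
  -- In `640 = 10 · 64`, the `64` is the coefficient constant of `hcoef` and the `10`, raised to the
  -- power `m`, absorbs all numerical losses.
  refine ⟨640 * B, by linarith, fun n hn f hf heven M hM m => ?_⟩
  have hn' : (1 : ℝ) ≤ n := by exact_mod_cast hn
  set N₀ : ℕ := B * n with hN₀
  have hN₀1 : 1 ≤ N₀ := by rw [hN₀]; nlinarith
  have hN₀' : (1 : ℝ) ≤ N₀ := by exact_mod_cast hN₀1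
  have hlarge : ∀ N : ℕ, N₀ ≤ N → C₀ * n ≤ N := by
    intro N hN
    have : (B * n : ℝ) ≤ N := by exact_mod_cast hN
    nlinarith
  have hM0 : 0 ≤ M := (abs_nonneg _).trans (hM N₀ hN₀1 (hlarge _ le_rfl))
  have hnear : ∀ y : ℝ, |y| ≤ 1 → |(f.comp (C ((4 * N₀ : ℝ)⁻¹) * X)).eval y| ≤ 2 * M := by
    intro y hy
    have := abs_eval_le_of_discrete (g := f.comp (C ((N₀ : ℝ)⁻¹) * X)) (N₀ := N₀) hn (M := M)
      (y₀ := y / 4) ?_ ?_ ?_ ?_ ?_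
    · convert this using 2
      simp only [eval_comp, eval_mul, eval_C, eval_X]
      congr 1; field_simp
    · refine natDegree_comp_le.trans ?_
      have : (C ((N₀ : ℝ)⁻¹) * X : ℝ[X]).natDegree ≤ 1 := by compute_degree
      calc _ ≤ n * 1 := Nat.mul_le_mul hf this
        _ = n := by ring
    · intro y; simp [eval_comp, heven]
    · rw [hN₀]; exact Nat.mul_le_mul_right _ hB1
    · intro N hN
      have := hM N (by omega) (hlarge N hN)
      convert this using 2
      simp only [eval_comp, eval_mul, eval_C, eval_X]
      congr 1; field_simp
    · rw [abs_div]; norm_num; linarith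
  set a : ℝ := 64 * n * N₀ with ha
  have ha0 : 0 ≤ a := by positivity
  have hcoef : ∀ k, |f.coeff k| ≤ a ^ k / k ! * (2 * M) := by
    intro k
    have hd : (f.comp (C ((4 * N₀ : ℝ)⁻¹) * X)).natDegree ≤ n := by
      refine natDegree_comp_le.trans ?_
      have : (C ((4 * N₀ : ℝ)⁻¹) * X : ℝ[X]).natDegree ≤ 1 := by compute_degree
      calc _ ≤ n * 1 := Nat.mul_le_mul hf this
        _ = n := by ring
    have := abs_coeff_le hd (by positivity) hnear k
    rw [Polynomial.comp_C_mul_X_coeff, abs_mul, abs_pow, abs_of_nonneg (by positivity : (0 : ℝ) ≤ (4 * (N₀ : ℝ))⁻¹),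
      inv_pow, ← div_eq_mul_inv, div_le_iff₀ (by positivity)] at this
    refine this.trans (le_of_eq ?_)
    rw [ha, show (64 : ℝ) * n * N₀ = 16 * n * (4 * N₀) by ring, mul_pow (16 * (n : ℝ))]
    ring
  have hcomp : 10 * a ≤ (640 * B * n : ℝ) ^ 2 := by
    rw [ha, hN₀]; push_cast
    have : (0 : ℝ) ≤ B * n ^ 2 := by positivity
    nlinarith
  have hcompm : ∀ m, (10 * a) ^ m ≤ (640 * B * n : ℝ) ^ (2 * m) := by
    intro m; rw [pow_mul]; exact pow_le_pow_left₀ (by positivity) hcomp m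
  constructor
  · rcases Nat.eq_zero_or_pos m with rfl | hm
    -- For `m = 0` the factor `2` of `hcoef` cannot be absorbed; the limit `N → ∞` gives the
    -- constant one.
    · have hlim : Filter.Tendsto (fun N : ℕ => |f.eval ((N : ℝ)⁻¹)|) Filter.atTop
          (nhds |f.eval 0|) :=
        ((f.continuous.tendsto 0).comp tendsto_inv_atTop_nhds_zero_nat).abs
      have := le_of_tendsto hlim (Filter.eventually_atTop.2
        ⟨N₀, fun N hN => hM N (by omega) (hlarge N hN)⟩)
      rw [Polynomial.coeff_zero_eq_eval_zero]
      simpa using this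
    · refine (hcoef m).trans ?_
      calc a ^ m / m ! * (2 * M) = 2 * a ^ m / m ! * M := by ring
        _ ≤ _ := by
          have h2 : (2 : ℝ) ≤ 10 ^ m := by
            calc (2 : ℝ) ≤ 10 ^ 1 := by norm_num
              _ ≤ 10 ^ m := pow_le_pow_right₀ (by norm_num) hm
          have h3 : 2 * a ^ m ≤ (640 * B * n : ℝ) ^ (2 * m) := by
            refine le_trans ?_ (hcompm m)
            rw [mul_pow 10 a]
            exact mul_le_mul_of_nonneg_right h2 (pow_nonneg ha0 m)
          gcongr
  · intro N hN hCN
    have hN' : (0 : ℝ) < N := by exact_mod_cast hN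
    set t : ℝ := a / N with ht
    have ht0 : 0 ≤ t := by positivity
    have hterm : ∀ k, |f.coeff k / (N : ℝ) ^ k| ≤ 2 * M * (t ^ k / k !) := by
      intro k
      rw [abs_div, abs_of_pos (by positivity : (0 : ℝ) < (N : ℝ) ^ k)]
      refine (div_le_div_of_nonneg_right (hcoef k) (by positivity : (0 : ℝ) ≤ (N : ℝ) ^ k)).trans (le_of_eq ?_)
      rw [ht, div_pow]; ring
    suffices hmain : |f.eval ((N : ℝ)⁻¹) - ∑ k ∈ Finset.range m, f.coeff k / (N : ℝ) ^ k|
        ≤ M * ((10 * t) ^ m / m !) by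
      refine hmain.trans ?_
      have e : M * ((10 * t) ^ m / m !) = (10 * a) ^ m / (m ! * (N : ℝ) ^ m) * M := by
        rw [ht, mul_pow, mul_pow, div_pow]; field_simp
      rw [e]
      gcongr
      exact hcompm m
    rcases Nat.eq_zero_or_pos m with rfl | hm
    · simpa using hM N hN hCN
    -- For `m ≤ 2t` the target is large, and the triangle inequality with `|f(1/N)| ≤ M` is enough.
    -- For `m ≥ 2t` the remainder is a tail dominated by its first term.
    rcases le_total (m : ℝ) (2 * t) with hmt | hmt
    · obtain ⟨h1, h2⟩ := sum_pow_div_factorial_le ht0 m hmt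
      have h3 : |∑ k ∈ Finset.range m, f.coeff k / (N : ℝ) ^ k|
          ≤ 2 * M * ∑ k ∈ Finset.range m, t ^ k / (k ! : ℝ) := by
        rw [Finset.mul_sum]
        exact (Finset.abs_sum_le_sum_abs _ _).trans (Finset.sum_le_sum fun k _ => hterm k)
      have h4 := abs_sub (f.eval ((N : ℝ)⁻¹)) (∑ k ∈ Finset.range m, f.coeff k / (N : ℝ) ^ k)
      have h5 := hM N hN hCN
      have hu : 0 ≤ t ^ m / (m ! : ℝ) := by positivity
      have h6 : ∑ k ∈ Finset.range m, t ^ k / (k ! : ℝ) ≤ 2 * (2 ^ m * (t ^ m / m !)) := by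
        refine h2.trans ?_; nlinarith
      have h7 : (5 : ℝ) * 2 ^ m ≤ 10 ^ m := by
        rw [show (10 : ℝ) = 5 * 2 by norm_num, mul_pow]
        refine mul_le_mul_of_nonneg_right ?_ (by positivity)
        calc (5 : ℝ) = 5 ^ 1 := by norm_num
          _ ≤ 5 ^ m := pow_le_pow_right₀ (by norm_num) hm
      calc _ ≤ M + 2 * M * (2 * (2 ^ m * (t ^ m / m !))) := by
            refine h4.trans (add_le_add h5 (h3.trans ?_))
            exact mul_le_mul_of_nonneg_left h6 (by positivity)
        _ ≤ M * (2 ^ m * (t ^ m / m !)) + 2 * M * (2 * (2 ^ m * (t ^ m / m !))) := by nlinarith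
        _ = M * (5 * 2 ^ m * (t ^ m / m !)) := by ring
        _ ≤ M * (10 ^ m * (t ^ m / m !)) := by gcongr
        _ = _ := by rw [mul_pow]; ring
    · have hsum : f.eval ((N : ℝ)⁻¹) - ∑ k ∈ Finset.range m, f.coeff k / (N : ℝ) ^ k
          = ∑ j ∈ Finset.range (n + 1), f.coeff (m + j) / (N : ℝ) ^ (m + j) := by
        rw [Polynomial.eval_eq_sum_range' (n := m + (n + 1)) (by omega), Finset.sum_range_add]
        simp only [inv_pow, ← div_eq_mul_inv]
        ring
      rw [hsum]
      have h1 := sum_pow_div_factorial_tail_le ht0 m hmt (n + 1)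
      have h2 : 0 ≤ t ^ (m + (n + 1)) / ((m + (n + 1))! : ℝ) := by positivity
      have h3 : (4 : ℝ) ≤ 10 ^ m := by
        calc (4 : ℝ) ≤ 10 ^ 1 := by norm_num
          _ ≤ 10 ^ m := pow_le_pow_right₀ (by norm_num) hm
      calc _ ≤ ∑ j ∈ Finset.range (n + 1), 2 * M * (t ^ (m + j) / ((m + j)! : ℝ)) :=
            (Finset.abs_sum_le_sum_abs _ _).trans (Finset.sum_le_sum fun k _ => hterm _)
        _ = 2 * M * ∑ j ∈ Finset.range (n + 1), t ^ (m + j) / ((m + j)! : ℝ) := by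
            rw [Finset.mul_sum]
        _ ≤ 2 * M * (2 * (t ^ m / m !)) := mul_le_mul_of_nonneg_left (by linarith) (by positivity)
        _ = M * (4 * (t ^ m / m !)) := by ring
        _ ≤ M * (10 ^ m * (t ^ m / m !)) := by gcongr
        _ = _ := by rw [mul_pow]; ring

end Discretization

/-! ### Free semicircular families -/

section Semicircle

lemma eval_S_two_cos_mul_sin (k : ℕ) (θ : ℝ) :
    (Chebyshev.S ℝ k).eval (2 * Real.cos θ) * Real.sin θ = Real.sin ((k + 1) * θ) := by
  induction k using Nat.twoStepInduction with
  | zero => simp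
  | one =>
    simp only [Nat.cast_one, Chebyshev.S_one, eval_X]
    rw [show ((1 : ℝ) + 1) * θ = 2 * θ by ring, Real.sin_two_mul]; ring
  | more k h0 h1 =>
    have e : ((k + 2 : ℕ) : ℤ) = (k : ℤ) + 2 := by push_cast; ring
    rw [e, Chebyshev.S_add_two, eval_sub, eval_mul, eval_X, sub_mul, h0, mul_assoc]
    push_cast at h1
    rw [h1]
    push_cast
    have e1 : ((k : ℝ) + 2 + 1) * θ = (k + 1 + 1) * θ + θ := by ring
    have e2 : ((k : ℝ) + 1) * θ = (k + 1 + 1) * θ - θ := by ring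
    rw [e1, e2, Real.sin_add, Real.sin_sub]; ring

lemma integral_cos_nat_mul (k : ℕ) (hk : k ≠ 0) : ∫ θ in (0 : ℝ)..Real.pi, Real.cos (k * θ) = 0 := by
  have hk' : (k : ℝ) ≠ 0 := by exact_mod_cast hk
  rw [intervalIntegral.integral_comp_mul_left (fun x => Real.cos x) hk']
  simp [Real.sin_nat_mul_pi]

/-- The substitution `x = 2 cos θ` turns the integrand into a multiple of `sin((k+1)θ) sin θ`, that
is, of `cos kθ - cos (k+2)θ`. -/
lemma integral_S_semicircle (k : ℕ) (hk : k ≠ 0) :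
    ∫ x in (-2 : ℝ)..2, (Chebyshev.S ℝ k).eval x * ((2 * Real.pi)⁻¹ * Real.sqrt (4 - x ^ 2)) = 0 := by
  have h := intervalIntegral.integral_comp_mul_deriv (a := 0) (b := Real.pi)
    (f := fun θ => 2 * Real.cos θ) (f' := fun θ => 2 * -Real.sin θ)
    (g := fun x => (Chebyshev.S ℝ k).eval x * ((2 * Real.pi)⁻¹ * Real.sqrt (4 - x ^ 2)))
    (fun θ _ => (Real.hasDerivAt_cos θ).const_mul 2) (by fun_prop)
    (by
      have := (Chebyshev.S ℝ k).continuous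
      fun_prop)
  rw [Real.cos_zero, Real.cos_pi, mul_neg, mul_one] at h
  rw [intervalIntegral.integral_symm, ← h, neg_eq_zero]
  have h2 : ∀ θ ∈ Set.uIcc (0 : ℝ) Real.pi,
      ((fun x => (Chebyshev.S ℝ k).eval x * ((2 * Real.pi)⁻¹ * Real.sqrt (4 - x ^ 2)))
        ∘ fun θ => 2 * Real.cos θ) θ * (2 * -Real.sin θ)
      = -(Real.pi)⁻¹ * (Real.cos (k * θ) - Real.cos ((k + 2 : ℕ) * θ)) := by
    intro θ hθ
    rw [Set.uIcc_of_le Real.pi_pos.le] at hθ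
    have hs : 0 ≤ Real.sin θ := Real.sin_nonneg_of_mem_Icc hθ
    have hsq : Real.sqrt (4 - (2 * Real.cos θ) ^ 2) = 2 * Real.sin θ := by
      rw [show 4 - (2 * Real.cos θ) ^ 2 = (2 * Real.sin θ) ^ 2 by
        nlinarith [Real.sin_sq_add_cos_sq θ], Real.sqrt_sq (by linarith)]
    simp only [Function.comp]
    rw [hsq]
    have e := eval_S_two_cos_mul_sin k θ
    have e1 : (k : ℝ) * θ = (k + 1) * θ - θ := by ring
    have e2 : ((k + 2 : ℕ) : ℝ) * θ = (k + 1) * θ + θ := by push_cast; ring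
    rw [e1, e2, Real.cos_sub, Real.cos_add, ← e]
    have := Real.pi_ne_zero
    field_simp
    ring
  rw [intervalIntegral.integral_congr h2, intervalIntegral.integral_const_mul,
    intervalIntegral.integral_sub (by apply Continuous.intervalIntegrable; fun_prop)
      (by apply Continuous.intervalIntegrable; fun_prop),
    integral_cos_nat_mul k hk, integral_cos_nat_mul (k + 2) (by omega)]
  simp

variable {A : Type*} [CStarAlgebra A] {τ : A →ₗ[ℂ] ℂ}

lemma trace_aeval_of_isSemicircular {a : A} (ha : IsSemicircular τ a) (p : ℝ[X]) :
    τ (aeval a p) =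
      ((∫ x in (-2 : ℝ)..2, p.eval x * ((2 * Real.pi)⁻¹ * Real.sqrt (4 - x ^ 2)) : ℝ) : ℂ) := by
  have hii : ∀ q : ℝ[X], IntervalIntegrable
      (fun x => q.eval x * ((2 * Real.pi)⁻¹ * Real.sqrt (4 - x ^ 2))) volume (-2) 2 := by
    intro q
    apply Continuous.intervalIntegrable
    have := q.continuous
    fun_prop
  induction p using Polynomial.induction_on' with
  | add p q hp hq =>
    rw [map_add, map_add, hp, hq, ← Complex.ofReal_add, ← intervalIntegral.integral_add (hii p) (hii q)]
    simp only [eval_add, add_mul]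
  | monomial k c =>
    rw [aeval_monomial, Algebra.algebraMap_eq_smul_one, smul_one_mul, ← Complex.coe_smul, map_smul,
      ha.2 k, smul_eq_mul, ← Complex.ofReal_mul, ← intervalIntegral.integral_const_mul]
    simp only [eval_monomial, mul_assoc]

lemma trace_aeval_S_of_isSemicircular {a : A} (ha : IsSemicircular τ a) {k : ℕ} (hk : k ≠ 0) :
    τ (aeval a (Chebyshev.S ℝ k)) = 0 := by
  rw [trace_aeval_of_isSemicircular ha, integral_S_semicircle k hk, Complex.ofReal_zero]

end Semicircle

/-! ### Noncommutative Chebyshev polynomials and the full Fock space -/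

section Fock

variable {d : ℕ}

/-- The noncommutative Chebyshev polynomials: the words of the full Fock space basis. -/
def chebWord {B : Type*} [Ring B] (a : Fin d → B) : List (Fin d) → B
  | [] => 1
  | [j] => a j
  | j :: k :: v => a j * chebWord a (k :: v) - if k = j then chebWord a v else 0

/-- The action of `x_j` on the basis of the full Fock space. -/
def fockStep (j : Fin d) : List (Fin d) → (List (Fin d) →₀ ℕ)
  | [] => Finsupp.single [j] 1
  | k :: v => Finsupp.single (j :: k :: v) 1 + if k = j then Finsupp.single v 1 else 0

/-- The sum of the creation and annihilation operators. -/
def fockShift (j : Fin d) : (List (Fin d) →₀ ℕ) →ₗ[ℕ] (List (Fin d) →₀ ℕ) :=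
  Finsupp.linearCombination ℕ (fockStep j)

/-- The vector obtained from the vacuum by applying a word. -/
def fockVec : List (Fin d) → (List (Fin d) →₀ ℕ)
  | [] => Finsupp.single [] 1
  | j :: w => fockShift j (fockVec w)

lemma mul_chebWord {B : Type*} [Ring B] (a : Fin d → B) (j : Fin d) (v : List (Fin d)) :
    a j * chebWord a v = Finsupp.linearCombination ℕ (chebWord a) (fockStep j v) := by
  cases v with
  | nil => simp [chebWord, fockStep]
  | cons k v =>
    by_cases h : k = j <;> simp [chebWord, fockStep, h]

lemma prod_map_eq_fockVec {B : Type*} [Ring B] (a : Fin d → B) (w : List (Fin d)) :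
    (w.map a).prod = Finsupp.linearCombination ℕ (chebWord a) (fockVec w) := by
  induction w with
  | nil => simp [fockVec, chebWord]
  | cons j w ih =>
    have h : (LinearMap.mulLeft ℕ (a j)) ∘ₗ Finsupp.linearCombination ℕ (chebWord a)
        = Finsupp.linearCombination ℕ (chebWord a) ∘ₗ fockShift j := by
      ext v
      simp [fockShift, mul_chebWord]
    rw [List.map_cons, List.prod_cons, ih, fockVec]
    exact LinearMap.congr_fun h (fockVec w)

lemma fockShift_support {j : Fin d} {n : ℕ} {f : List (Fin d) →₀ ℕ}
    (hf : ∀ v ∈ f.support, v.length ≤ n) : ∀ v ∈ (fockShift j f).support, v.length ≤ n + 1 := by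
  intro v hv
  rw [fockShift, Finsupp.linearCombination_apply] at hv
  obtain ⟨u, hu, hv⟩ := Finset.mem_biUnion.1 (Finsupp.support_sum hv)
  have hu' := hf u hu
  have hv' := Finsupp.support_smul hv
  cases u with
  | nil =>
    rw [fockStep] at hv'
    have := Finsupp.support_single_subset hv'
    simp only [Finset.mem_singleton] at this
    subst this; simp
  | cons k u =>
    rw [fockStep] at hv'
    rcases Finset.mem_union.1 (Finsupp.support_add hv') with h | h
    · have := Finsupp.support_single_subset h
      simp only [Finset.mem_singleton] at this
      subst this; simp at hu' ⊢; omega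
    · split_ifs at h
      · have := Finsupp.support_single_subset h
        simp only [Finset.mem_singleton] at this
        subst this; simp at hu' ⊢; omega
      · simp at h

lemma length_le_of_mem_support_fockVec (w : List (Fin d)) :
    ∀ v ∈ (fockVec w).support, v.length ≤ w.length := by
  induction w with
  | nil =>
    intro v hv
    have := Finsupp.support_single_subset hv
    simp only [Finset.mem_singleton] at this
    simp [this]
  | cons j w ih => exact fockShift_support ih

/-- The bilinear pairing for which the words are orthonormal. -/
def fockPairing : (List (Fin d) →₀ ℕ) →ₗ[ℕ] (List (Fin d) →₀ ℕ) →ₗ[ℕ] ℕ :=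
  Finsupp.linearCombination ℕ fun v => Finsupp.lapply v

lemma fockPairing_single (v : List (Fin d)) (g : List (Fin d) →₀ ℕ) :
    fockPairing (Finsupp.single v 1) g = g v := by
  simp [fockPairing]

lemma fockPairing_apply (f g : List (Fin d) →₀ ℕ) {T : Finset (List (Fin d))} (hT : f.support ⊆ T) :
    fockPairing f g = ∑ v ∈ T, f v * g v := by
  rw [fockPairing, Finsupp.linearCombination_apply, Finsupp.sum_of_support_subset _ hT _ (by simp)]
  simp [LinearMap.sum_apply]

/-- Creation and annihilation of the letter `j` are adjoint to each other in the word basis. -/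
lemma fockPairing_shift (j : Fin d) (f g : List (Fin d) →₀ ℕ) :
    fockPairing (fockShift j f) g = fockPairing f (fockShift j g) := by
  have h : fockPairing ∘ₗ fockShift j = fockPairing.compl₂ (fockShift j) := by
    ext u w
    simp only [LinearMap.coe_comp, Function.comp_apply, Finsupp.lsingle_apply, LinearMap.compl₂_apply,
      fockPairing_single, fockShift, Finsupp.linearCombination_single, one_smul]
    cases u with
    | nil =>
      rw [fockStep, fockPairing_single]
      cases w with
      | nil => simp [fockStep]
      | cons k w => by_cases h : k = j <;> simp [fockStep, Finsupp.single_apply, h, eq_comm]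
    | cons i u =>
      rw [fockStep, map_add, LinearMap.add_apply, fockPairing_single]
      have e : (fockPairing (if i = j then Finsupp.single u 1 else 0)) (Finsupp.single w 1)
          = if i = j ∧ w = u then 1 else 0 := by
        by_cases h : i = j <;> simp [h, fockPairing_single, Finsupp.single_apply]
      rw [e]
      cases w with
      | nil =>
        simp only [fockStep, Finsupp.single_apply]
        by_cases h : i = j <;> simp [h, eq_comm]
      | cons k w =>
        rw [fockStep, Finsupp.add_apply]
        by_cases h : i = j <;> by_cases h' : k = j <;>
          simp [h, h', Finsupp.single_apply, eq_comm, add_comm] <;> grind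
  exact LinearMap.congr_fun (LinearMap.congr_fun h f) g

/-- Symmetry of the shifts moves the letters of `u` across one at a time, hence in reverse order. -/
lemma fockPairing_fockVec (u w : List (Fin d)) :
    fockPairing (fockVec u) (fockVec w) = fockVec (u.reverse ++ w) [] := by
  induction u generalizing w with
  | nil => rw [fockVec, fockPairing_single]; rfl
  | cons j u ih =>
    rw [fockVec, fockPairing_shift]
    have := ih (j :: w)
    rw [fockVec] at this
    rw [this]; simp

/-- Along a run of equal letters the recursion of `chebWord` is the three-term recurrence of
`Chebyshev.S`; the hypothesis on the head of `v` ends the run there. -/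
lemma chebWord_replicate_append {B : Type*} [Ring B] [Algebra ℝ B] (a : Fin d → B) (j : Fin d)
    (v : List (Fin d)) (hv : v.head? ≠ some j) (k : ℕ) :
    chebWord a (List.replicate k j ++ v) = aeval (a j) (Chebyshev.S ℝ k) * chebWord a v := by
  induction k using Nat.twoStepInduction with
  | zero => simp
  | one =>
    cases v with
    | nil => simp [chebWord]
    | cons i v =>
      have : i ≠ j := by simpa using hv
      simp [chebWord, this]
  | more k h0 h1 =>
    have e : ((k + 2 : ℕ) : ℤ) = (k : ℤ) + 2 := by push_cast; ring
    rw [e, Chebyshev.S_add_two, map_sub, map_mul, aeval_X, sub_mul, ← h0, mul_assoc]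
    push_cast at h1
    rw [← h1]
    simp [List.replicate_succ, chebWord]

variable {A : Type*} [CStarAlgebra A] {τ : A →ₗ[ℂ] ℂ} {s : Fin d → A}

/-- Cut the word into maximal runs. A run of length `k ≥ 1` contributes `S_k(s_j)`, which is centred
under the semicircle law. The clause on heads ensures, in the induction, that neighbouring factors
belong to different letters. -/
lemma exists_alternating_chebWord (hs : IsFreeSemicircular τ s) (v : List (Fin d)) :
    ∃ l : List (Fin d × A), l.IsChain (fun p p' => p.1 ≠ p'.1) ∧
      (∀ p ∈ l, p.2 ∈ StarAlgebra.adjoin ℂ {s p.1} ∧ τ p.2 = 0) ∧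
      (l.map Prod.snd).prod = chebWord s v ∧ l.head?.map Prod.fst = v.head? := by
  induction hn : v.length using Nat.strong_induction_on generalizing v with
  | _ n ih =>
    cases v with
    | nil => exact ⟨[], by simp, by simp, by simp [chebWord], by simp⟩
    | cons j v =>
      set t := (j :: v).takeWhile (· = j) with ht
      set u := (j :: v).dropWhile (· = j) with hu
      have hsplit : t ++ u = j :: v := List.takeWhile_append_dropWhile
      have htr : t = List.replicate t.length j := by
        rw [List.eq_replicate_iff]
        refine ⟨rfl, fun b hb => ?_⟩
        have := List.mem_takeWhile_imp hb
        simpa using this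
      have ht0 : t.length ≠ 0 := by rw [ht]; simp
      have hu0 : u.head? ≠ some j := by
        intro h
        have := List.head?_dropWhile_not (fun x => decide (x = j)) (j :: v)
        rw [← hu, h] at this
        simp at this
      have hlen : u.length < n := by
        have := congrArg List.length hsplit
        rw [List.length_append, hn] at this
        omega
      obtain ⟨l, h1, h2, h3, h4⟩ := ih u.length hlen u rfl
      refine ⟨(j, aeval (s j) (Chebyshev.S ℝ (t.length : ℤ))) :: l, ?_, ?_, ?_, by simp⟩
      · rw [List.isChain_cons]
        refine ⟨fun p hp h => ?_, h1⟩
        rw [Option.mem_def] at hp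
        rw [hp] at h4
        apply hu0
        rw [← h4]; simp [← h]
      · intro p hp
        rcases List.mem_cons.1 hp with rfl | hp
        · refine ⟨?_, trace_aeval_S_of_isSemicircular (hs.semicircular j) ht0⟩
          have hmem : s j ∈ StarAlgebra.adjoin ℂ {s j} := StarAlgebra.self_mem_adjoin_singleton ℂ (s j)
          simp only
          rw [Polynomial.aeval_eq_sum_range]
          refine sum_mem fun i _ => ?_
          rw [← Complex.coe_smul]
          exact SMulMemClass.smul_mem _ (pow_mem hmem i)
        · exact h2 p hp
      · rw [List.map_cons, List.prod_cons, h3, ← hsplit, htr, chebWord_replicate_append s j u hu0]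
        simp

lemma trace_chebWord (hτ : IsFaithfulTrace τ) (hs : IsFreeSemicircular τ s) (v : List (Fin d)) :
    τ (chebWord s v) = if v = [] then 1 else 0 := by
  split_ifs with h
  · rw [h, chebWord, hτ.map_one]
  · obtain ⟨l, h1, h2, h3, h4⟩ := exists_alternating_chebWord hs v
    rw [← h3]
    refine hs.free l ?_ h1 h2
    rintro rfl
    apply h
    cases v <;> simp_all

lemma trace_prod_map (hτ : IsFaithfulTrace τ) (hs : IsFreeSemicircular τ s) (w : List (Fin d)) :
    τ (w.map s).prod = (fockVec w [] : ℂ) := by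
  rw [prod_map_eq_fockVec, Finsupp.linearCombination_apply, Finsupp.sum, map_sum]
  simp only [map_nsmul, trace_chebWord hτ hs]
  simp +contextual

lemma star_prod_map {B : Type*} [Ring B] [StarRing B] {a : Fin d → B} (ha : ∀ j, star (a j) = a j)
    (w : List (Fin d)) : star (w.map a).prod = (w.reverse.map a).prod := by
  induction w with
  | nil => simp
  | cons j w ih => simp [ih, ha]

/-- In the spectral order `‖b‖² - b*b` is positive, hence of the form `c*c`, and `τ` is nonnegative
on it. -/
lemma trace_re_star_mul_self_le (hτ : IsFaithfulTrace τ) (b : A) :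
    (τ (star b * b)).re ≤ ‖b‖ ^ 2 := by
  let _ := CStarAlgebra.spectralOrder A
  have := CStarAlgebra.spectralOrderedRing A
  have h := CStarAlgebra.star_mul_le_algebraMap_norm_sq (a := b)
  rw [← sub_nonneg, CStarAlgebra.nonneg_iff_eq_star_mul_self] at h
  obtain ⟨c, hc⟩ := h
  have := (hτ.nonneg c).1
  rw [← hc, map_sub, Algebra.algebraMap_eq_smul_one, ← Complex.coe_smul, map_smul, hτ.map_one,
    Complex.sub_re, smul_eq_mul, mul_one, Complex.ofReal_re] at this
  linarith

/-- The words of length at most `q`. -/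
def wordsUpTo (d : ℕ) : ℕ → Finset (List (Fin d))
  | 0 => {[]}
  | q + 1 => insert [] ((Finset.univ ×ˢ wordsUpTo d q).image fun p => p.1 :: p.2)

lemma mem_wordsUpTo {q : ℕ} {v : List (Fin d)} : v ∈ wordsUpTo d q ↔ v.length ≤ q := by
  induction q generalizing v with
  | zero => simp [wordsUpTo]
  | succ q ih => cases v <;> simp [wordsUpTo, ih]

lemma sum_wordsUpTo_le (hd : 1 ≤ d) {y : ℝ} (hy : 1 ≤ y) (q : ℕ) :
    ∑ v ∈ wordsUpTo d q, y ^ v.length ≤ (2 * d * y) ^ q := by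
  have hd' : (1 : ℝ) ≤ d := by exact_mod_cast hd
  have hdy : 1 ≤ d * y := by nlinarith
  induction q with
  | zero => simp [wordsUpTo]
  | succ q ih =>
    rw [wordsUpTo, Finset.sum_insert (by simp), Finset.sum_image (by
      rintro ⟨a, b⟩ - ⟨a', b'⟩ - h; simpa using h), Finset.sum_product]
    simp only [List.length_cons, pow_succ, List.length_nil, pow_zero, Finset.sum_const,
      Finset.card_univ, Fintype.card_fin, nsmul_eq_mul, ← Finset.sum_mul]
    have h1 : (1 : ℝ) ≤ (2 * d * y) ^ q := one_le_pow₀ (by nlinarith)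
    have h2 : (d : ℝ) * ((∑ v ∈ wordsUpTo d q, y ^ v.length) * y) ≤ d * y * (2 * d * y) ^ q := by
      calc _ = d * y * ∑ v ∈ wordsUpTo d q, y ^ v.length := by ring
        _ ≤ _ := mul_le_mul_of_nonneg_left ih (by linarith)
    nlinarith

lemma NCPoly.eval_eq_sum {B : Type*} [Ring B] [Algebra ℂ B] (a : Fin d → B) (P : NCPoly d) :
    P.eval a = ∑ w ∈ P.coeff.support, P.coeff w • (w.toList.map a).prod := by
  rw [NCPoly.eval, MonoidAlgebra.lift_apply]
  simp only [FreeMonoid.lift_apply]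
  rfl

/-- The coefficients of a noncommutative polynomial in the Chebyshev basis. -/
def fockCoeff (P : NCPoly d) (v : List (Fin d)) : ℂ :=
  ∑ w ∈ P.coeff.support, P.coeff w * (fockVec w.toList v : ℂ)

lemma support_fockVec_subset {P : NCPoly d} {w : FreeMonoid (Fin d)} (hw : w ∈ P.coeff.support) :
    (fockVec w.toList).support ⊆ wordsUpTo d P.degree := by
  intro v hv
  rw [mem_wordsUpTo]
  exact (length_le_of_mem_support_fockVec _ v hv).trans
    (Finset.le_sup (f := FreeMonoid.length) hw)

lemma NCPoly.eval_eq_sum_chebWord {B : Type*} [Ring B] [Algebra ℂ B] (a : Fin d → B) (P : NCPoly d) :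
    P.eval a = ∑ v ∈ wordsUpTo d P.degree, fockCoeff P v • chebWord a v := by
  simp only [P.eval_eq_sum, fockCoeff, Finset.sum_smul]
  rw [Finset.sum_comm]
  refine Finset.sum_congr rfl fun w hw => ?_
  rw [prod_map_eq_fockVec, Finsupp.linearCombination_apply,
    Finsupp.sum_of_support_subset _ (support_fockVec_subset hw) _ (by simp), Finset.smul_sum]
  refine Finset.sum_congr rfl fun v _ => ?_
  rw [mul_smul, Nat.cast_smul_eq_nsmul]

/-- Parseval: the Chebyshev words at `s` are orthonormal in `L²(τ)`. It is checked on pairs of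
monomials, where the Fock pairing is a vacuum coefficient and thus the trace of `u*w`. -/
lemma sum_norm_sq_fockCoeff (hτ : IsFaithfulTrace τ) (hs : IsFreeSemicircular τ s) (P : NCPoly d) :
    ((∑ v ∈ wordsUpTo d P.degree, ‖fockCoeff P v‖ ^ 2 : ℝ) : ℂ)
      = τ (star (P.eval s) * P.eval s) := by
  have hL : ((∑ v ∈ wordsUpTo d P.degree, ‖fockCoeff P v‖ ^ 2 : ℝ) : ℂ)
      = ∑ u ∈ P.coeff.support, ∑ w ∈ P.coeff.support, star (P.coeff u) * P.coeff w *
          ((fockPairing (fockVec u.toList) (fockVec w.toList) : ℕ) : ℂ) := by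
    push_cast
    have : ∀ v, ((‖fockCoeff P v‖ : ℂ)) ^ 2 = ∑ u ∈ P.coeff.support, ∑ w ∈ P.coeff.support,
        star (P.coeff u) * P.coeff w * ((fockVec u.toList v : ℂ) * (fockVec w.toList v : ℂ)) := by
      intro v
      rw [← Complex.conj_mul', fockCoeff, map_sum, Finset.sum_mul_sum]
      refine Finset.sum_congr rfl fun u _ => Finset.sum_congr rfl fun w _ => ?_
      rw [map_mul, Complex.conj_natCast]
      simp only [RCLike.star_def]
      ring
    simp only [this]
    rw [Finset.sum_comm]
    refine Finset.sum_congr rfl fun u hu => ?_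
    rw [Finset.sum_comm]
    refine Finset.sum_congr rfl fun w _ => ?_
    rw [fockPairing_apply _ _ (support_fockVec_subset hu), ← Finset.mul_sum]
    push_cast
    rfl
  rw [hL, P.eval_eq_sum, star_sum, Finset.sum_mul_sum, map_sum]
  refine Finset.sum_congr rfl fun u _ => ?_
  rw [map_sum]
  refine Finset.sum_congr rfl fun w _ => ?_
  rw [fockPairing_fockVec, ← trace_prod_map hτ hs, star_smul,
    star_prod_map (fun j => (hs.semicircular j).1.star_eq), smul_mul_smul_comm, map_smul, smul_eq_mul,
    List.map_append, List.prod_append]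

lemma norm_chebWord_le {B : Type*} [NormedRing B] (h1 : ‖(1 : B)‖ ≤ 1) {a : Fin d → B} {R : ℝ}
    (hR : 0 ≤ R) (ha : ∀ j, ‖a j‖ ≤ R) :
    ∀ v : List (Fin d), ‖chebWord a v‖ ≤ (R + 1) ^ v.length
  | [] => by simpa [chebWord] using h1
  | [j] => by
    rw [chebWord]
    simpa using (ha j).trans (by linarith)
  | j :: k :: v => by
    have h2 := norm_chebWord_le h1 hR ha (k :: v)
    have h3 := norm_chebWord_le h1 hR ha v
    rw [chebWord]
    have h4 : ‖if k = j then chebWord a v else 0‖ ≤ (R + 1) ^ v.length := by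
      split_ifs
      · exact h3
      · rw [norm_zero]; positivity
    have h5 : (R + 1) ^ v.length ≤ (R + 1) ^ (k :: v).length :=
      pow_le_pow_right₀ (by linarith) (by simp)
    calc _ ≤ ‖a j * chebWord a (k :: v)‖ + ‖if k = j then chebWord a v else 0‖ := norm_sub_le _ _
      _ ≤ R * (R + 1) ^ (k :: v).length + (R + 1) ^ (k :: v).length :=
        add_le_add ((norm_mul_le _ _).trans (mul_le_mul (ha j) h2 (norm_nonneg _) hR)) (h4.trans h5)
      _ = _ := by rw [List.length_cons (a := j), pow_succ]; ring

/-- A noncommutative polynomial of bounded elements is controlled by its norm at a free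
semicircular family. -/
theorem norm_eval_sq_le (hτ : IsFaithfulTrace τ) (hs : IsFreeSemicircular τ s)
    {B : Type*} [NormedRing B] [NormedAlgebra ℂ B] (h1 : ‖(1 : B)‖ ≤ 1) {a : Fin d → B} {R : ℝ}
    (hR : 0 ≤ R) (ha : ∀ j, ‖a j‖ ≤ R) (P : NCPoly d) :
    ‖P.eval a‖ ^ 2 ≤ (2 * d * (R + 1) ^ 2) ^ P.degree * ‖P.eval s‖ ^ 2 := by
  -- The coefficients do not depend on where `P` is evaluated, so the family `s` controls them for
  -- the elements `a`.
  have hc : ∑ v ∈ wordsUpTo d P.degree, ‖fockCoeff P v‖ ^ 2 ≤ ‖P.eval s‖ ^ 2 := by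
    have := congrArg Complex.re (sum_norm_sq_fockCoeff hτ hs P)
    rw [Complex.ofReal_re] at this
    rw [this]
    exact trace_re_star_mul_self_le hτ _
  have hw : ∑ v ∈ wordsUpTo d P.degree, ((R + 1) ^ v.length) ^ 2
      ≤ (2 * d * (R + 1) ^ 2) ^ P.degree := by
    simp only [← pow_mul, mul_comm _ 2]
    simp only [pow_mul]
    rcases Nat.eq_zero_or_pos d with rfl | hd
    · have : P.degree = 0 := by
        refine Nat.le_zero.1 (Finset.sup_le fun w _ => ?_)
        rcases hw : w.toList with - | ⟨x, -⟩
        · exact (congrArg List.length hw).le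
        · exact x.elim0
      rw [this]; simp [wordsUpTo]
    · exact sum_wordsUpTo_le hd (by nlinarith) _
  have hn : ‖P.eval a‖ ≤ ∑ v ∈ wordsUpTo d P.degree, ‖fockCoeff P v‖ * (R + 1) ^ v.length := by
    rw [P.eval_eq_sum_chebWord]
    refine (norm_sum_le _ _).trans (Finset.sum_le_sum fun v _ => ?_)
    rw [norm_smul]
    exact mul_le_mul_of_nonneg_left (norm_chebWord_le h1 hR ha v) (norm_nonneg _)
  calc ‖P.eval a‖ ^ 2 ≤ (∑ v ∈ wordsUpTo d P.degree, ‖fockCoeff P v‖ * (R + 1) ^ v.length) ^ 2 :=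
        pow_le_pow_left₀ (norm_nonneg _) hn 2
    _ ≤ _ := Finset.sum_mul_sq_le_sq_mul_sq _ _ _
    _ ≤ ‖P.eval s‖ ^ 2 * (2 * d * (R + 1) ^ 2) ^ P.degree :=
        mul_le_mul hc hw (Finset.sum_nonneg fun _ _ => by positivity) (by positivity)
    _ = _ := mul_comm _ _

end Fock

/-! ### Hermitian matrices -/

section Hermitian

variable {N : ℕ} {A : Matrix (Fin N) (Fin N) ℂ}

lemma trace_aeval_eq_sum (hA : A.IsHermitian) (h : ℝ[X]) :
    (aeval A h).trace = ((∑ i, h.eval (hA.eigenvalues i) : ℝ) : ℂ) := by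
  rw [← cfc_polynomial (R := ℝ) h A hA.isSelfAdjoint, hA.cfc_eq, Matrix.IsHermitian.cfc,
    Unitary.conjStarAlgAut_apply, Matrix.trace_mul_cycle]
  simp [Matrix.trace_diagonal]

open scoped Matrix.Norms.L2Operator in
lemma l2_opNorm_eq_norm_eigenvalues (hA : A.IsHermitian) : ‖A‖ = ‖hA.eigenvalues‖ := by
  conv_lhs => rw [hA.spectral_theorem]
  rw [Unitary.conjStarAlgAut_apply, ← Unitary.coe_star, CStarRing.norm_mul_coe_unitary,
    CStarRing.norm_coe_unitary_mul, Matrix.l2_opNorm_diagonal]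
  simp [Pi.norm_def]

lemma abs_eval_le_supNorm {K x : ℝ} (hx : |x| ≤ K) (h : ℝ[X]) : |h.eval x| ≤ supNorm K h := by
  have hb : BddAbove (Set.range fun x : Set.Icc (-K) K => |h.eval (x : ℝ)|) := by
    have := isCompact_Icc (a := -K) (b := K) |>.bddAbove_image (f := fun x => |h.eval x|)
      h.continuous.abs.continuousOn
    rwa [Set.image_eq_range] at this
  exact le_ciSup hb ⟨x, abs_le.1 hx⟩

lemma supNorm_nonneg (K : ℝ) (h : ℝ[X]) : 0 ≤ supNorm K h :=
  Real.iSup_nonneg fun _ => abs_nonneg _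

open scoped Matrix.Norms.L2Operator in
lemma norm_ntr_aeval_le (hN : N ≠ 0) (hA : A.IsHermitian) {K : ℝ} (hK : ‖A‖ ≤ K) (h : ℝ[X]) :
    ‖ntr (aeval A h)‖ ≤ supNorm K h := by
  have hN' : (0 : ℝ) < N := by exact_mod_cast Nat.pos_of_ne_zero hN
  rw [ntr, trace_aeval_eq_sum hA, norm_mul, norm_inv, Complex.norm_natCast, Complex.norm_real,
    Real.norm_eq_abs, inv_mul_le_iff₀ hN']
  refine (Finset.abs_sum_le_sum_abs _ _).trans ?_
  refine (Finset.sum_le_card_nsmul _ _ (supNorm K h) fun i _ => abs_eval_le_supNorm ?_ h).trans ?_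
  · rw [l2_opNorm_eq_norm_eigenvalues hA] at hK
    exact (norm_le_pi_norm hA.eigenvalues i).trans hK
  · simp

open scoped Matrix.Norms.L2Operator in
lemma l2_opNorm_le_of_trace_pow_le (hA : A.IsHermitian) {k : ℕ} (hk : k ≠ 0) {R : ℝ} (hR : 0 ≤ R)
    (h : (A ^ (2 * k)).trace.re ≤ R ^ (2 * k)) : ‖A‖ ≤ R := by
  have e := trace_aeval_eq_sum hA (X ^ (2 * k))
  simp only [map_pow, aeval_X, eval_pow, eval_X] at e
  rw [e, Complex.ofReal_re] at h
  rw [l2_opNorm_eq_norm_eigenvalues hA, pi_norm_le_iff_of_nonneg hR]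
  intro i
  have h1 : hA.eigenvalues i ^ (2 * k) ≤ R ^ (2 * k) :=
    (Finset.single_le_sum (f := fun i => hA.eigenvalues i ^ (2 * k))
      (fun i _ => by rw [pow_mul]; positivity) (Finset.mem_univ i)).trans h
  rw [← (even_two_mul k).pow_abs] at h1
  exact le_of_pow_le_pow_left₀ (by omega) hR h1

lemma ntr_aeval_im (hA : A.IsHermitian) (h : ℝ[X]) : (ntr (aeval A h)).im = 0 := by
  rw [ntr, trace_aeval_eq_sum hA]
  simp

end Hermitian

/-! ### Noncommutative polynomials -/

section NCPolyLemmas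

variable {d : ℕ}

/-- Evaluation of noncommutative polynomials as an algebra homomorphism. -/
def NCPoly.evalHom {B : Type*} [Ring B] [Algebra ℂ B] (a : Fin d → B) : NCPoly d →ₐ[ℂ] B :=
  MonoidAlgebra.lift ℂ B (FreeMonoid (Fin d)) (FreeMonoid.lift a)

lemma NCPoly.eval_aeval {B : Type*} [Ring B] [Algebra ℂ B] [Algebra ℝ B] [IsScalarTower ℝ ℂ B]
    (a : Fin d → B) (P : NCPoly d) (h : ℝ[X]) : (aeval P h).eval a = aeval (P.eval a) h :=
  (aeval_algHom_apply ((NCPoly.evalHom a).restrictScalars ℝ) P h).symm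

lemma NCPoly.degree_le_iff {P : NCPoly d} {n : ℕ} :
    P.degree ≤ n ↔ ∀ w ∈ P.coeff.support, w.length ≤ n := Finset.sup_le_iff

lemma NCPoly.degree_mul_le (P Q : NCPoly d) : (P * Q).degree ≤ P.degree + Q.degree := by
  classical
  rw [NCPoly.degree_le_iff]
  intro w hw
  obtain ⟨u, hu, v, hv, rfl⟩ := Finset.mem_mul.1 (MonoidAlgebra.support_coeff_mul_subset P Q hw)
  rw [FreeMonoid.length_mul]
  exact add_le_add (Finset.le_sup (f := FreeMonoid.length) hu)
    (Finset.le_sup (f := FreeMonoid.length) hv)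

lemma NCPoly.degree_pow_le (P : NCPoly d) (k : ℕ) : (P ^ k).degree ≤ k * P.degree := by
  induction k with
  | zero =>
    rw [NCPoly.degree_le_iff]
    intro w hw
    rw [pow_zero, MonoidAlgebra.one_def, MonoidAlgebra.coeff_single] at hw
    have := Finsupp.support_single_subset hw
    rw [Finset.mem_singleton] at this
    simp [this]
  | succ k ih =>
    rw [pow_succ]
    refine (NCPoly.degree_mul_le _ _).trans ?_
    rw [add_mul, one_mul]
    omega

lemma NCPoly.degree_aeval_le (P : NCPoly d) {h : ℝ[X]} {q : ℕ} (hq : h.natDegree ≤ q) :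
    (aeval P h).degree ≤ P.degree * q := by
  classical
  rw [NCPoly.degree_le_iff, aeval_eq_sum_range]
  intro w hw
  rw [MonoidAlgebra.coeff_sum] at hw
  obtain ⟨k, hk, hw⟩ := Finset.mem_biUnion.1 (Finsupp.support_finsetSum hw)
  rw [MonoidAlgebra.coeff_smul] at hw
  have h1 := NCPoly.degree_le_iff.1 (NCPoly.degree_pow_le P k) w (Finsupp.support_smul hw)
  have hk' : k ≤ q := by have := Finset.mem_range.1 hk; omega
  calc _ ≤ k * P.degree := h1
    _ ≤ q * P.degree := Nat.mul_le_mul_right _ hk'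
    _ = _ := mul_comm _ _

lemma NCPoly.IsSelfAdj.star_eval {B : Type*} [Ring B] [StarRing B] [Algebra ℂ B] [StarModule ℂ B]
    {P : NCPoly d} (hP : P.IsSelfAdj) {a : Fin d → B} (ha : ∀ j, star (a j) = a j) :
    star (P.eval a) = P.eval a := by
  rw [NCPoly.eval_eq_sum, star_sum]
  have hmem : ∀ w ∈ P.coeff.support, w.reverse ∈ P.coeff.support := by
    intro w hw
    rw [Finsupp.mem_support_iff] at hw ⊢
    rw [hP]; simpa using hw
  refine Finset.sum_nbij' (fun w => w.reverse) (fun w => w.reverse) hmem hmem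
    (fun w _ => FreeMonoid.reverse_reverse) (fun w _ => FreeMonoid.reverse_reverse) fun w _ => ?_
  rw [star_smul, star_prod_map ha, hP]
  rfl

end NCPolyLemmas

/-! ### Trace polynomials -/

section TracePoly

variable {d N : ℕ}

/-- The normalized trace of a noncommutative polynomial as a formal polynomial in traces of
words. -/
def tracePoly (d : ℕ) : NCPoly d →ₗ[ℂ] MvPolynomial (List (Fin d)) ℂ :=
  (Finsupp.linearCombination ℂ fun w : FreeMonoid (Fin d) => MvPolynomial.X w.toList) ∘ₗ
    (MonoidAlgebra.coeffLinearEquiv ℂ).toLinearMap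

lemma tracePoly_apply (Q : NCPoly d) :
    tracePoly d Q = ∑ w ∈ Q.coeff.support, Q.coeff w • MvPolynomial.X w.toList := rfl

/-- Trace polynomials of GUE matrices in terms of the Gaussian coordinates. -/
def traceEval (d N : ℕ) :
    MvPolynomial (List (Fin d)) ℂ →ₐ[ℂ] MvPolynomial (Coord d N) ℂ :=
  MvPolynomial.aeval (wordTr N)

lemma traceEval_tracePoly (Q : NCPoly d) :
    traceEval d N (tracePoly d Q) = ∑ w ∈ Q.coeff.support, Q.coeff w • wordTr N w.toList := by
  simp [tracePoly_apply, traceEval]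

lemma evalReal_wordTr (x : Coord d N → ℝ) (w : List (Fin d)) :
    evalReal x (wordTr N w) = ntr (w.map (gueSample x)).prod := by
  have h : (wordMat N w).map (evalReal x) = (w.map (gueSample x)).prod := by
    have : (evalReal x : MvPolynomial (Coord d N) ℂ →ₐ[ℂ] ℂ).mapMatrix (wordMat N w)
        = (w.map (gueSample x)).prod := by
      rw [wordMat, map_list_prod, List.map_map]
      rfl
    exact this
  rw [wordTr, map_smul, ntr, ← h, smul_eq_mul]
  congr 1
  simp [Matrix.trace]

lemma evalReal_traceEval_tracePoly (x : Coord d N → ℝ) (Q : NCPoly d) :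
    evalReal x (traceEval d N (tracePoly d Q)) = ntr (Q.eval (gueSample x)) := by
  rw [traceEval_tracePoly, NCPoly.eval_eq_sum, ntr, Matrix.trace_sum, Finset.mul_sum, map_sum]
  refine Finset.sum_congr rfl fun w _ => ?_
  rw [map_smul, evalReal_wordTr, ntr, Matrix.trace_smul, smul_eq_mul, smul_eq_mul]
  ring

lemma totalDegree_wordTr_le (w : List (Fin d)) :
    MvPolynomial.totalDegree (wordTr N w) ≤ w.length := by
  have h : ∀ a b, MvPolynomial.totalDegree (wordMat N w a b) ≤ w.length := by
    induction w with
    | nil =>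
      intro a b
      rw [wordMat, List.map_nil, List.prod_nil, Matrix.one_apply]
      split_ifs <;> simp
    | cons j w ih =>
      intro a b
      rw [wordMat, List.map_cons, List.prod_cons, Matrix.mul_apply]
      refine MvPolynomial.totalDegree_finsetSum_le fun c _ => ?_
      refine (MvPolynomial.totalDegree_mul _ _).trans ?_
      rw [List.length_cons, add_comm]
      refine add_le_add (ih c b) ?_
      rw [gueMat, Matrix.of_apply]
      refine MvPolynomial.totalDegree_finsetSum_le fun p _ => ?_
      exact (MvPolynomial.totalDegree_smul_le _ _).trans (MvPolynomial.totalDegree_X _).le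
  rw [wordTr]
  refine (MvPolynomial.totalDegree_smul_le _ _).trans ?_
  exact MvPolynomial.totalDegree_finsetSum_le fun a _ => h a a

lemma totalDegree_traceEval_tracePoly_le (Q : NCPoly d) :
    MvPolynomial.totalDegree (traceEval d N (tracePoly d Q)) ≤ Q.degree := by
  rw [traceEval_tracePoly]
  refine MvPolynomial.totalDegree_finsetSum_le fun w hw => ?_
  exact (MvPolynomial.totalDegree_smul_le _ _).trans
    ((totalDegree_wordTr_le _).trans (Finset.le_sup (f := FreeMonoid.length) hw))

variable {r : ℕ}

/-- The product `tr h₁(P₁) ⋯ tr h_r(P_r)` as a formal trace polynomial. -/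
def multiTracePoly (P : Fin r → NCPoly d) (h : Fin r → ℝ[X]) : MvPolynomial (List (Fin d)) ℂ :=
  ∏ i, tracePoly d (aeval (P i) (h i))

lemma evalReal_multiTracePoly (P : Fin r → NCPoly d) (h : Fin r → ℝ[X]) (x : Coord d N → ℝ) :
    evalReal x (traceEval d N (multiTracePoly P h)) = multiTrace P h (gueSample x) := by
  simp only [multiTracePoly, multiTrace, map_prod, evalReal_traceEval_tracePoly, NCPoly.eval_aeval]

lemma totalDegree_multiTracePoly_le (P : Fin r → NCPoly d) {q : Fin r → ℕ} {h : Fin r → ℝ[X]}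
    (hq : ∀ i, (h i).natDegree ≤ q i) :
    MvPolynomial.totalDegree (traceEval d N (multiTracePoly P h)) ≤ totalDegree P q := by
  rw [multiTracePoly, map_prod]
  refine (MvPolynomial.totalDegree_finsetProd _ _).trans (Finset.sum_le_sum fun i _ => ?_)
  exact (totalDegree_traceEval_tracePoly_le _).trans (NCPoly.degree_aeval_le _ (hq i))

end TracePoly

/-! ### The a priori bound -/

section RealPart

variable {ι : Type*} [Fintype ι]

/-- The coefficientwise real part. -/
def realPart (p : MvPolynomial ι ℂ) : MvPolynomial ι ℝ :=
  ∑ α ∈ p.support, MvPolynomial.monomial α (p.coeff α).re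

lemma evalReal_realPart (p : MvPolynomial ι ℂ) (x : ι → ℝ) :
    evalReal x (realPart p) = (evalReal x p).re := by
  conv_rhs => rw [p.as_sum]
  rw [realPart, map_sum, map_sum, Complex.re_sum]
  refine Finset.sum_congr rfl fun α _ => ?_
  rw [evalReal_monomial, evalReal_monomial]
  simp only [RCLike.ofReal_real_eq_id, id_eq]
  exact (Complex.re_mul_ofReal _ _).symm

lemma totalDegree_realPart_le (p : MvPolynomial ι ℂ) :
    (realPart p).totalDegree ≤ p.totalDegree := by
  refine MvPolynomial.totalDegree_finsetSum_le fun α hα => ?_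
  exact (MvPolynomial.totalDegree_monomial_le _ _).trans (MvPolynomial.le_totalDegree hα)

lemma gaussE_realPart (p : MvPolynomial ι ℂ) :
    gaussE ι ℝ (realPart p) = (gaussE ι ℂ p).re := by
  simp only [gaussE_apply, evalReal_realPart]
  exact integral_re (𝕜 := ℂ) (integrable_evalReal p)

end RealPart

/-! ### Norm control of GUE matrices and the bound on the mean -/

section APriori

variable {d N : ℕ}

/-- The event that the norm of some GUE matrix exceeds `R`, detected by a moment. -/
def badEvent (d N k : ℕ) (R : ℝ) : Set (Coord d N → ℝ) :=
  ⋃ j : Fin d, {x | R ^ (2 * k) / N ≤ (ntr (gueSample x j ^ (2 * k))).re}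

lemma ntr_gueSample_pow (x : Coord d N → ℝ) (j : Fin d) (k : ℕ) :
    ntr (gueSample x j ^ k) = evalReal x (wordTr N (List.replicate k j)) := by
  rw [evalReal_wordTr, List.map_replicate, List.prod_replicate]

lemma measurableSet_badEvent (d N k : ℕ) (R : ℝ) : MeasurableSet (badEvent d N k R) := by
  refine MeasurableSet.iUnion fun j => measurableSet_le measurable_const ?_
  simp only [ntr_gueSample_pow]
  exact (Complex.continuous_re.comp (continuous_evalReal _)).measurable

lemma norm_gaussE_wordTr_replicate_le (hN : N ≠ 0) (j : Fin d) {k : ℕ} (hk : k ≤ N) :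
    ‖gaussE (Coord d N) ℂ (wordTr N (List.replicate k j))‖ ≤ 2 * 6 ^ k := by
  have hN' : (1 : ℝ) ≤ N := by exact_mod_cast Nat.one_le_iff_ne_zero.2 hN
  have h := norm_gaussE_wordTrProd_le hN [List.replicate k j] (by simpa [totalLen] using hk)
  simp only [wordTrProd, List.map_cons, List.map_nil, List.prod_cons, List.prod_nil, mul_one,
    momBoundProd, List.length_replicate] at h
  refine h.trans ?_
  rw [momBound, mul_comm (2 : ℝ)]
  refine mul_le_mul_of_nonneg_left ?_ (by positivity)
  have h1 : 1 / ((k : ℝ) + 1) ^ 2 ≤ 1 := by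
    rw [div_le_one (by positivity)]
    have : (0 : ℝ) ≤ k := by positivity
    nlinarith
  have h2 : 1 / (N : ℝ) ≤ 1 := by rw [div_le_one (by linarith)]; exact hN'
  linarith

/-- Markov's inequality for the `2k`-th moment and a union bound over the `d` matrices; the factor
`N` is the price of detecting one eigenvalue by a normalized trace. -/
lemma measureReal_badEvent_le (hN : N ≠ 0) {k : ℕ} (hk : 2 * k ≤ N) {R : ℝ} (hR : 0 < R) :
    (stdGauss (Coord d N)).real (badEvent d N k R) ≤ d * (2 * 6 ^ (2 * k) * N / R ^ (2 * k)) := by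
  have hN' : (0 : ℝ) < N := by exact_mod_cast Nat.pos_of_ne_zero hN
  refine (measureReal_iUnion_fintype_le _).trans ?_
  have hcard : (d : ℝ) * (2 * 6 ^ (2 * k) * N / R ^ (2 * k))
      = ∑ _j : Fin d, 2 * 6 ^ (2 * k) * N / R ^ (2 * k) := by simp
  rw [hcard]
  refine Finset.sum_le_sum fun j _ => ?_
  have hInt : Integrable (fun x => (ntr (gueSample x j ^ (2 * k))).re) (stdGauss (Coord d N)) := by
    simp only [ntr_gueSample_pow]
    exact (integrable_evalReal (wordTr N (List.replicate (2 * k) j))).re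
  have hnn : ∀ x : Coord d N → ℝ, 0 ≤ (ntr (gueSample x j ^ (2 * k))).re := by
    intro x
    have e := trace_aeval_eq_sum (isHermitian_gueSample x j) (X ^ (2 * k))
    simp only [map_pow, aeval_X, eval_pow, eval_X] at e
    rw [ntr, e, ← Complex.ofReal_natCast, ← Complex.ofReal_inv, ← Complex.ofReal_mul,
      Complex.ofReal_re]
    refine mul_nonneg (by positivity) (Finset.sum_nonneg fun i _ => ?_)
    rw [pow_mul]; positivity
  have h1 := mul_meas_ge_le_integral_of_nonneg (Filter.Eventually.of_forall hnn) hInt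
    (R ^ (2 * k) / N)
  have h2 : ∫ x, (ntr (gueSample x j ^ (2 * k))).re ∂stdGauss (Coord d N) ≤ 2 * 6 ^ (2 * k) := by
    simp only [ntr_gueSample_pow]
    have h3 := integral_re (𝕜 := ℂ) (integrable_evalReal (wordTr N (List.replicate (2 * k) j)))
    refine le_trans (le_of_eq h3) ?_
    refine (Complex.re_le_norm _).trans ?_
    rw [← gaussE_apply]
    exact norm_gaussE_wordTr_replicate_le hN j hk
  have h3 := h1.trans h2
  rw [div_mul_eq_mul_div, div_le_iff₀ hN'] at h3
  rw [le_div_iff₀ (by positivity), mul_comm]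
  exact h3

open scoped Matrix.Norms.L2Operator in
lemma norm_gueSample_le_of_notMem_badEvent (hN : N ≠ 0) {k : ℕ} (hk : k ≠ 0) {R : ℝ} (hR : 0 ≤ R)
    {x : Coord d N → ℝ} (hx : x ∉ badEvent d N k R) (j : Fin d) : ‖gueSample x j‖ ≤ R := by
  have hN' : (0 : ℝ) < N := by exact_mod_cast Nat.pos_of_ne_zero hN
  refine l2_opNorm_le_of_trace_pow_le (isHermitian_gueSample x j) hk hR ?_
  simp only [badEvent, Set.mem_iUnion, Set.mem_ofPred_eq, not_exists, not_le] at hx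
  have h := hx j
  rw [ntr, ← Complex.ofReal_natCast, ← Complex.ofReal_inv, Complex.re_ofReal_mul, ← div_eq_inv_mul,
    div_lt_div_iff_of_pos_right hN'] at h
  exact h.le

/-- For `R = b√d` the factor `2d(R+1)²` of `norm_eval_sq_le` is at most `(Cd)²`, which explains the
form of the radius. -/
lemma norm_eval_le_radius {A : Type*} [CStarAlgebra A] {τ : A →ₗ[ℂ] ℂ} {s : Fin d → A}
    (hτ : IsFaithfulTrace τ) (hs : IsFreeSemicircular τ s)
    {B : Type*} [NormedRing B] [NormedAlgebra ℂ B] (h1 : ‖(1 : B)‖ ≤ 1) {a : Fin d → B} {b C : ℝ}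
    (hb : 0 ≤ b) (hC : 2 * (b + 1) ≤ C) (ha : ∀ j, ‖a j‖ ≤ b * √d) (P : NCPoly d) :
    ‖P.eval a‖ ≤ radius C s P := by
  have h := norm_eval_sq_le hτ hs h1 (by positivity) ha P
  have hC0 : 0 ≤ C := by linarith
  refine abs_le_of_sq_le_sq' (a := ‖P.eval a‖) (b := radius C s P) (h.trans ?_)
    (mul_nonneg (by positivity) (norm_nonneg _)) |>.2
  rw [radius, mul_pow ((C * d) ^ P.degree), ← pow_mul (C * d), mul_comm P.degree 2, pow_mul (C * d)]
  refine mul_le_mul_of_nonneg_right (pow_le_pow_left₀ (by positivity) ?_ _) (by positivity)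
  rcases Nat.eq_zero_or_pos d with rfl | hd
  · simp
  have hd' : (1 : ℝ) ≤ d := by exact_mod_cast hd
  have h2 : 1 ≤ √(d : ℝ) := Real.one_le_sqrt.2 hd'
  have h3 : b * √d + 1 ≤ (b + 1) * √d := by linarith
  calc 2 * d * (b * √d + 1) ^ 2 ≤ 2 * d * ((b + 1) * √d) ^ 2 := by gcongr
    _ = 2 * (b + 1) ^ 2 * d ^ 2 := by rw [mul_pow, Real.sq_sqrt (by positivity)]; ring
    _ ≤ C ^ 2 * d ^ 2 := by
      refine mul_le_mul_of_nonneg_right ?_ (by positivity)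
      nlinarith
    _ = _ := by ring

/-- The constant in the norm bound for GUE matrices outside of an exponentially small event. -/
def normConst : ℝ := 6 * 576 ^ 2

/-- Here `576 = 32 · 9 · 2`: the `32` absorbs `16 · 2`, the `9` the hypercontractive loss `9ᴰ`, the
`2` the dimension through `N ≤ 2ᴺ`. It enters `normConst` squared because the moment has order
`2⌊N/2⌋`, only guaranteed to be `N/2`. The factor `√d` yields `d⁻ᵏ`, which pays for the union bound.
-/
lemma badEvent_small (hN : 2 ≤ N) {D : ℕ} (hD : D ≤ N) :
    16 * 9 ^ D * (stdGauss (Coord d N)).real (badEvent d N (N / 2) (normConst * √d)) ≤ 1 := by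
  rcases Nat.eq_zero_or_pos d with rfl | hd
  · simp [badEvent]
  have hd' : (1 : ℝ) ≤ d := by exact_mod_cast hd
  have hsd : 0 < √(d : ℝ) := Real.sqrt_pos.2 (by linarith)
  set k := N / 2 with hk
  have hk1 : 1 ≤ k := by omega
  have hk4 : N ≤ 2 * (2 * k) := by omega
  have h := measureReal_badEvent_le (d := d) (N := N) (by omega) (k := k) (by omega)
    (R := normConst * √d) (by unfold normConst; positivity)
  have e : (d : ℝ) * (2 * 6 ^ (2 * k) * N / (normConst * √d) ^ (2 * k))
      = 2 * N * (d / d ^ k) / 576 ^ (2 * (2 * k)) := by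
    rw [normConst, mul_pow, mul_pow, pow_mul √(d : ℝ), Real.sq_sqrt (by positivity), ← pow_mul]
    field_simp
  rw [e] at h
  have h1 : (d : ℝ) / d ^ k ≤ 1 := by
    rw [div_le_one (by positivity)]
    exact le_self_pow₀ hd' (by omega)
  have h2 : (576 : ℝ) ^ N ≤ 576 ^ (2 * (2 * k)) := pow_le_pow_right₀ (by norm_num) hk4
  have h3 : 2 * (N : ℝ) * (d / d ^ k) / 576 ^ (2 * (2 * k)) ≤ 2 * N * 1 / 576 ^ N := by gcongr
  have h4 : (9 : ℝ) ^ D ≤ 9 ^ N := pow_le_pow_right₀ (by norm_num) hD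
  have h5 : (N : ℝ) ≤ 2 ^ N := by exact_mod_cast Nat.lt_two_pow_self.le
  have h6 : (32 : ℝ) ≤ 32 ^ N := le_self_pow₀ (by norm_num) (by omega)
  calc _ ≤ 16 * 9 ^ D * (2 * (N : ℝ) * 1 / 576 ^ N) := mul_le_mul_of_nonneg_left (h.trans h3) (by positivity)
    _ = 32 * (9 ^ D * N) / 576 ^ N := by ring
    _ ≤ 32 ^ N * (9 ^ N * 2 ^ N) / 576 ^ N := by gcongr
    _ = 1 := by
      rw [← mul_pow, ← mul_pow, div_eq_one_iff_eq (by positivity)]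
      norm_num

variable {r : ℕ}

/-- The expected product of traces is bounded by the product of the uniform norms. -/
theorem abs_re_gaussE_multiTracePoly_le {A : Type*} [CStarAlgebra A] {τ : A →ₗ[ℂ] ℂ} {s : Fin d → A}
    (hτ : IsFaithfulTrace τ) (hs : IsFreeSemicircular τ s) {P : Fin r → NCPoly d}
    (hP : ∀ i, (P i).IsSelfAdj) {q : Fin r → ℕ} {h : Fin r → ℝ[X]}
    (hq : ∀ i, (h i).natDegree ≤ q i) (hN : 2 ≤ N) (hD : totalDegree P q ≤ N) {C : ℝ}
    (hC : 2 * (normConst + 1) ≤ C) :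
    |(gaussE (Coord d N) ℂ (traceEval d N (multiTracePoly P h))).re|
      ≤ ∏ i, supNorm (radius C s (P i)) (h i) := by
  set M := ∏ i, supNorm (radius C s (P i)) (h i) with hM
  set f := traceEval d N (multiTracePoly P h) with hf
  have hb : 0 ≤ normConst := by unfold normConst; norm_num
  have hgood : ∀ x ∉ badEvent d N (N / 2) (normConst * √d), |(evalReal x f).re| ≤ M := by
    intro x hx
    refine (Complex.abs_re_le_norm _).trans ?_
    rw [hf, evalReal_multiTracePoly, multiTrace, norm_prod]
    refine Finset.prod_le_prod (fun i _ => norm_nonneg _) fun i _ => ?_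
    open scoped Matrix.Norms.L2Operator in
    have h1 : ‖(1 : Matrix (Fin N) (Fin N) ℂ)‖ ≤ 1 := by
      rw [← Matrix.diagonal_one, Matrix.l2_opNorm_diagonal]
      exact (pi_norm_le_iff_of_nonneg zero_le_one).2 fun i => by simp
    refine norm_ntr_aeval_le (by omega) ?_ ?_ _
    · exact (hP i).star_eval fun j => isHermitian_gueSample x j
    · exact norm_eval_le_radius hτ hs h1 hb hC
        (norm_gueSample_le_of_notMem_badEvent (by omega) (by omega) (by positivity) hx) (P i)
  have hdeg : (realPart f).totalDegree ≤ totalDegree P q :=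
    (totalDegree_realPart_le _).trans (totalDegree_multiTracePoly_le P hq)
  have hCM : gaussE (Coord d N) ℝ (MvPolynomial.C M) = M := by
    simp [gaussE_apply, evalReal]
  have hCd : (MvPolynomial.C M : MvPolynomial (Coord d N) ℝ).totalDegree ≤ totalDegree P q := by simp
  have hsmall := badEvent_small (d := d) hN hD
  have hmeas := measurableSet_badEvent d N (N / 2) (normConst * √d)
  have e1 : ∀ x, evalReal x (MvPolynomial.C M : MvPolynomial (Coord d N) ℝ) = M := by
    intro x; simp [evalReal]
  have h1 := gaussE_nonneg_of_nonneg_off (totalDegree P q) (MvPolynomial.C M - realPart f)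
    ((MvPolynomial.totalDegree_sub _ _).trans (max_le hCd hdeg)) hmeas (fun x hx => by
      rw [map_sub, e1, evalReal_realPart]
      linarith [(abs_le.1 (hgood x hx)).2]) hsmall
  have h2 := gaussE_nonneg_of_nonneg_off (totalDegree P q) (MvPolynomial.C M + realPart f)
    ((MvPolynomial.totalDegree_add _ _).trans (max_le hCd hdeg)) hmeas (fun x hx => by
      rw [map_add, e1, evalReal_realPart]
      linarith [(abs_le.1 (hgood x hx)).1]) hsmall
  rw [map_sub, hCM, gaussE_realPart] at h1
  rw [map_add, hCM, gaussE_realPart] at h2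
  exact abs_le.2 ⟨by linarith, by linarith⟩

lemma im_gaussE_multiTracePoly {P : Fin r → NCPoly d} (hP : ∀ i, (P i).IsSelfAdj)
    (h : Fin r → ℝ[X]) :
    (gaussE (Coord d N) ℂ (traceEval d N (multiTracePoly P h))).im = 0 := by
  have e := integral_im (𝕜 := ℂ) (integrable_evalReal (traceEval d N (multiTracePoly P h)))
  rw [gaussE_apply]
  refine (show _ = _ from e.symm).trans ?_
  have hz : ∀ x : Coord d N → ℝ, RCLike.im (evalReal x (traceEval d N (multiTracePoly P h))) = 0 := by
    intro x
    rw [evalReal_multiTracePoly, multiTrace]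
    have : ∀ i, ((ntr (aeval ((P i).eval (gueSample x)) (h i))).re : ℂ)
        = ntr (aeval ((P i).eval (gueSample x)) (h i)) := fun i => by
      apply Complex.ext
      · simp
      · rw [Complex.ofReal_im]
        exact (ntr_aeval_im ((hP i).star_eval fun j => isHermitian_gueSample x j) (h i)).symm
    have e2 := Finset.prod_congr (rfl : (Finset.univ : Finset (Fin r)) = _) fun i _ => this i
    rw [← e2, ← Complex.ofReal_prod]
    exact RCLike.ofReal_im (K := ℂ) _
  simp only [hz, integral_zero]

end APriori

/-! ### The asymptotic expansion -/

section Expansion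

variable {d N r : ℕ}

/-- The polynomial in `N⁻²` giving the expected product of the traces of several words. -/
def expansionPoly (ws : List (List (Fin d))) : ℝ[X] := (exists_isExpansion_wordTrProd ws).choose

lemma two_mul_natDegree_expansionPoly_le (ws : List (List (Fin d))) :
    2 * (expansionPoly ws).natDegree ≤ totalLen ws :=
  (exists_isExpansion_wordTrProd ws).choose_spec.1

lemma isExpansion_expansionPoly (ws : List (List (Fin d))) :
    IsExpansion (fun N => gaussE (Coord d N) ℂ (wordTrProd N ws)) (expansionPoly ws) :=
  (exists_isExpansion_wordTrProd ws).choose_spec.2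

/-- The polynomial in `N⁻²` giving the expectation of a trace polynomial. -/
def traceExpansion (d : ℕ) : MvPolynomial (List (Fin d)) ℂ →ₗ[ℂ] ℂ[X] :=
  (MvPolynomial.basisMonomials (List (Fin d)) ℂ).constr ℂ fun α =>
    (expansionPoly α.toMultiset.toList).map Complex.ofRealHom

lemma traceExpansion_monomial (α : List (Fin d) →₀ ℕ) :
    traceExpansion d (MvPolynomial.monomial α 1)
      = (expansionPoly α.toMultiset.toList).map Complex.ofRealHom := by
  have h := (MvPolynomial.basisMonomials (List (Fin d)) ℂ).constr_basis ℂ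
    (fun α => (expansionPoly α.toMultiset.toList).map Complex.ofRealHom) α
  rwa [MvPolynomial.coe_basisMonomials] at h

lemma traceEval_monomial (α : List (Fin d) →₀ ℕ) :
    traceEval d N (MvPolynomial.monomial α 1) = wordTrProd N α.toMultiset.toList := by
  rw [traceEval, MvPolynomial.aeval_monomial, map_one, one_mul, wordTrProd, ← Multiset.prod_coe,
    ← Multiset.map_coe, Multiset.coe_toList, Finsupp.toMultiset_map, Finsupp.prod_toMultiset,
    Finsupp.prod_mapDomain_index (by simp) (by simp [pow_add])]

/-- Both sides are linear, so monomials suffice. Working with formal trace polynomials, which do not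
know `N`, makes the expansion coefficients multilinear although `expansionPoly` is chosen separately
for each list of words. -/
lemma eval_traceExpansion (hN : N ≠ 0) (t : MvPolynomial (List (Fin d)) ℂ) :
    (traceExpansion d t).eval (((N : ℝ)⁻¹ ^ 2 : ℝ) : ℂ) = gaussE (Coord d N) ℂ (traceEval d N t) := by
  have h : (Polynomial.leval (((N : ℝ)⁻¹ ^ 2 : ℝ) : ℂ)) ∘ₗ traceExpansion d
      = gaussE (Coord d N) ℂ ∘ₗ (traceEval d N).toLinearMap := by
    refine (MvPolynomial.basisMonomials (List (Fin d)) ℂ).ext fun α => ?_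
    rw [MvPolynomial.coe_basisMonomials]
    simp only [LinearMap.coe_comp, Function.comp_apply, traceExpansion_monomial,
      AlgHom.toLinearMap_apply, traceEval_monomial, Polynomial.leval_apply, eval_map_ofReal]
    exact (isExpansion_expansionPoly _ N hN).symm
  exact LinearMap.congr_fun h t

/-- After expansion, each term picks one word from every `hᵢ(Pᵢ)`, and these have total length at
most `Σ q̃ᵢ qᵢ`. -/
lemma two_mul_natDegree_traceExpansion_le (P : Fin r → NCPoly d) {q : Fin r → ℕ} {h : Fin r → ℝ[X]}
    (hq : ∀ i, (h i).natDegree ≤ q i) :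
    2 * (traceExpansion d (multiTracePoly P h)).natDegree ≤ totalDegree P q := by
  suffices h : (traceExpansion d (multiTracePoly P h)).natDegree ≤ totalDegree P q / 2 by omega
  simp only [multiTracePoly, tracePoly_apply]
  rw [Finset.prod_univ_sum, map_sum]
  refine natDegree_sum_le_of_forall_le _ _ fun f hf => ?_
  rw [Fintype.mem_piFinset] at hf
  have e : ∏ i, (aeval (P i) (h i)).coeff (f i) • (MvPolynomial.X (f i).toList :
        MvPolynomial (List (Fin d)) ℂ)
      = (∏ i, (aeval (P i) (h i)).coeff (f i)) •
        MvPolynomial.monomial (∑ i, Finsupp.single (f i).toList 1) (1 : ℂ) := by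
    rw [Finset.prod_smul, MvPolynomial.monomial_sum_one]
    rfl
  rw [e, map_smul, traceExpansion_monomial]
  refine (natDegree_smul_le _ _).trans (natDegree_map_le.trans ?_)
  have h1 := two_mul_natDegree_expansionPoly_le
    (∑ i, Finsupp.single (f i).toList 1 : List (Fin d) →₀ ℕ).toMultiset.toList
  have h2 : totalLen (∑ i, Finsupp.single (f i).toList 1 : List (Fin d) →₀ ℕ).toMultiset.toList
      = ∑ i, (f i).length := by
    rw [totalLen, ← Multiset.sum_coe, ← Multiset.map_coe, Multiset.coe_toList, map_sum]
    have := map_sum (Multiset.sumAddMonoidHom.comp (Multiset.mapAddMonoidHom List.length))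
      (fun i => Finsupp.toMultiset (Finsupp.single (f i).toList 1)) Finset.univ
    refine (show _ = _ from this).trans (Finset.sum_congr rfl fun i _ => ?_)
    simp [Finsupp.toMultiset_single]
    rfl
  have h3 : ∑ i, (f i).length ≤ totalDegree P q := Finset.sum_le_sum fun i _ =>
    (Finset.le_sup (f := FreeMonoid.length) (hf i)).trans (NCPoly.degree_aeval_le (P i) (hq i))
  omega

/-- The coefficientwise real part of a complex polynomial. -/
def rePoly (p : ℂ[X]) : ℝ[X] := ∑ k ∈ p.support, monomial k (p.coeff k).re

lemma coeff_rePoly (p : ℂ[X]) (k : ℕ) : (rePoly p).coeff k = (p.coeff k).re := by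
  simp +contextual [rePoly, coeff_monomial]

lemma natDegree_rePoly_le (p : ℂ[X]) : (rePoly p).natDegree ≤ p.natDegree := by
  rw [natDegree_le_iff_coeff_eq_zero]
  intro k hk
  rw [coeff_rePoly, coeff_eq_zero_of_natDegree_lt hk, Complex.zero_re]

lemma eval_rePoly (p : ℂ[X]) (y : ℝ) : (rePoly p).eval y = (p.eval (y : ℂ)).re := by
  rw [eval_eq_sum_range' (Nat.lt_succ_of_le (natDegree_rePoly_le p)), eval_eq_sum_range,
    Complex.re_sum]
  refine Finset.sum_congr rfl fun k _ => ?_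
  rw [coeff_rePoly, ← Complex.ofReal_pow, Complex.re_mul_ofReal]

/-- The polynomial in `N⁻¹` giving the expected product of traces. -/
def meanPoly (P : Fin r → NCPoly d) (h : Fin r → ℝ[X]) : ℝ[X] :=
  expand ℝ 2 (rePoly (traceExpansion d (multiTracePoly P h)))

lemma natDegree_meanPoly_le (P : Fin r → NCPoly d) {q : Fin r → ℕ} {h : Fin r → ℝ[X]}
    (hq : ∀ i, (h i).natDegree ≤ q i) : (meanPoly P h).natDegree ≤ totalDegree P q := by
  rw [meanPoly, natDegree_expand]
  have h1 := natDegree_rePoly_le (traceExpansion d (multiTracePoly P h))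
  have h2 := two_mul_natDegree_traceExpansion_le P hq
  omega

lemma eval_neg_meanPoly (P : Fin r → NCPoly d) (h : Fin r → ℝ[X]) (y : ℝ) :
    (meanPoly P h).eval (-y) = (meanPoly P h).eval y := by
  simp [meanPoly, expand_eval]

lemma eval_meanPoly (P : Fin r → NCPoly d) (h : Fin r → ℝ[X]) (hN : N ≠ 0) :
    (meanPoly P h).eval ((N : ℝ)⁻¹)
      = (gaussE (Coord d N) ℂ (traceEval d N (multiTracePoly P h))).re := by
  rw [meanPoly, expand_eval, eval_rePoly, eval_traceExpansion hN]

/-- The coefficient functionals of the asymptotic expansion. -/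
def expansionCoeff (P : Fin r → NCPoly d) (m : ℕ) :
    MultilinearMap ℝ (fun _ : Fin r => ℝ[X]) ℝ :=
  if Even m then
    (Complex.reLm ∘ₗ (lcoeff ℂ (m / 2)).restrictScalars ℝ ∘ₗ
        (traceExpansion d).restrictScalars ℝ).compMultilinearMap
      ((MultilinearMap.mkPiAlgebra ℝ (Fin r) (MvPolynomial (List (Fin d)) ℂ)).compLinearMap
        fun i => (tracePoly d).restrictScalars ℝ ∘ₗ (aeval (P i)).toLinearMap)
  else 0

lemma expansionCoeff_apply (P : Fin r → NCPoly d) (m : ℕ) (h : Fin r → ℝ[X]) :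
    expansionCoeff P m h = (meanPoly P h).coeff m := by
  rw [meanPoly, coeff_expand two_pos, coeff_rePoly, expansionCoeff]
  simp only [even_iff_two_dvd]
  split_ifs
  · simp [multiTracePoly]
  · rfl

lemma expansionCoeff_of_odd (P : Fin r → NCPoly d) {m : ℕ} (hm : Odd m) :
    expansionCoeff P m = 0 := if_neg (Nat.not_even_iff_odd.2 hm)

end Expansion

/-! ### Transfer from Gaussian coordinates to arbitrary GUE families -/

section Expectation

variable {d N r : ℕ}

lemma measurable_prod_map_apply (w : List (Fin d)) (a b : Fin N) :
    Measurable fun G : Fin d → Matrix (Fin N) (Fin N) ℂ => (w.map G).prod a b := by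
  induction w generalizing a with
  | nil => exact measurable_const
  | cons j w ih =>
    simp only [List.map_cons, List.prod_cons, Matrix.mul_apply]
    refine Finset.measurable_sum _ fun c _ => Measurable.mul ?_ (ih c)
    exact (measurable_pi_apply c).comp ((measurable_pi_apply a).comp (measurable_pi_apply j))

lemma measurable_multiTrace (P : Fin r → NCPoly d) (h : Fin r → ℝ[X]) :
    Measurable fun G : Fin d → Matrix (Fin N) (Fin N) ℂ => multiTrace P h G := by
  unfold multiTrace
  refine Finset.measurable_prod _ fun i _ => ?_
  simp only [← NCPoly.eval_aeval]
  simp only [NCPoly.eval_eq_sum, ntr, Matrix.trace, Matrix.diag_apply,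
    Matrix.sum_apply, Matrix.smul_apply, smul_eq_mul]
  refine measurable_const.mul (Finset.measurable_sum _ fun a _ => Finset.measurable_sum _ fun w _ => ?_)
  exact measurable_const.mul (measurable_prod_map_apply _ a a)

lemma measurable_gueSample :
    Measurable (gueSample : (Coord d N → ℝ) → Fin d → Matrix (Fin N) (Fin N) ℂ) := by
  refine measurable_pi_lambda _ fun j => measurable_pi_lambda _ fun a => measurable_pi_lambda _ fun b => ?_
  exact (continuous_evalReal (gueMat d N j a b)).measurable

/-- The random variable is integrable and its mean is given by a Gaussian expectation. -/
theorem integrable_multiTrace_and_integral (P : Fin r → NCPoly d) (h : Fin r → ℝ[X]) (hN : N ≠ 0)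
    {Ω : Type*} [MeasurableSpace Ω] {μ : Measure Ω} [IsProbabilityMeasure μ]
    {G : Fin d → Ω → Matrix (Fin N) (Fin N) ℂ} (hG : IsIndepGUE μ G) :
    Integrable (fun ω => multiTrace P h (fun j => G j ω)) μ ∧
      ∫ ω, multiTrace P h (fun j => G j ω) ∂μ
        = gaussE (Coord d N) ℂ (traceEval d N (multiTracePoly P h)) := by
  have hGm : AEMeasurable (fun ω j => G j ω) μ :=
    aemeasurable_pi_lambda _ fun j => (hG.hasLaw j).aemeasurable
  have hΦ := measurable_multiTrace (N := N) P h
  have hlaw := map_eq_of_isIndepGUE hN hG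
  have hInt : Integrable (fun G => multiTrace P h G) (μ.map fun ω j => G j ω) := by
    rw [hlaw, integrable_map_measure hΦ.aestronglyMeasurable measurable_gueSample.aemeasurable]
    have := integrable_evalReal (traceEval d N (multiTracePoly P h))
    simp only [evalReal_multiTracePoly] at this
    exact this
  refine ⟨hInt.comp_aemeasurable hGm, ?_⟩
  rw [← integral_map hGm hΦ.aestronglyMeasurable (f := fun G => multiTrace P h G), hlaw,
    integral_map measurable_gueSample.aemeasurable hΦ.aestronglyMeasurable, gaussE_apply]
  simp only [evalReal_multiTracePoly]

end Expectation

end MultiTraceGUE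
end

/-! ### Assembly of the theorem -/

open MultiTraceGUE in
theorem proposition3p2 :
    ∃ C : ℝ, 0 < C ∧
      ∀ (d r : ℕ) (P : Fin r → NCPoly d), (∀ i, (P i).IsSelfAdj) →
      ∀ (A : Type*) [CStarAlgebra A] (τ : A →ₗ[ℂ] ℂ) (s : Fin d → A),
        IsFaithfulTrace τ → IsFreeSemicircular τ s →
      ∃ ν : ℕ → MultilinearMap ℝ (fun _ : Fin r => ℝ[X]) ℝ,
        (∀ (m : ℕ) (q : Fin r → ℕ) (h : Fin r → ℝ[X]),
          (∀ i, 1 ≤ q i) → (∀ i, (h i).natDegree ≤ q i) →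
          |ν m h| ≤ (C * totalDegree P q) ^ (2 * m) / (m ! : ℝ)
              * ∏ i, supNorm (radius C s (P i)) (h i) ∧
          ∀ N : ℕ, 1 ≤ N → C * totalDegree P q ≤ N →
          ∀ (Ω : Type*) [MeasurableSpace Ω] (μ : Measure Ω) [IsProbabilityMeasure μ]
            (G : Fin d → Ω → Matrix (Fin N) (Fin N) ℂ), IsIndepGUE μ G →
            Integrable (fun ω => multiTrace P h (fun j => G j ω)) μ ∧
            ‖(∫ ω, multiTrace P h (fun j => G j ω) ∂μ)
                - ∑ k ∈ Finset.range m, (ν k h : ℂ) / (N : ℂ) ^ k‖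
              ≤ (C * totalDegree P q) ^ (2 * m) / ((m ! : ℝ) * (N : ℝ) ^ m)
                * ∏ i, supNorm (radius C s (P i)) (h i)) ∧
        ∀ m, Odd m → ν m = 0 := by
  -- The threshold `2` ensures that `N ≥ 2D` with `D ≥ 1` gives both `N ≥ 2` and `N ≥ D`, as the a
  -- priori bound requires.
  obtain ⟨C₁, hC₁, hbound⟩ := exists_coeff_remainder_bound 2
  set C := max C₁ (2 * (normConst + 1)) with hC
  have hCC₁ : C₁ ≤ C := le_max_left _ _
  have hCn : 2 * (normConst + 1) ≤ C := le_max_right _ _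
  have hC0 : 0 < C := by linarith
  refine ⟨C, hC0, fun d r P hP A _ τ s hτ hs => ⟨expansionCoeff P, fun m q h _ hq => ?_,
    fun m hm => expansionCoeff_of_odd P hm⟩⟩
  set D := totalDegree P q with hD
  set M := ∏ i, supNorm (radius C s (P i)) (h i) with hM
  have hM0 : 0 ≤ M := Finset.prod_nonneg fun i _ => supNorm_nonneg _ _
  set f := meanPoly P h with hf
  have hfd : f.natDegree ≤ D := natDegree_meanPoly_le P hq
  have hfb : ∀ N : ℕ, 2 ≤ N → D ≤ N → |f.eval ((N : ℝ)⁻¹)| ≤ M := by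
    intro N hN hDN
    rw [hf, eval_meanPoly P h (by omega)]
    exact abs_re_gaussE_multiTracePoly_le hτ hs hP hq hN hDN hCn
  suffices hmain : |f.coeff m| ≤ (C * D) ^ (2 * m) / (m ! : ℝ) * M ∧
      ∀ N : ℕ, 1 ≤ N → C * D ≤ N →
        |f.eval ((N : ℝ)⁻¹) - ∑ k ∈ Finset.range m, f.coeff k / (N : ℝ) ^ k|
          ≤ (C * D) ^ (2 * m) / ((m ! : ℝ) * (N : ℝ) ^ m) * M by
    refine ⟨by rw [expansionCoeff_apply]; exact hmain.1, fun N hN hCN Ω _ μ _ G hG => ?_⟩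
    obtain ⟨h1, h2⟩ := integrable_multiTrace_and_integral P h (by omega) hG
    refine ⟨h1, ?_⟩
    have h3 : gaussE (Coord d N) ℂ (traceEval d N (multiTracePoly P h))
        = ((f.eval ((N : ℝ)⁻¹) : ℝ) : ℂ) := by
      rw [hf, eval_meanPoly P h (by omega)]
      apply Complex.ext
      · simp
      · rw [Complex.ofReal_im]; exact im_gaussE_multiTracePoly hP h
    rw [h2, h3]
    simp only [expansionCoeff_apply]
    refine le_trans (le_of_eq ?_) (hmain.2 N hN hCN)
    rw [← Real.norm_eq_abs, ← Complex.norm_real]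
    push_cast
    rfl
  -- If `D = 0`, every `N ≥ 1` is admissible, even `N = 1`, where `hfb` says nothing; but then `f`
  -- is constant and its value at `N = 2` decides.
  rcases Nat.eq_zero_or_pos D with hD0 | hD1
  · have hconst : f = Polynomial.C (f.coeff 0) := eq_C_of_natDegree_le_zero (by omega)
    have hcoef : ∀ k, k ≠ 0 → f.coeff k = 0 := fun k hk =>
      coeff_eq_zero_of_natDegree_lt (by omega)
    have heval : ∀ y, f.eval y = f.coeff 0 := fun y => by
      conv_lhs => rw [hconst, eval_C]
    have h0 : |f.coeff 0| ≤ M := by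
      have := hfb 2 le_rfl (by omega)
      rwa [heval] at this
    rcases Nat.eq_zero_or_pos m with rfl | hm
    · refine ⟨by simpa using h0, fun N _ _ => ?_⟩
      rw [heval]; simpa using h0
    · refine ⟨by rw [hcoef m (by omega), abs_zero]; positivity, fun N _ _ => ?_⟩
      rw [heval, Finset.sum_eq_single 0 (fun k _ hk => by rw [hcoef k hk, zero_div])
        (fun h => absurd (Finset.mem_range.2 hm) h), pow_zero, div_one, sub_self, abs_zero]
      positivity
  · obtain ⟨h1, h2⟩ := hbound D hD1 f hfd (eval_neg_meanPoly P h) M (fun N _ hN => by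
      have : 2 * D ≤ N := by exact_mod_cast hN
      exact hfb N (by omega) (by omega)) m
    have hmono : (C₁ * D) ^ (2 * m) ≤ (C * D) ^ (2 * m) :=
      pow_le_pow_left₀ (by positivity) (mul_le_mul_of_nonneg_right hCC₁ (by positivity)) _
    refine ⟨h1.trans ?_, fun N hN hCN => (h2 N hN ?_).trans ?_⟩
    · gcongr
    · refine le_trans ?_ hCN
      exact mul_le_mul_of_nonneg_right (by linarith) (by positivity)
    · gcongr
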